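/- Theorem (The first variation formula and the generalized divergence theorem). Let $M\subset\mathbf{R}^n$ be a compact smooth embedded $m$-dimensional submanifold of $\mathbf{R}^n$, possibly with (smooth) boundary $\partial M$. Let $\varepsilon>0$ and let $\phi_t:M\to\mathbf{R}^n$, $t\in(-\varepsilon,\varepsilon)$, be a smooth one-parameter family of smooth maps, i.e. $(t,p)\mapsto\phi_t(p)$ is smooth on $(-\varepsilon,\varepsilon)\times M$, such that $\phi_0(p)=p$ for all $p\in M$. Let $X(p)=\left(\frac{d}{dt}\right)_{t=0}\phi_t(p)$, $p\in M$, be the initial velocity vector field. For a subset $S$ of $\mathbf{R}^n$, let $\operatorname{area}(S)$ denote its $m$-dimensional Hausdorff measure (normalized to agree with Lebesgue measure on $m$-planes); let $dS$ and $ds$ denote integration with respect to $m$-dimensional and $(m-1)$-dimensional Hausdorff measure. Then $\operatorname{area}(\phi_tM)$ is finite for all $t$ near $0$ and differentiable in $t$ at $t=0$, the integrals below are of integrable functions, and $$\left(\frac{d}{dt}\right)_{t=0}\operatorname{area}(\phi_tM)=\int_M\operatorname{div}_MX\,dS=\int_{\partial M}X\cdot\nu_{\partial M}\,ds-\int_MH\cdot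 X\,dS .$$ Here: - $\operatorname{div}_MX(p)=\sum_{i=1}^m\mathbf e_i\cdot\nabla_{\mathbf e_i}X$ for any orthonormal basis $\mathbf e_1,\dots,\mathbf e_m$ of the tangent space $\operatorname{Tan}_pM$, where $\nabla_v$ is the ordinary directional derivative in $\mathbf{R}^n$ along $M$; - $H(p)=\sum_{i=1}^m \mathrm{II}_p(\mathbf e_i,\mathbf e_i)$ is the mean curvature vector of $M$ at $p$, the trace (not divided by $m$) of the second fundamental form $\mathrm{II}_p(u,v)=(\nabla_uV)^\perp$, where $V$ is a tangent vector field on $M$ with $V(p)=v$ and $\perp$ denotes the projection onto the orthogonal complement of $\operatorname{Tan}_pM$; - for $x\in\partial M$, $\nu_{\partial M}(x)$ is the (unique) unit vector in $\operatorname{Tan}_xM$ that is normal to $\partial M$ at $x$ and points away from $M$. -/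

import Mathlib

open Set MeasureTheory Topology
open scoped ContDiff

namespace FirstVariation

noncomputable section

/-- The coordinate `m`-plane `{y | y_m = ⋯ = y_{n-1} = 0}` of `ℝⁿ` (coordinates numbered from `0`). -/
def flatModel (n m : ℕ) : Set (EuclideanSpace ℝ (Fin n)) :=
  {y | ∀ i : Fin n, m ≤ (i : ℕ) → y i = 0}

/-- The closed half `{y | y_0 ≥ 0}` of the coordinate `m`-plane of `ℝⁿ`. -/
def halfModel (n m : ℕ) : Set (EuclideanSpace ℝ (Fin n)) :=
  {y | y ∈ flatModel n m ∧ ∀ i : Fin n, (i : ℕ) = 0 → 0 ≤ y i}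

/-- `Ψ` is a smooth diffeomorphism between two open subsets of `ℝⁿ`. -/
def IsSmoothChart {n : ℕ}
    (Ψ : OpenPartialHomeomorph (EuclideanSpace ℝ (Fin n)) (EuclideanSpace ℝ (Fin n))) : Prop :=
  ContDiffOn ℝ ∞ Ψ Ψ.source ∧ ContDiffOn ℝ ∞ Ψ.symm Ψ.target

/-- Near `p`, a smooth change of coordinates of `ℝⁿ` carries `M` to the coordinate `m`-plane. -/
def IsInteriorPt {n : ℕ} (m : ℕ) (M : Set (EuclideanSpace ℝ (Fin n)))
    (p : EuclideanSpace ℝ (Fin n)) : Prop :=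
  ∃ Ψ : OpenPartialHomeomorph (EuclideanSpace ℝ (Fin n)) (EuclideanSpace ℝ (Fin n)),
    p ∈ Ψ.source ∧ IsSmoothChart Ψ ∧ ∀ x ∈ Ψ.source, x ∈ M ↔ Ψ x ∈ flatModel n m

/-- Near `p`, a smooth change of coordinates of `ℝⁿ` carries `M` to the closed half of the
coordinate `m`-plane, and `p` to a point of the edge of this half-plane. -/
def IsBoundaryPt {n : ℕ} (m : ℕ) (M : Set (EuclideanSpace ℝ (Fin n)))
    (p : EuclideanSpace ℝ (Fin n)) : Prop :=
  0 < m ∧ ∃ Ψ : OpenPartialHomeomorph (EuclideanSpace ℝ (Fin n)) (EuclideanSpace ℝ (Fin n)),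
    p ∈ Ψ.source ∧ IsSmoothChart Ψ ∧ (∀ x ∈ Ψ.source, x ∈ M ↔ Ψ x ∈ halfModel n m) ∧
      ∀ i : Fin n, (i : ℕ) = 0 → Ψ p i = 0

/-- `M` is a smooth embedded `m`-dimensional submanifold of `ℝⁿ`, possibly with boundary. -/
def IsSubmanifold {n : ℕ} (m : ℕ) (M : Set (EuclideanSpace ℝ (Fin n))) : Prop :=
  m ≤ n ∧ ∀ p ∈ M, IsInteriorPt m M p ∨ IsBoundaryPt m M p

/-- The manifold boundary `∂M` of an `m`-dimensional submanifold `M` of `ℝⁿ`. -/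
def bdry {n : ℕ} (m : ℕ) (M : Set (EuclideanSpace ℝ (Fin n))) : Set (EuclideanSpace ℝ (Fin n)) :=
  {p | p ∈ M ∧ IsBoundaryPt m M p}

/-- The tangent space `Tan_p M`, as a linear subspace of `ℝⁿ`. -/
def Tan {n : ℕ} (M : Set (EuclideanSpace ℝ (Fin n))) (p : EuclideanSpace ℝ (Fin n)) :
    Submodule ℝ (EuclideanSpace ℝ (Fin n)) :=
  Submodule.span ℝ (tangentConeAt ℝ M p)

/-- The `m`-dimensional area of a subset of `ℝⁿ`: its `m`-dimensional Hausdorff measure, normalized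
to agree with Lebesgue measure on `m`-planes. -/
def area {n : ℕ} (m : ℕ) (S : Set (EuclideanSpace ℝ (Fin n))) : ℝ :=
  (Measure.euclideanHausdorffMeasure m S).toReal

/-- The derivative `∇_v X (p)` of a map `X : M → ℝⁿ` in a direction `v ∈ Tan_p M`. Only the values
of `X` on `M` matter; on `Tan_p M` all derivatives of `X` within `M` at `p` agree. -/
def nabla {n : ℕ} (M : Set (EuclideanSpace ℝ (Fin n)))
    (X : EuclideanSpace ℝ (Fin n) → EuclideanSpace ℝ (Fin n))
    (p v : EuclideanSpace ℝ (Fin n)) : EuclideanSpace ℝ (Fin n) :=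
  fderivWithin ℝ X M p v

/-- The divergence `div_M X (p) = ∑ᵢ eᵢ · ∇_{eᵢ} X` for an orthonormal basis `eᵢ` of `Tan_p M`
(see `divM_eq_sum` for the independence of the basis). -/
def divM {n : ℕ} (M : Set (EuclideanSpace ℝ (Fin n)))
    (X : EuclideanSpace ℝ (Fin n) → EuclideanSpace ℝ (Fin n))
    (p : EuclideanSpace ℝ (Fin n)) : ℝ :=
  ∑ i, inner ℝ (stdOrthonormalBasis ℝ (Tan M p) i : EuclideanSpace ℝ (Fin n))
    (nabla M X p (stdOrthonormalBasis ℝ (Tan M p) i))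

theorem divM_eq_sum {n : ℕ} {ι : Type*} [Fintype ι] (M : Set (EuclideanSpace ℝ (Fin n)))
    (X : EuclideanSpace ℝ (Fin n) → EuclideanSpace ℝ (Fin n)) (p : EuclideanSpace ℝ (Fin n))
    (e : OrthonormalBasis ι ℝ (Tan M p)) :
    divM M X p = ∑ i, inner ℝ (e i : EuclideanSpace ℝ (Fin n)) (nabla M X p (e i)) := by
  have key : ∀ {κ : Type _} [Fintype κ] (b : OrthonormalBasis κ ℝ (Tan M p)),
      LinearMap.trace ℝ (Tan M p) ((Tan M p).orthogonalProjectionOnto.toLinearMap ∘ₗ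
        (fderivWithin ℝ X M p).toLinearMap ∘ₗ (Tan M p).subtype) =
      ∑ i, inner ℝ (b i : EuclideanSpace ℝ (Fin n)) (nabla M X p (b i)) := by
    intro κ _ b
    rw [LinearMap.trace_eq_sum_inner _ b]
    simp [nabla]
  have key' := LinearMap.trace_eq_sum_inner ((Tan M p).orthogonalProjectionOnto.toLinearMap ∘ₗ
        (fderivWithin ℝ X M p).toLinearMap ∘ₗ (Tan M p).subtype) e
  rw [divM, ← key (stdOrthonormalBasis ℝ (Tan M p)), key']
  simp [nabla]

/-- The second fundamental form `II_p(u, v) = (∇_u V)^⊥` of `M`, where `V` is the extension of the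
tangent vector `v ∈ Tan_p M` to the tangent vector field `V(x) = proj_{Tan_x M} v` on `M`. -/
def secondFundamentalForm {n : ℕ} (M : Set (EuclideanSpace ℝ (Fin n)))
    (p u v : EuclideanSpace ℝ (Fin n)) : EuclideanSpace ℝ (Fin n) :=
  (Tan M p)ᗮ.starProjection (nabla M (fun x => (Tan M x).starProjection v) p u)

/-- The mean curvature vector `H(p) = ∑ᵢ II_p(eᵢ, eᵢ) = ∑ᵢ (∇_{eᵢ} eᵢ)^⊥`, the trace (not the
average) of the second fundamental form. -/
def meanCurvature {n : ℕ} (M : Set (EuclideanSpace ℝ (Fin n))) (p : EuclideanSpace ℝ (Fin n)) :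
    EuclideanSpace ℝ (Fin n) :=
  ∑ i, secondFundamentalForm M p (stdOrthonormalBasis ℝ (Tan M p) i)
    (stdOrthonormalBasis ℝ (Tan M p) i)

/-- `ν` is a unit vector in `Tan_p M` that is normal to `∂M` at `p` and points away from `M`, that
is, it is not the limit of a sequence `c_k • (x_k - p)` with `x_k ∈ M`, `x_k → p` and `c_k ≥ 0`. -/
def IsOutwardConormal {n : ℕ} (m : ℕ) (M : Set (EuclideanSpace ℝ (Fin n)))
    (p ν : EuclideanSpace ℝ (Fin n)) : Prop :=
  ‖ν‖ = 1 ∧ ν ∈ Tan M p ∧ (∀ w ∈ Tan (bdry m M) p, inner ℝ ν w = 0) ∧ ν ∉ posTangentConeAt M p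

end

end FirstVariation

/-! Everything is computed in parametrizations `f` of pieces of `M` by pieces of a half-space
(`IsPatch`). Derivatives within `M` are determined only along tangent directions, whereas
derivatives within the half-space are unique. With `A = Df` and its pseudo-inverse `A⁺ = (AᵀA)⁻¹Aᵀ`,
the operator `A A⁺` is the orthogonal projection to the tangent space, and `div_M X = tr (A⁺ D(X ∘
f))`.

First variation: for small `t` the map `φ t` is an injective immersion of `M` (`eventually_injOn`,
`eventually_injective_spaceDeriv`), so by the area formula `lintegral_jac_eq` the area of its image
is, locally, the integral of the volume factor `jac` of the space derivative of `φ t ∘ f`.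
Differentiation under the integral sign, Jacobi's formula `fderiv_jac` and the equality of mixed
derivatives produce the integrand `jac A * tr (A⁺ D(X ∘ f))`, that is, the divergence. Injectivity
makes the areas of disjoint pieces add up.

Divergence theorem: the field `W X` with `W = jac A • A⁺` lives on the half-space. By the product
rule its Euclidean divergence is `jac A * div_M X` plus a term linear in the value of `X`. That term
vanishes on tangent vectors, by Jacobi's formula and the symmetry of `D²f`; for general `v` it
therefore equals `jac A * tr (A⁺ D(A A⁺ v))`, which is `jac A * (H · v)` (`tr_weight_flip`,
`inner_meanCurvature`). The divergence theorem on the half-space leaves only an integral over the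
edge, and the base-times-height identity `jac_mul_norm` recognizes it as the flux of `X` through
`∂M` (`IsPatch.flux_eq`). A partition of unity globalizes the result. -/

namespace FirstVariation

noncomputable section

set_option linter.unusedSectionVars false

/-! ### Linear algebra: Gram operator, pseudo-inverse, Jacobi's formula. -/

section LinearAlgebra

variable {U V : Type*} [NormedAddCommGroup U] [InnerProductSpace ℝ U] [FiniteDimensional ℝ U]
  [NormedAddCommGroup V] [InnerProductSpace ℝ V] [FiniteDimensional ℝ V]

/-- The adjoint as a continuous `ℝ`-linear map. -/
def adjL (U V : Type*) [NormedAddCommGroup U] [InnerProductSpace ℝ U] [FiniteDimensional ℝ U]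
    [NormedAddCommGroup V] [InnerProductSpace ℝ V] [FiniteDimensional ℝ V] :
    (U →L[ℝ] V) →L[ℝ] (V →L[ℝ] U) :=
  LinearMap.toContinuousLinearMap
    { toFun := fun A => ContinuousLinearMap.adjoint A
      map_add' := fun A B => map_add _ A B
      map_smul' := fun c A => by simp }

/-- The Gram operator `AᵀA`. -/
def gram (A : U →L[ℝ] V) : U →L[ℝ] U := ContinuousLinearMap.adjoint A ∘L A

/-- The pseudo-inverse `(AᵀA)⁻¹Aᵀ`. -/
def pinv (A : U →L[ℝ] V) : V →L[ℝ] U := Ring.inverse (gram A) ∘L ContinuousLinearMap.adjoint A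

/-- The volume factor of a linear map. -/
def jac (A : U →L[ℝ] V) : ℝ := (A : U →ₗ[ℝ] V).normDet

/-- The trace of a continuous endomorphism, as a continuous linear functional. -/
def tr (U : Type*) [NormedAddCommGroup U] [InnerProductSpace ℝ U] [FiniteDimensional ℝ U] :
    (U →L[ℝ] U) →L[ℝ] ℝ :=
  LinearMap.toContinuousLinearMap
    ((LinearMap.trace ℝ U).comp (ContinuousLinearMap.coeLM ℝ : (U →L[ℝ] U) →ₗ[ℝ] (U →ₗ[ℝ] U)))

theorem tr_apply (A : U →L[ℝ] U) : tr U A = LinearMap.trace ℝ U A := rfl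

theorem tr_eq_sum_inner {ι : Type*} [Fintype ι] (b : OrthonormalBasis ι ℝ U) (A : U →L[ℝ] U) :
    tr U A = ∑ i, inner ℝ (b i) (A (b i)) := by
  rw [tr_apply, LinearMap.trace_eq_sum_inner _ b]
  rfl

theorem tr_comp_comm (A : U →L[ℝ] V) (B : V →L[ℝ] U) : tr U (B ∘L A) = tr V (A ∘L B) := by
  rw [tr_apply, tr_apply]
  exact (LinearMap.trace_comp_comm' (B : V →ₗ[ℝ] U) (A : U →ₗ[ℝ] V)).symm

theorem tr_adjoint (A : U →L[ℝ] U) : tr U (ContinuousLinearMap.adjoint A) = tr U A := by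
  rw [tr_eq_sum_inner (stdOrthonormalBasis ℝ U), tr_eq_sum_inner (stdOrthonormalBasis ℝ U)]
  refine Finset.sum_congr rfl fun i _ => ?_
  rw [ContinuousLinearMap.adjoint_inner_right, real_inner_comm]

theorem isUnit_of_injective {A : U →L[ℝ] U} (hA : Function.Injective A) : IsUnit A := by
  have h : IsUnit (A : U →ₗ[ℝ] U) := (LinearMap.isUnit_iff_ker_eq_bot _).2 (LinearMap.ker_eq_bot.2 hA)
  let E := (LinearEquiv.ofBijective (A : U →ₗ[ℝ] U)
    ⟨hA, LinearMap.range_eq_top.1 ((LinearMap.isUnit_iff_range_eq_top _).1 h)⟩).toContinuousLinearEquiv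
  refine ⟨⟨A, E.symm, ?_, ?_⟩, rfl⟩
  · ext x; exact E.apply_symm_apply x
  · ext x; exact E.symm_apply_apply x

theorem gram_apply (A : U →L[ℝ] V) (x : U) :
    gram A x = ContinuousLinearMap.adjoint A (A x) := rfl

theorem gram_injective {A : U →L[ℝ] V} (hA : Function.Injective A) :
    Function.Injective (gram A) := by
  rw [injective_iff_map_eq_zero]
  intro x hx
  have : inner ℝ (A x) (A x) = (0 : ℝ) := by
    rw [← ContinuousLinearMap.adjoint_inner_left, ← gram_apply, hx, inner_zero_left]
  exact hA (by rw [inner_self_eq_zero.1 this, map_zero])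

theorem isUnit_gram {A : U →L[ℝ] V} (hA : Function.Injective A) : IsUnit (gram A) :=
  isUnit_of_injective (gram_injective hA)

theorem pinv_comp_self {A : U →L[ℝ] V} (hA : Function.Injective A) :
    pinv A ∘L A = ContinuousLinearMap.id ℝ U :=
  Ring.inverse_mul_cancel _ (isUnit_gram hA)

theorem pinv_apply_self {A : U →L[ℝ] V} (hA : Function.Injective A) (x : U) :
    pinv A (A x) = x := DFunLike.congr_fun (pinv_comp_self hA) x

theorem gram_pinv {A : U →L[ℝ] V} (hA : Function.Injective A) (v : V) :
    gram A (pinv A v) = ContinuousLinearMap.adjoint A v :=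
  DFunLike.congr_fun (Ring.mul_inverse_cancel _ (isUnit_gram hA)) (ContinuousLinearMap.adjoint A v)

/-- The normal equations `AᵀA (A⁺v) = Aᵀv` say that the residual `v - A A⁺v` is orthogonal to the
range of `A`. -/
theorem self_pinv_eq_starProjection {A : U →L[ℝ] V} (hA : Function.Injective A) (v : V) :
    A (pinv A v) = (LinearMap.range (A : U →ₗ[ℝ] V)).starProjection v := by
  symm
  refine Submodule.eq_starProjection_of_mem_of_inner_eq_zero
    (LinearMap.mem_range_self (A : U →ₗ[ℝ] V) _) ?_
  rintro _ ⟨x, rfl⟩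
  have := gram_pinv hA v
  rw [gram_apply] at this
  change inner ℝ (v - A (pinv A v)) (A x) = 0
  rw [← ContinuousLinearMap.adjoint_inner_left, map_sub, this, sub_self, inner_zero_left]

theorem pinv_starProjection {A : U →L[ℝ] V} (hA : Function.Injective A) (v : V) :
    pinv A ((LinearMap.range (A : U →ₗ[ℝ] V)).starProjection v) = pinv A v := by
  rw [← self_pinv_eq_starProjection hA, pinv_apply_self hA]

theorem contDiff_gram {N : WithTop ℕ∞} : ContDiff ℝ N (gram : (U →L[ℝ] V) → (U →L[ℝ] U)) :=
  ((adjL U V).contDiff).clm_comp contDiff_id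

theorem contDiffAt_pinv {N : WithTop ℕ∞} {A : U →L[ℝ] V} (hA : Function.Injective A) :
    ContDiffAt ℝ N pinv A := by
  obtain ⟨u, hu⟩ := isUnit_gram hA
  have h1 : ContDiffAt ℝ N (fun B : U →L[ℝ] V => Ring.inverse (gram B)) A := by
    refine ContDiffAt.comp A (g := Ring.inverse) ?_ contDiff_gram.contDiffAt
    rw [← hu]
    exact contDiffAt_ringInverse ℝ u
  exact h1.clm_comp ((adjL U V).contDiff).contDiffAt

theorem contDiff_det {N : WithTop ℕ∞} :
    ContDiff ℝ N (fun A : U →L[ℝ] U => LinearMap.det (A : U →ₗ[ℝ] U)) := by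
  let b := (stdOrthonormalBasis ℝ U).toBasis
  have : (fun A : U →L[ℝ] U => LinearMap.det (A : U →ₗ[ℝ] U)) = fun A : U →L[ℝ] U =>
      ∑ σ : Equiv.Perm _, ((Equiv.Perm.sign σ : ℤ) : ℝ) *
        ∏ i, LinearMap.toMatrix b b (A : U →ₗ[ℝ] U) (σ i) i := by
    ext A
    rw [← LinearMap.det_toMatrix b, Matrix.det_apply']
  rw [this]
  refine ContDiff.sum fun σ _ => contDiff_const.mul (contDiff_prod fun i _ => ?_)
  let L : (U →L[ℝ] U) →ₗ[ℝ] ℝ :=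
    { toFun := fun A => LinearMap.toMatrix b b (A : U →ₗ[ℝ] U) (σ i) i
      map_add' := fun A B => by simp
      map_smul' := fun c A => by simp }
  exact L.toContinuousLinearMap.contDiff

/-- Factoring `G + tB = G (1 + t G⁻¹B)` reduces the claim to a perturbation of the identity, where
the linear coefficient of the determinant is the trace. -/
theorem hasDerivAt_det_line {G : U →L[ℝ] U} (hG : IsUnit G) (B : U →L[ℝ] U) :
    HasDerivAt (fun t : ℝ => LinearMap.det ((G + t • B : U →L[ℝ] U) : U →ₗ[ℝ] U))
      (LinearMap.det (G : U →ₗ[ℝ] U) * tr U (Ring.inverse G ∘L B)) 0 := by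
  let b := (stdOrthonormalBasis ℝ U).toBasis
  let C := Ring.inverse G ∘L B
  let M := LinearMap.toMatrix b b (C : U →ₗ[ℝ] U)
  have h1 : ∀ t : ℝ, LinearMap.det ((G + t • B : U →L[ℝ] U) : U →ₗ[ℝ] U) =
      LinearMap.det (G : U →ₗ[ℝ] U) * Matrix.det (1 + t • M) := by
    intro t
    have : (G + t • B : U →L[ℝ] U) = G * (1 + t • C) := by
      have : G * C = B := by
        change G * (Ring.inverse G * B) = B
        rw [← mul_assoc, Ring.mul_inverse_cancel _ hG, one_mul]
      rw [mul_add, mul_one, mul_smul_comm, this]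
    rw [this]
    change LinearMap.det ((G : U →ₗ[ℝ] U) * ((1 + t • C : U →L[ℝ] U) : U →ₗ[ℝ] U)) = _
    rw [map_mul, ← LinearMap.det_toMatrix b ((1 + t • C : U →L[ℝ] U) : U →ₗ[ℝ] U)]
    congr 2
    change LinearMap.toMatrix b b (1 + t • (C : U →ₗ[ℝ] U)) = _
    rw [map_add, map_smul]
    congr 1
    exact LinearMap.toMatrix_one b
  simp_rw [h1]
  refine HasDerivAt.const_mul _ ?_
  have h2 : tr U C = Matrix.trace M := by
    rw [tr_apply, ← LinearMap.trace_eq_matrix_trace]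
  rw [show tr U (Ring.inverse G ∘L B) = Matrix.trace M from h2]
  -- The terms of degree at least two are collected as a polynomial times `t ^ 2`, the form given by
  -- `Matrix.det_one_add_smul`; they do not affect the derivative at `0`.
  have h3 : HasDerivAt (fun t : ℝ => 1 + Matrix.trace M * t +
      Polynomial.eval t (Matrix.det (1 + (Polynomial.X : Polynomial ℝ) •
        M.map Polynomial.C)).divX.divX * t ^ 2) (Matrix.trace M) 0 := by
    have := (((hasDerivAt_id (0 : ℝ)).const_mul (Matrix.trace M)).const_add 1).add
      (((Matrix.det (1 + (Polynomial.X : Polynomial ℝ) •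
        M.map Polynomial.C)).divX.divX.hasDerivAt 0).mul ((hasDerivAt_id (0 : ℝ)).pow 2))
    simpa using! this
  refine h3.congr_of_eventuallyEq (Filter.Eventually.of_forall fun t => ?_)
  exact Matrix.det_one_add_smul t M

theorem jac_nonneg (A : U →L[ℝ] V) : 0 ≤ jac A := LinearMap.normDet_nonneg _

theorem jac_pos {A : U →L[ℝ] V} (hA : Function.Injective A) : 0 < jac A := by
  refine lt_of_le_of_ne (jac_nonneg A) fun h => ?_
  exact LinearMap.normDet_eq_zero_iff_ker_ne_bot.1 h.symm (LinearMap.ker_eq_bot.2 hA)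

theorem jac_sq (A : U →L[ℝ] V) : jac A ^ 2 = LinearMap.det (gram A : U →ₗ[ℝ] U) :=
  ContinuousLinearMap.normDet_sq A

theorem jac_eq_sqrt : (jac : (U →L[ℝ] V) → ℝ) =
    fun A => √(LinearMap.det (gram A : U →ₗ[ℝ] U)) := by
  ext A
  rw [← jac_sq, Real.sqrt_sq (jac_nonneg A)]

theorem continuous_jac : Continuous (jac : (U →L[ℝ] V) → ℝ) := by
  rw [jac_eq_sqrt]
  exact ((contDiff_det (N := 0)).continuous.comp (contDiff_gram (N := 0)).continuous).sqrt

/-- At an injective map the radicand `det (AᵀA)` is positive, so the square root is smooth there; in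
general `jac` is only continuous. -/
theorem contDiffAt_jac {N : WithTop ℕ∞} {A : U →L[ℝ] V} (hA : Function.Injective A) :
    ContDiffAt ℝ N jac A := by
  rw [jac_eq_sqrt]
  refine ContDiffAt.sqrt ((contDiff_det.comp contDiff_gram).contDiffAt) ?_
  rw [← jac_sq]
  exact pow_ne_zero _ (jac_pos hA).ne'

/-- Jacobi's formula for the volume factor. -/
theorem fderiv_jac {A : U →L[ℝ] V} (hA : Function.Injective A) (B : U →L[ℝ] V) :
    fderiv ℝ jac A B = jac A * tr U (pinv A ∘L B) := by
  have hJ : HasFDerivAt jac (fderiv ℝ jac A) A :=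
    ((contDiffAt_jac (N := 1) hA).differentiableAt one_ne_zero).hasFDerivAt
  -- The square `jac ^ 2 = det (AᵀA)` is differentiated in two ways, and the nonzero factor `2 * jac
  -- A` is cancelled at the end.
  have h1 : HasFDerivAt (fun C : U →L[ℝ] V => jac C ^ 2)
      ((2 * jac A) • fderiv ℝ jac A) A := by
    have := hJ.pow 2
    simpa using! this
  have hg : HasFDerivAt (gram : (U →L[ℝ] V) → _) (fderiv ℝ gram A) A :=
    ((contDiff_gram (N := 1)).differentiable one_ne_zero A).hasFDerivAt
  have hgB : fderiv ℝ gram A B =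
      ContinuousLinearMap.adjoint A ∘L B + ContinuousLinearMap.adjoint B ∘L A := by
    have := ((adjL U V).hasFDerivAt (x := A)).clm_comp (hasFDerivAt_id A)
    have h := DFunLike.congr_fun (hg.unique this) B
    simpa using! h
  have hd : HasFDerivAt (fun A : U →L[ℝ] U => LinearMap.det (A : U →ₗ[ℝ] U))
      (fderiv ℝ (fun A : U →L[ℝ] U => LinearMap.det (A : U →ₗ[ℝ] U)) (gram A)) (gram A) :=
    ((contDiff_det (U := U) (N := 1)).differentiable one_ne_zero _).hasFDerivAt
  have hdC : ∀ C, fderiv ℝ (fun A : U →L[ℝ] U => LinearMap.det (A : U →ₗ[ℝ] U)) (gram A) C =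
      jac A ^ 2 * tr U (Ring.inverse (gram A) ∘L C) := by
    intro C
    have hl : HasDerivAt (fun t : ℝ => gram A + t • C) C 0 := by
      simpa using! ((hasDerivAt_id (0 : ℝ)).smul_const C).const_add (gram A)
    have hd' := hd
    rw [show gram A = gram A + (0 : ℝ) • C by simp] at hd'
    have := hd'.comp_hasDerivAt (0 : ℝ) hl
    simp only [zero_smul, add_zero] at this
    rw [jac_sq]
    exact this.unique (hasDerivAt_det_line (isUnit_gram hA) C)
  have h2 := (hd.comp A hg).congr_of_eventuallyEq (f₁ := fun C : U →L[ℝ] V => jac C ^ 2)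
    (Filter.Eventually.of_forall fun C => jac_sq C)
  have h3 := DFunLike.congr_fun (h1.unique h2) B
  simp only [smul_apply, ContinuousLinearMap.comp_apply, smul_eq_mul] at h3
  rw [hgB, hdC, ContinuousLinearMap.comp_add, map_add] at h3
  -- The two terms in the derivative of the Gram operator contribute equally: taking adjoints
  -- exchanges them, because the inverse Gram operator is self-adjoint and the trace is cyclic.
  have h4 : tr U (Ring.inverse (gram A) ∘L (ContinuousLinearMap.adjoint B ∘L A)) =
      tr U (pinv A ∘L B) := by
    rw [← tr_adjoint]
    have hsa : ContinuousLinearMap.adjoint (Ring.inverse (gram A)) = Ring.inverse (gram A) := by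
      have : IsSelfAdjoint (gram A) := by
        rw [ContinuousLinearMap.isSelfAdjoint_iff', gram, ContinuousLinearMap.adjoint_comp,
          ContinuousLinearMap.adjoint_adjoint]
      rw [← ContinuousLinearMap.star_eq_adjoint, ← Ring.inverse_star, this.star_eq]
    rw [ContinuousLinearMap.adjoint_comp, ContinuousLinearMap.adjoint_comp,
      ContinuousLinearMap.adjoint_adjoint, hsa, tr_comp_comm]
    rfl
  rw [h4] at h3
  change _ = jac A ^ 2 * (tr U (pinv A ∘L B) + _) at h3
  have hp := jac_pos hA
  have : 2 * jac A * fderiv ℝ jac A B = 2 * jac A * (jac A * tr U (pinv A ∘L B)) := by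
    rw [h3]; ring
  exact mul_left_cancel₀ (by positivity) this

end LinearAlgebra

end

end FirstVariation

/-! ### The area formula for injective immersions. -/

namespace FirstVariation

noncomputable section

set_option linter.unusedSectionVars false

section AreaFormula

open scoped NNReal ENNReal

/-- On `t`, `f` factors through `g` by an `L`-Lipschitz map of `g '' t`. Neither map has to be
injective, so a map and its linear approximation can be compared in both directions. -/
theorem euclideanHausdorffMeasure_image_le_of_dist_le {Z X Y : Type*} [MetricSpace X]
    [MeasurableSpace X] [BorelSpace X] [MetricSpace Y] [MeasurableSpace Y] [BorelSpace Y]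
    {f : Z → Y} {g : Z → X} {t : Set Z} {L : ℝ≥0} (d : ℕ)
    (h : ∀ x ∈ t, ∀ y ∈ t, dist (f x) (f y) ≤ L * dist (g x) (g y)) :
    Measure.euclideanHausdorffMeasure d (f '' t) ≤
      (L : ℝ≥0∞) ^ d * Measure.euclideanHausdorffMeasure d (g '' t) := by
  rcases t.eq_empty_or_nonempty with rfl | ⟨z0, hz0⟩
  · simp
  have : Nonempty Z := ⟨z0⟩
  have hgf : ∀ x ∈ t, ∀ y ∈ t, g x = g y → f x = f y := by
    intro x hx y hy hxy
    have := h x hx y hy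
    rw [hxy, dist_self, mul_zero] at this
    exact dist_le_zero.1 this
  let k : X → Y := fun a => f (Function.invFunOn g t a)
  have hk : ∀ x ∈ t, k (g x) = f x := fun x hx =>
    hgf _ (Function.invFunOn_mem ⟨x, hx, rfl⟩) _ hx (Function.invFunOn_eq ⟨x, hx, rfl⟩)
  have hL : LipschitzOnWith L k (g '' t) := by
    refine LipschitzOnWith.of_dist_le_mul ?_
    rintro _ ⟨x, hx, rfl⟩ _ ⟨y, hy, rfl⟩
    rw [hk x hx, hk y hy]
    exact h x hx y hy
  have himg : f '' t = k '' (g '' t) := by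
    rw [image_image]
    exact image_congr fun x hx => (hk x hx).symm
  have := hL.hausdorffMeasure_image_le (d := (d : ℝ)) (Nat.cast_nonneg d)
  rw [ENNReal.rpow_natCast] at this
  rw [himg]
  simp only [Measure.euclideanHausdorffMeasure_def, Measure.smul_apply]
  simp only [ENNReal.smul_def, smul_eq_mul]
  rw [mul_left_comm]
  gcongr

variable {U V : Type*} [NormedAddCommGroup U] [InnerProductSpace ℝ U] [FiniteDimensional ℝ U]
  [NormedAddCommGroup V] [InnerProductSpace ℝ V] [FiniteDimensional ℝ V]
  [MeasurableSpace U] [BorelSpace U] [MeasurableSpace V] [BorelSpace V]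

/-- Relative to an injective `A`, an error `δ‖x - y‖` is at most `δK‖A x - A y‖`. Hence `f` and `A`
stretch distances equally up to a factor `L`, and the measures of their images agree up to `L ^ d ≤
c`; for `A` the measure of the image is known exactly. -/
theorem exists_approximation_radius {A : U →L[ℝ] V} (hA : Function.Injective A) {c : ℝ≥0}
    (hc : 1 < c) : ∃ δ : ℝ≥0, 0 < δ ∧ (∀ B : U →L[ℝ] V, ‖B - A‖ ≤ δ →
        jac B ≤ c * jac A ∧ jac A ≤ c * jac B) ∧
      ∀ (f : U → V) (t : Set U), ApproximatesLinearOn f A t δ →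
        Measure.euclideanHausdorffMeasure (Module.finrank ℝ U) (f '' t) ≤
          c * (ENNReal.ofReal (jac A) * volume t) ∧
        ENNReal.ofReal (jac A) * volume t ≤
          c * Measure.euclideanHausdorffMeasure (Module.finrank ℝ U) (f '' t) := by
  set d := Module.finrank ℝ U
  have hc' : (1 : ℝ) < c := hc
  obtain ⟨L, hL1, hLc⟩ : ∃ L : ℝ≥0, 1 < L ∧ L ^ d ≤ c := by
    have : Filter.Tendsto (fun L : ℝ≥0 => L ^ d) (𝓝[>] 1) (𝓝 1) := by
      have h := ((continuous_pow d).tendsto (1 : ℝ≥0)).mono_left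
        (nhdsWithin_le_nhds (s := Ioi (1 : ℝ≥0)))
      simpa using h
    have h1 := (this.eventually (Iio_mem_nhds hc)).and self_mem_nhdsWithin
    obtain ⟨L, h1, h2⟩ := h1.exists
    exact ⟨L, h2, le_of_lt h1⟩
  have hL1' : (1 : ℝ) < L := hL1
  obtain ⟨K, hK0, hK⟩ := LinearMap.exists_antilipschitzWith (A : U →ₗ[ℝ] V)
    (LinearMap.ker_eq_bot.2 hA)
  have hKd : ∀ x y : U, ‖x - y‖ ≤ K * ‖A x - A y‖ := by
    intro x y
    have := hK.le_mul_dist x y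
    rwa [dist_eq_norm, dist_eq_norm] at this
  have hJ : ∀ᶠ B in 𝓝 A, jac B ≤ c * jac A ∧ jac A ≤ c * jac B := by
    have hp := jac_pos hA
    refine (Filter.Tendsto.eventually_le_const ?_ continuous_jac.continuousAt).and ?_
    · nlinarith
    · have : Filter.Tendsto (fun B : U →L[ℝ] V => c * jac B) (𝓝 A) (𝓝 (c * jac A)) :=
        (continuous_jac.const_mul _).continuousAt
      refine (this.eventually_const_lt ?_).mono fun B hB => hB.le
      nlinarith
  obtain ⟨η, hη0, hη⟩ := Metric.eventually_nhds_iff.1 hJ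
  have hKpos : (0 : ℝ) < K := hK0
  -- The bound `η / 2` keeps the closed ball inside the open one where `jac` is controlled; `(L - 1)
  -- / K` and `(1 - 1 / L) / K` yield the upper and the lower distance estimate.
  have hε : 0 < min (η / 2) (min (((L : ℝ) - 1) / K) ((1 - 1 / (L : ℝ)) / K)) := by
    have : 1 / (L : ℝ) < 1 := by rw [div_lt_one (by linarith)]; exact hL1'
    refine lt_min (by linarith) (lt_min (div_pos (by linarith) hKpos) (div_pos (by linarith) hKpos))
  refine ⟨⟨_, hε.le⟩, hε, ?_, ?_⟩
  · intro B hB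
    refine hη ?_
    rw [dist_eq_norm]
    refine (hB.trans (min_le_left _ _)).trans_lt (by linarith)
  intro f t hf
  set δ : ℝ≥0 := ⟨_, hε.le⟩
  have hδ1 : (δ : ℝ) * K ≤ L - 1 := by
    rw [← le_div_iff₀ hKpos]
    exact (min_le_right _ _).trans (min_le_left _ _)
  have hδ2 : (δ : ℝ) * K ≤ 1 - 1 / L := by
    rw [← le_div_iff₀ hKpos]
    exact (min_le_right _ _).trans (min_le_right _ _)
  have hfd : ∀ x ∈ t, ∀ y ∈ t, ‖f x - f y - (A x - A y)‖ ≤ δ * K * ‖A x - A y‖ := by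
    intro x hx y hy
    have h1 := hf x hx y hy
    rw [map_sub] at h1
    refine h1.trans ?_
    rw [mul_assoc]
    gcongr
    exact hKd x y
  have hAt : Measure.euclideanHausdorffMeasure d (A '' t) = ENNReal.ofReal (jac A) * volume t :=
    (A : U →ₗ[ℝ] V).euclideanHausdorffMeasure_image_eq_normDet_mul_volume t
  have hLc' : ((L : ℝ≥0∞)) ^ d ≤ c := by exact_mod_cast hLc
  rw [← hAt]
  constructor
  · refine (euclideanHausdorffMeasure_image_le_of_dist_le (g := A) (L := L) d ?_).trans (by gcongr)
    intro x hx y hy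
    rw [dist_eq_norm, dist_eq_norm]
    have h1 := hfd x hx y hy
    have h2 : ‖f x - f y‖ ≤ ‖f x - f y - (A x - A y)‖ + ‖A x - A y‖ := by
      simpa using norm_add_le (f x - f y - (A x - A y)) (A x - A y)
    nlinarith [norm_nonneg (A x - A y)]
  · refine (euclideanHausdorffMeasure_image_le_of_dist_le (f := A) (g := f) (L := L) d ?_).trans
      (by gcongr)
    intro x hx y hy
    rw [dist_eq_norm, dist_eq_norm]
    have h1 := hfd x hx y hy
    have h2 : ‖A x - A y‖ ≤ ‖f x - f y - (A x - A y)‖ + ‖f x - f y‖ := by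
      have := norm_sub_le (f x - f y) (f x - f y - (A x - A y))
      rw [sub_sub_cancel] at this
      linarith
    have h3 : (1 / (L : ℝ)) * ‖A x - A y‖ ≤ ‖f x - f y‖ := by
      nlinarith [norm_nonneg (A x - A y)]
    have hLp : (0 : ℝ) < L := by linarith
    calc ‖A x - A y‖ = L * ((1 / (L : ℝ)) * ‖A x - A y‖) := by field_simp
      _ ≤ _ := by gcongr

variable {f : U → V} {f' : U → U →L[ℝ] V} {s : Set U}

theorem measurableEmbedding_domRestrict (hs : MeasurableSet s) (hc : ContinuousOn f s)
    (hf : InjOn f s) : MeasurableEmbedding (s.domRestrict f) := by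
  have : StandardBorelSpace s := hs.standardBorel
  exact (continuousOn_iff_continuous_domRestrict.1 hc).measurable.measurableEmbedding
    (injOn_iff_injective.1 hf)

/-- The area formula for injective immersions, with the error factor `c`, on a set on which the
derivative is almost constant. -/
theorem lintegral_jac_bounds (hs : MeasurableSet s) (hfd : ∀ x ∈ s, HasFDerivWithinAt f (f' x) s x)
    (hf : InjOn f s) {A : U →L[ℝ] V} {c δ : ℝ≥0} (hδ0 : 0 < δ)
    (hδ : ∀ B : U →L[ℝ] V, ‖B - A‖ ≤ δ → jac B ≤ c * jac A ∧ jac A ≤ c * jac B)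
    (hδf : ∀ (f : U → V) (t : Set U), ApproximatesLinearOn f A t δ →
        Measure.euclideanHausdorffMeasure (Module.finrank ℝ U) (f '' t) ≤
          c * (ENNReal.ofReal (jac A) * volume t) ∧
        ENNReal.ofReal (jac A) * volume t ≤
          c * Measure.euclideanHausdorffMeasure (Module.finrank ℝ U) (f '' t))
    (hs' : ∀ x ∈ s, ‖f' x - A‖ ≤ δ / 2) :
    Measure.euclideanHausdorffMeasure (Module.finrank ℝ U) (f '' s) ≤
        c * (c * ∫⁻ x in s, ENNReal.ofReal (jac (f' x))) ∧
      ∫⁻ x in s, ENNReal.ofReal (jac (f' x)) ≤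
        c * (c * Measure.euclideanHausdorffMeasure (Module.finrank ℝ U) (f '' s)) := by
  rcases s.eq_empty_or_nonempty with rfl | hne
  · simp
  -- Half of `δ` is spent on approximating `f` on a piece by its derivative at a point of `s`, the
  -- other half on replacing that derivative by `A`.
  obtain ⟨t, B, td, tm, tc, ta, hB⟩ := exists_partition_approximatesLinearOn_of_hasFDerivWithinAt
    f s f' hfd (fun _ => δ / 2) (fun _ => (half_pos hδ0).ne')
  have hcont : ContinuousOn f s := fun x hx => (hfd x hx).continuousWithinAt
  have hap : ∀ i, ApproximatesLinearOn f A (s ∩ t i) δ := by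
    intro i x hx y hy
    obtain ⟨z, hz, hBz⟩ := hB hne i
    have h1 := ta i x hx y hy
    have h2 : ‖(B i - A) (x - y)‖ ≤ δ / 2 * ‖x - y‖ := by
      refine ((B i - A).le_opNorm _).trans ?_
      gcongr
      rw [hBz]
      exact hs' z hz
    calc ‖f x - f y - A (x - y)‖ = ‖(f x - f y - B i (x - y)) + (B i - A) (x - y)‖ := by
          congr 1
          simp
      _ ≤ _ := norm_add_le _ _
      _ ≤ δ / 2 * ‖x - y‖ + δ / 2 * ‖x - y‖ := add_le_add (by simpa using h1) h2
      _ = δ * ‖x - y‖ := by ring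
  have hm : ∀ i, MeasurableSet (s ∩ t i) := fun i => hs.inter (tm i)
  have hst : s = ⋃ i, s ∩ t i := by rw [← inter_iUnion, inter_eq_left.2 tc]
  have hdisj : Pairwise (Function.onFun Disjoint fun i => s ∩ t i) :=
    td.mono fun i j h => h.mono inter_subset_right inter_subset_right
  have hμ : Measure.euclideanHausdorffMeasure (Module.finrank ℝ U) (f '' s) =
      ∑' i, Measure.euclideanHausdorffMeasure (Module.finrank ℝ U) (f '' (s ∩ t i)) := by
    conv_lhs => rw [hst, image_iUnion]
    refine measure_iUnion ?_ fun i => (hm i).image_of_continuousOn_injOn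
      (hcont.mono inter_subset_left) (hf.mono inter_subset_left)
    intro i j hij
    exact disjoint_image_image fun x hx y hy hxy =>
      Set.disjoint_left.1 (hdisj hij) hx (hf hx.1 hy.1 hxy ▸ hy)
  have hν : ∫⁻ x in s, ENNReal.ofReal (jac (f' x)) =
      ∑' i, ∫⁻ x in s ∩ t i, ENNReal.ofReal (jac (f' x)) := by
    conv_lhs => rw [hst]
    exact lintegral_iUnion hm hdisj _
  have hJ : ∀ i, ∫⁻ x in s ∩ t i, ENNReal.ofReal (jac (f' x)) ≤
      c * (ENNReal.ofReal (jac A) * volume (s ∩ t i)) := by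
    intro i
    rw [← mul_assoc, ← setLIntegral_const]
    refine setLIntegral_mono' (hm i) fun x hx => ?_
    rw [← ENNReal.ofReal_coe_nnreal, ← ENNReal.ofReal_mul c.coe_nonneg]
    exact ENNReal.ofReal_le_ofReal (hδ _ ((hs' x hx.1).trans (half_le_self δ.2))).1
  have hJ' : ∀ i, ENNReal.ofReal (jac A) * volume (s ∩ t i) ≤
      c * ∫⁻ x in s ∩ t i, ENNReal.ofReal (jac (f' x)) := by
    intro i
    rw [← setLIntegral_const, ← lintegral_const_mul' _ _ ENNReal.coe_ne_top]
    refine setLIntegral_mono' (hm i) fun x hx => ?_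
    rw [← ENNReal.ofReal_coe_nnreal, ← ENNReal.ofReal_mul c.coe_nonneg]
    exact ENNReal.ofReal_le_ofReal (hδ _ ((hs' x hx.1).trans (half_le_self δ.2))).2
  rw [hμ, hν]
  simp only [← ENNReal.tsum_mul_left]
  -- One factor `c` compares the measure of the image with `jac A` times volume, the other compares
  -- `jac A` with `jac (f' x)`.
  refine ⟨ENNReal.tsum_le_tsum fun i => ?_, ENNReal.tsum_le_tsum fun i => ?_⟩
  · refine (hδf f _ (hap i)).1.trans ?_
    exact mul_le_mul_right (hJ' i) _
  · refine (hJ i).trans ?_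
    exact mul_le_mul_right (hδf f _ (hap i)).2 _

/-- Continuity of `f'` and the Lindelöf property cut `s` into countably many disjoint measurable
pieces on which `f'` is nearly constant. Both sides are countably additive, the right one by
injectivity of `f`, so they agree up to the factor `c * c` for every `c > 1`. -/
theorem lintegral_jac_eq (hs : MeasurableSet s)
    (hfd : ∀ x ∈ s, HasFDerivWithinAt f (f' x) s x) (hc : ContinuousOn f' s)
    (hinj : ∀ x ∈ s, Function.Injective (f' x)) (hf : InjOn f s) :
    ∫⁻ x in s, ENNReal.ofReal (jac (f' x)) =
      Measure.euclideanHausdorffMeasure (Module.finrank ℝ U) (f '' s) := by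
  rcases s.eq_empty_or_nonempty with rfl | hne
  · simp
  have hcont : ContinuousOn f s := fun x hx => (hfd x hx).continuousWithinAt
  have key : ∀ c : ℝ≥0, 1 < c →
      Measure.euclideanHausdorffMeasure (Module.finrank ℝ U) (f '' s) ≤
        c * (c * ∫⁻ x in s, ENNReal.ofReal (jac (f' x))) ∧
      ∫⁻ x in s, ENNReal.ofReal (jac (f' x)) ≤
        c * (c * Measure.euclideanHausdorffMeasure (Module.finrank ℝ U) (f '' s)) := by
    intro c hc1
    have h1 : ∀ x : U, ∃ δ : ℝ≥0, x ∈ s → 0 < δ ∧ (∀ B : U →L[ℝ] V, ‖B - f' x‖ ≤ δ →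
        jac B ≤ c * jac (f' x) ∧ jac (f' x) ≤ c * jac B) ∧
      ∀ (f : U → V) (t : Set U), ApproximatesLinearOn f (f' x) t δ →
        Measure.euclideanHausdorffMeasure (Module.finrank ℝ U) (f '' t) ≤
          c * (ENNReal.ofReal (jac (f' x)) * volume t) ∧
        ENNReal.ofReal (jac (f' x)) * volume t ≤
          c * Measure.euclideanHausdorffMeasure (Module.finrank ℝ U) (f '' t) := by
      intro x
      by_cases hx : x ∈ s
      · obtain ⟨δ, h⟩ := exists_approximation_radius (hinj x hx) hc1
        exact ⟨δ, fun _ => h⟩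
      · exact ⟨0, fun h => absurd h hx⟩
    choose δ hδ using h1
    have h2 : ∀ x : U, ∃ W : Set U, IsOpen W ∧ (x ∈ s → x ∈ W) ∧
        ∀ y ∈ s ∩ W, x ∈ s → ‖f' y - f' x‖ ≤ δ x / 2 := by
      intro x
      by_cases hx : x ∈ s
      · have : {y | ‖f' y - f' x‖ ≤ δ x / 2} ∈ 𝓝[s] x := by
          have h3 : Filter.Tendsto f' (𝓝[s] x) (𝓝 (f' x)) := hc x hx
          have h4 : (0 : ℝ) < δ x / 2 := half_pos (hδ x hx).1
          filter_upwards [h3 (Metric.closedBall_mem_nhds _ h4)] with y hy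
          simpa [dist_eq_norm] using hy
        obtain ⟨W, hW, hxW, hWs⟩ := mem_nhdsWithin.1 this
        exact ⟨W, hW, fun _ => hxW, fun y hy _ => hWs ⟨hy.2, hy.1⟩⟩
      · exact ⟨∅, isOpen_empty, fun h => absurd h hx, fun y hy => absurd hy.2 (notMem_empty y)⟩
    choose W hWo hWx hW using h2
    obtain ⟨T, hTs, hTc, hT⟩ := TopologicalSpace.countable_cover_nhdsWithin (s := s) (f := W)
      fun x hx => mem_nhdsWithin_of_mem_nhds ((hWo x).mem_nhds (hWx x hx))
    have hTne : T.Nonempty := by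
      obtain ⟨x, hx⟩ := hne
      obtain ⟨y, hy, -⟩ := mem_iUnion₂.1 (hT hx)
      exact ⟨y, hy⟩
    obtain ⟨g, hg⟩ := hTc.exists_eq_range hTne
    have hgs : ∀ i, g i ∈ s := fun i => hTs (hg ▸ mem_range_self i)
    let t : ℕ → Set U := disjointed fun i => W (g i)
    have tm : ∀ i, MeasurableSet (t i) :=
      MeasurableSet.disjointed fun i => (hWo (g i)).measurableSet
    have td : Pairwise (Function.onFun Disjoint t) := disjoint_disjointed _
    have tc : s ⊆ ⋃ i, t i := by
      rw [iUnion_disjointed]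
      intro x hx
      obtain ⟨y, hy, hxy⟩ := mem_iUnion₂.1 (hT hx)
      rw [hg] at hy
      obtain ⟨i, rfl⟩ := hy
      exact mem_iUnion.2 ⟨i, hxy⟩
    have hm : ∀ i, MeasurableSet (s ∩ t i) := fun i => hs.inter (tm i)
    have hst : s = ⋃ i, s ∩ t i := by rw [← inter_iUnion, inter_eq_left.2 tc]
    have hdisj : Pairwise (Function.onFun Disjoint fun i => s ∩ t i) :=
      td.mono fun i j h => h.mono inter_subset_right inter_subset_right
    have hμ : Measure.euclideanHausdorffMeasure (Module.finrank ℝ U) (f '' s) =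
        ∑' i, Measure.euclideanHausdorffMeasure (Module.finrank ℝ U) (f '' (s ∩ t i)) := by
      conv_lhs => rw [hst, image_iUnion]
      refine measure_iUnion ?_ fun i => (hm i).image_of_continuousOn_injOn
        (hcont.mono inter_subset_left) (hf.mono inter_subset_left)
      intro i j hij
      exact disjoint_image_image fun x hx y hy hxy =>
      Set.disjoint_left.1 (hdisj hij) hx (hf hx.1 hy.1 hxy ▸ hy)
    have hν : ∫⁻ x in s, ENNReal.ofReal (jac (f' x)) =
        ∑' i, ∫⁻ x in s ∩ t i, ENNReal.ofReal (jac (f' x)) := by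
      conv_lhs => rw [hst]
      exact lintegral_iUnion hm hdisj _
    have hb := fun i => lintegral_jac_bounds (hm i)
      (fun x hx => (hfd x hx.1).mono inter_subset_left) (hf.mono inter_subset_left)
      (hδ _ (hgs i)).1 (hδ _ (hgs i)).2.1 (hδ _ (hgs i)).2.2
      (fun x hx => hW (g i) x ⟨hx.1, disjointed_subset (fun j => W (g j)) i hx.2⟩ (hgs i))
    rw [hμ, hν]
    simp only [← ENNReal.tsum_mul_left]
    exact ⟨ENNReal.tsum_le_tsum fun i => (hb i).1, ENNReal.tsum_le_tsum fun i => (hb i).2⟩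
  have lim : ∀ a b : ℝ≥0∞, (∀ c : ℝ≥0, 1 < c → a ≤ c * (c * b)) → a ≤ b := by
    intro a b h
    have h1 : Filter.Tendsto (fun c : ℝ≥0 => (c : ℝ≥0∞) * (c * b)) (𝓝[>] 1) (𝓝 b) := by
      have h2 : Filter.Tendsto (fun c : ℝ≥0 => ((c * c : ℝ≥0) : ℝ≥0∞)) (𝓝[>] 1) (𝓝 1) := by
        have : Continuous fun c : ℝ≥0 => ((c * c : ℝ≥0) : ℝ≥0∞) := by fun_prop
        have h := (this.tendsto 1).mono_left (nhdsWithin_le_nhds (s := Ioi (1 : ℝ≥0)))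
        simpa using h
      have h3 := ENNReal.Tendsto.mul_const (b := b) h2 (Or.inl one_ne_zero)
      simpa [mul_assoc] using h3
    exact ge_of_tendsto h1 (by filter_upwards [self_mem_nhdsWithin] with c hc using h c hc)
  exact le_antisymm (lim _ _ fun c hc => (key c hc).2) (lim _ _ fun c hc => (key c hc).1)

/-- The **area formula**: the pushforward of `jac (f' x) dx` under an injective immersion `f` is
the Hausdorff measure on the image. -/
theorem map_withDensity_jac (hs : MeasurableSet s)
    (hfd : ∀ x ∈ s, HasFDerivWithinAt f (f' x) s x) (hc : ContinuousOn f' s)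
    (hinj : ∀ x ∈ s, Function.Injective (f' x)) (hf : InjOn f s) :
    Measure.map (s.domRestrict f)
      (Measure.comap (↑) (volume.withDensity fun x => ENNReal.ofReal (jac (f' x)))) =
      (Measure.euclideanHausdorffMeasure (Module.finrank ℝ U)).restrict (f '' s) := by
  have hcont : ContinuousOn f s := fun x hx => (hfd x hx).continuousWithinAt
  have hemb := measurableEmbedding_domRestrict hs hcont hf
  ext B hB
  rw [hemb.map_apply, (MeasurableEmbedding.subtype_coe hs).comap_apply, Measure.restrict_apply hB,
    withDensity_apply]
  · have h1 : (Subtype.val '' (s.domRestrict f ⁻¹' B) : Set U) = s ∩ f ⁻¹' B := by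
      ext x; simp [and_comm]
    have hm : MeasurableSet (s ∩ f ⁻¹' B) := by
      rw [← h1]
      exact hs.subtype_image (hemb.measurable hB)
    rw [h1, lintegral_jac_eq hm (fun x hx => (hfd x hx.1).mono inter_subset_left)
      (hc.mono inter_subset_left) (fun x hx => hinj x hx.1) (hf.mono inter_subset_left),
      image_inter_preimage, inter_comm]
  · exact hs.subtype_image (hemb.measurable hB)

/-- Since `f` restricted to `s` is a measurable embedding, the change of variables from
`map_withDensity_jac` holds for every `g`, without measurability or integrability. -/
theorem integral_image_eq (hs : MeasurableSet s)
    (hfd : ∀ x ∈ s, HasFDerivWithinAt f (f' x) s x) (hc : ContinuousOn f' s)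
    (hinj : ∀ x ∈ s, Function.Injective (f' x)) (hf : InjOn f s) (g : V → ℝ) :
    ∫ x in f '' s, g x ∂(Measure.euclideanHausdorffMeasure (Module.finrank ℝ U)) =
      ∫ x in s, jac (f' x) * g (f x) := by
  have hcont : ContinuousOn f s := fun x hx => (hfd x hx).continuousWithinAt
  rw [← map_withDensity_jac hs hfd hc hinj hf,
    (measurableEmbedding_domRestrict hs hcont hf).integral_map]
  simp only [Set.domRestrict_apply, ← Function.comp_apply (f := g), ENNReal.ofReal]
  rw [← (MeasurableEmbedding.subtype_coe hs).integral_map, map_comap_subtype_coe hs,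
    setIntegral_withDensity_eq_setIntegral_smul₀ (f := fun x => (jac (f' x)).toNNReal)
      ((continuous_jac.comp_continuousOn hc).aemeasurable hs).real_toNNReal _ hs]
  congr with x
  rw [NNReal.smul_def, Real.coe_toNNReal _ (jac_nonneg (f' x)), smul_eq_mul]

end AreaFormula

end

end FirstVariation

/-! ### Parametrizations of submanifolds by pieces of a half-space. -/

namespace FirstVariation

noncomputable section

set_option linter.unusedSectionVars false

section Patch

variable {n m : ℕ}

/-- The closed half-space `{y | 0 ≤ y_0}` of `ℝᵐ` (everything if `m = 0`). -/
def half (m : ℕ) : Set (EuclideanSpace ℝ (Fin m)) := {y | ∀ i : Fin m, (i : ℕ) = 0 → 0 ≤ y i}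

/-- `f`, defined on the open set `V`, is a smooth embedding with left inverse `h`, and parametrizes
the part of `S` in the open set `O` by `V ∩ D`. -/
structure IsPatch (S : Set (EuclideanSpace ℝ (Fin n))) (D : Set (EuclideanSpace ℝ (Fin m)))
    (f : EuclideanSpace ℝ (Fin m) → EuclideanSpace ℝ (Fin n))
    (h : EuclideanSpace ℝ (Fin n) → EuclideanSpace ℝ (Fin m))
    (V : Set (EuclideanSpace ℝ (Fin m))) (O : Set (EuclideanSpace ℝ (Fin n))) : Prop where
  isOpen_dom : IsOpen V
  isOpen_cod : IsOpen O
  smooth : ContDiffOn ℝ ∞ f V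
  smooth_inv : ContDiffOn ℝ ∞ h O
  mapsTo : ∀ y ∈ V, f y ∈ O
  left_inv : ∀ y ∈ V, h (f y) = y
  mem_iff : ∀ y ∈ V, f y ∈ S ↔ y ∈ D
  right_inv : ∀ x ∈ O, x ∈ S → h x ∈ V ∧ f (h x) = x

theorem convex_half : Convex ℝ (half m) := by
  intro x hx y hy a b ha hb _ i hi
  have := hx i hi
  have := hy i hi
  simp only [PiLp.add_apply, PiLp.smul_apply, smul_eq_mul]
  positivity

theorem isClosed_half : IsClosed (half m) := by
  have : half m = ⋂ i : Fin m, {y | (i : ℕ) = 0 → 0 ≤ y i} := by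
    ext y; simp [half]
  rw [this]
  refine isClosed_iInter fun i => ?_
  by_cases hi : (i : ℕ) = 0
  · simp only [hi, forall_const]
    exact isClosed_le continuous_const (by fun_prop)
  · simp [hi]

theorem mem_interior_half {y : EuclideanSpace ℝ (Fin m)} (hy : ∀ i : Fin m, (i : ℕ) = 0 → 0 < y i) :
    y ∈ interior (half m) := by
  have : IsOpen {y : EuclideanSpace ℝ (Fin m) | ∀ i : Fin m, (i : ℕ) = 0 → 0 < y i} := by
    have : {y : EuclideanSpace ℝ (Fin m) | ∀ i : Fin m, (i : ℕ) = 0 → 0 < y i} =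
        ⋂ i : Fin m, {y | (i : ℕ) = 0 → 0 < y i} := by
      ext y; simp
    rw [this]
    refine isOpen_iInter_of_finite fun i => ?_
    by_cases hi : (i : ℕ) = 0
    · simp only [hi, forall_const]
      exact isOpen_lt continuous_const (by fun_prop)
    · simp [hi]
  exact mem_interior.2 ⟨_, fun z hz i hi => (hz i hi).le, this, hy⟩

theorem uniqueDiffOn_half : UniqueDiffOn ℝ (half m) :=
  uniqueDiffOn_convex convex_half
    ⟨WithLp.toLp 2 (fun _ => 1), mem_interior_half fun i _ => by simp⟩

/-- The inclusion of `ℝᵐ` in `ℝⁿ` as the first coordinates. -/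
def padL (n m : ℕ) : EuclideanSpace ℝ (Fin m) →L[ℝ] EuclideanSpace ℝ (Fin n) :=
  LinearMap.toContinuousLinearMap
    { toFun := fun y => WithLp.toLp 2 fun i => if h : (i : ℕ) < m then y ⟨i, h⟩ else 0
      map_add' := fun x y => by ext i; by_cases h : (i : ℕ) < m <;> simp [h]
      map_smul' := fun c y => by ext i; by_cases h : (i : ℕ) < m <;> simp [h] }

/-- The projection of `ℝⁿ` to the first `m` coordinates. -/
def truncL (hmn : m ≤ n) : EuclideanSpace ℝ (Fin n) →L[ℝ] EuclideanSpace ℝ (Fin m) :=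
  LinearMap.toContinuousLinearMap
    { toFun := fun x => WithLp.toLp 2 fun i => x (Fin.castLE hmn i)
      map_add' := fun x y => by ext i; simp
      map_smul' := fun c y => by ext i; simp }

theorem padL_apply (y : EuclideanSpace ℝ (Fin m)) (i : Fin n) :
    padL n m y i = if h : (i : ℕ) < m then y ⟨i, h⟩ else 0 := rfl

theorem truncL_apply (hmn : m ≤ n) (x : EuclideanSpace ℝ (Fin n)) (i : Fin m) :
    truncL hmn x i = x (Fin.castLE hmn i) := rfl

theorem truncL_padL (hmn : m ≤ n) (y : EuclideanSpace ℝ (Fin m)) :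
    truncL hmn (padL n m y) = y := by
  ext i
  rw [truncL_apply, padL_apply]
  simp

theorem padL_truncL (hmn : m ≤ n) {x : EuclideanSpace ℝ (Fin n)} (hx : x ∈ flatModel n m) :
    padL n m (truncL hmn x) = x := by
  ext i
  rw [padL_apply]
  split_ifs with h
  · rfl
  · exact (hx i (not_lt.1 h)).symm

theorem padL_mem_flatModel (y : EuclideanSpace ℝ (Fin m)) : padL n m y ∈ flatModel n m := by
  intro i hi
  rw [padL_apply, dif_neg (not_lt.2 hi)]

theorem padL_mem_halfModel (hmn : m ≤ n) (y : EuclideanSpace ℝ (Fin m)) :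
    padL n m y ∈ halfModel n m ↔ y ∈ half m := by
  constructor
  · rintro ⟨-, h⟩ i hi
    have := h (Fin.castLE hmn i) hi
    rw [padL_apply] at this
    simpa using this
  · refine fun h => ⟨padL_mem_flatModel y, fun i hi => ?_⟩
    rw [padL_apply]
    split_ifs with h1
    · exact h _ hi
    · exact le_rfl

/-- The domain of the parametrization is open and may reach across the edge of the half-space, so
`f` has ordinary two-sided derivatives even at boundary points; only membership in `M` sees the
half-space. -/
theorem isPatch_of_chart {M : Set (EuclideanSpace ℝ (Fin n))} (hmn : m ≤ n)
    {Ψ : OpenPartialHomeomorph (EuclideanSpace ℝ (Fin n)) (EuclideanSpace ℝ (Fin n))}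
    (hΨ : IsSmoothChart Ψ) (hM : ∀ x ∈ Ψ.source, x ∈ M ↔ Ψ x ∈ halfModel n m) :
    IsPatch M (half m) (fun y => Ψ.symm (padL n m y)) (fun x => truncL hmn (Ψ x))
      (padL n m ⁻¹' Ψ.target) Ψ.source where
  isOpen_dom := Ψ.open_target.preimage (padL n m).continuous
  isOpen_cod := Ψ.open_source
  smooth := hΨ.2.comp (padL n m).contDiff.contDiffOn fun y hy => hy
  smooth_inv := (truncL hmn).contDiff.comp_contDiffOn hΨ.1
  mapsTo y hy := Ψ.map_target hy
  left_inv y hy := by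
    have : Ψ (Ψ.symm (padL n m y)) = padL n m y := Ψ.right_inv hy
    simp only [this, truncL_padL]
  mem_iff y hy := by
    have : Ψ (Ψ.symm (padL n m y)) = padL n m y := Ψ.right_inv hy
    rw [hM _ (Ψ.map_target hy), this, padL_mem_halfModel hmn]
  right_inv x hx hxM := by
    have h1 : padL n m (truncL hmn (Ψ x)) = Ψ x := padL_truncL hmn ((hM x hx).1 hxM).1
    simp only [mem_preimage, h1]
    exact ⟨Ψ.map_source hx, Ψ.left_inv hx⟩

/-- Near each of its points, a submanifold with boundary corresponds to the half-plane in some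
smooth chart, in which the points on the edge are boundary points. -/
theorem exists_half_chart {M : Set (EuclideanSpace ℝ (Fin n))} (hM : IsSubmanifold m M)
    {p : EuclideanSpace ℝ (Fin n)} (hp : p ∈ M) :
    ∃ Ψ : OpenPartialHomeomorph (EuclideanSpace ℝ (Fin n)) (EuclideanSpace ℝ (Fin n)),
      p ∈ Ψ.source ∧ IsSmoothChart Ψ ∧ ∀ x ∈ Ψ.source, x ∈ M ↔ Ψ x ∈ halfModel n m := by
  rcases hM.2 p hp with ⟨Ψ, hpΨ, hΨ, h⟩ | ⟨-, Ψ, hpΨ, hΨ, h, -⟩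
  swap
  · exact ⟨Ψ, hpΨ, hΨ, h⟩
  -- At an interior point a translation moves the first coordinate of the image of `p` to `1`, and
  -- on the open set where this coordinate is positive the plane and its half agree. For `m = 0`
  -- nothing moves: the first coordinate vanishes on the plane anyway.
  let a : EuclideanSpace ℝ (Fin n) :=
    WithLp.toLp 2 fun i => if (i : ℕ) = 0 ∧ 0 < m then 1 - Ψ p i else 0
  let Ψ₁ := Ψ.trans (Homeomorph.addRight a).toOpenPartialHomeomorph
  have hsrc : Ψ₁.source = Ψ.source := by simp [Ψ₁]
  let B : Set (EuclideanSpace ℝ (Fin n)) :=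
    {z | ∀ i : Fin n, (i : ℕ) = 0 → 0 < m → 0 < z i}
  have hB : IsOpen B := by
    have : B = ⋂ i : Fin n, {z | (i : ℕ) = 0 → 0 < m → 0 < z i} := by ext; simp [B]
    rw [this]
    refine isOpen_iInter_of_finite fun i => ?_
    by_cases hi : (i : ℕ) = 0 ∧ 0 < m
    · simp only [hi, forall_const]
      exact isOpen_lt continuous_const (by fun_prop)
    · have : {z : EuclideanSpace ℝ (Fin n) | (i : ℕ) = 0 → 0 < m → 0 < z i} = univ := by
        ext z; simp only [mem_ofPred_eq, mem_univ, iff_true]; intro h1 h2; exact absurd ⟨h1, h2⟩ hi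
      rw [this]; exact isOpen_univ
  have hW : IsOpen (Ψ.source ∩ Ψ ⁻¹' ((fun z => z + a) ⁻¹' B)) :=
    Ψ.isOpen_inter_preimage (hB.preimage (by fun_prop))
  let Ψ₂ := Ψ₁.restrOpen _ hW
  have hsrc₂ : Ψ₂.source = Ψ.source ∩ Ψ ⁻¹' ((fun z => z + a) ⁻¹' B) := by
    rw [OpenPartialHomeomorph.restrOpen_source, hsrc, ← inter_assoc, inter_self]
  refine ⟨Ψ₂, ?_, ⟨?_, ?_⟩, ?_⟩
  · rw [hsrc₂]
    refine ⟨hpΨ, fun i hi hm => ?_⟩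
    simp [a, hi, hm]
  · rw [hsrc₂]
    exact (hΨ.1.mono inter_subset_left).add contDiffOn_const
  · have : ContDiffOn ℝ ∞ (fun z => Ψ.symm (z - a)) Ψ₂.target := by
      refine hΨ.2.comp (contDiff_id.sub contDiff_const).contDiffOn fun z hz => ?_
      have h1 := Ψ₂.map_target hz
      have h2 : Ψ₂ (Ψ₂.symm z) = z := Ψ₂.right_inv hz
      have h3 : Ψ₂ (Ψ₂.symm z) = Ψ (Ψ₂.symm z) + a := rfl
      rw [hsrc₂] at h1
      have h4 : z - a = Ψ (Ψ₂.symm z) := by rw [sub_eq_iff_eq_add, ← h3, h2]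
      change z - a ∈ Ψ.target
      rw [h4]
      exact Ψ.map_source h1.1
    refine this.congr fun z hz => ?_
    change Ψ.symm (z + -a) = _
    rw [sub_eq_add_neg]
  · intro x hx
    rw [hsrc₂] at hx
    rw [h x hx.1]
    change Ψ x ∈ flatModel n m ↔ Ψ x + a ∈ halfModel n m
    have ha : a ∈ flatModel n m := by
      intro i hi
      have : ¬ ((i : ℕ) = 0 ∧ 0 < m) := by omega
      simp [a, this]
    constructor
    · intro h1
      refine ⟨fun i hi => ?_, fun i hi => ?_⟩
      · simp [h1 i hi, ha i hi]
      · rcases Nat.eq_zero_or_pos m with hm | hm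
        · rw [PiLp.add_apply, h1 i (by omega), ha i (by omega), add_zero]
        · exact (hx.2 i hi hm).le
    · rintro ⟨h1, -⟩ i hi
      have := h1 i hi
      rwa [PiLp.add_apply, ha i hi, add_zero] at this

end Patch

end

end FirstVariation

/-! ### Tangent space, divergence and mean curvature in a parametrization. -/

namespace FirstVariation

noncomputable section

set_option linter.unusedSectionVars false

/-- The sum `∑ᵢ eᵢ · L eᵢ` over an orthonormal basis of the range of `A` is the trace of `A⁺LA`. -/
theorem sum_inner_eq_tr {U V : Type*} [NormedAddCommGroup U] [InnerProductSpace ℝ U]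
    [FiniteDimensional ℝ U] [NormedAddCommGroup V] [InnerProductSpace ℝ V] [FiniteDimensional ℝ V]
    {ι : Type*} [Fintype ι] {A : U →L[ℝ] V} (hA : Function.Injective A) {T : Submodule ℝ V}
    (hT : T = LinearMap.range (A : U →ₗ[ℝ] V)) (b : OrthonormalBasis ι ℝ T) (L : V →L[ℝ] V) :
    ∑ i, inner ℝ (b i : V) (L (b i)) = tr U (pinv A ∘L (L ∘L A)) := by
  subst hT
  -- With `A` factored through its range, cyclicity moves the trace to the range, where the
  -- projection `A A⁺` disappears in inner products with the basis.
  let R : U →L[ℝ] LinearMap.range (A : U →ₗ[ℝ] V) :=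
    A.codRestrict _ fun x => LinearMap.mem_range_self (A : U →ₗ[ℝ] V) x
  have h1 : pinv A ∘L (L ∘L A) =
      (pinv A ∘L L ∘L (LinearMap.range (A : U →ₗ[ℝ] V)).subtypeL) ∘L R := by
    ext x; rfl
  rw [h1, tr_comp_comm, tr_eq_sum_inner b]
  refine Finset.sum_congr rfl fun i _ => ?_
  change _ = inner ℝ (b i : V) (A (pinv A (L (b i))))
  rw [self_pinv_eq_starProjection hA, ← Submodule.inner_starProjection_left_eq_right,
    Submodule.starProjection_eq_self_iff.2 (b i).2]

namespace IsPatch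

variable {n m : ℕ} {S : Set (EuclideanSpace ℝ (Fin n))} {D : Set (EuclideanSpace ℝ (Fin m))}
    {f : EuclideanSpace ℝ (Fin m) → EuclideanSpace ℝ (Fin n)}
    {h : EuclideanSpace ℝ (Fin n) → EuclideanSpace ℝ (Fin m)}
    {V : Set (EuclideanSpace ℝ (Fin m))} {O : Set (EuclideanSpace ℝ (Fin n))}
    {y : EuclideanSpace ℝ (Fin m)}

theorem contDiffAt (P : IsPatch S D f h V O) (hy : y ∈ V) : ContDiffAt ℝ ∞ f y :=
  P.smooth.contDiffAt (P.isOpen_dom.mem_nhds hy)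

theorem contDiffAt_inv (P : IsPatch S D f h V O) {x : EuclideanSpace ℝ (Fin n)} (hx : x ∈ O) :
    ContDiffAt ℝ ∞ h x :=
  P.smooth_inv.contDiffAt (P.isOpen_cod.mem_nhds hx)

theorem hasFDerivAt (P : IsPatch S D f h V O) (hy : y ∈ V) : HasFDerivAt f (fderiv ℝ f y) y :=
  ((P.contDiffAt hy).differentiableAt (by simp)).hasFDerivAt

theorem hasFDerivAt_inv (P : IsPatch S D f h V O) {x : EuclideanSpace ℝ (Fin n)} (hx : x ∈ O) :
    HasFDerivAt h (fderiv ℝ h x) x :=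
  ((P.contDiffAt_inv hx).differentiableAt (by simp)).hasFDerivAt

theorem contDiffOn_fderiv (P : IsPatch S D f h V O) : ContDiffOn ℝ ∞ (fderiv ℝ f) V :=
  P.smooth.fderiv_of_isOpen P.isOpen_dom (by simp)

theorem injOn (P : IsPatch S D f h V O) : InjOn f V := fun a ha b hb hab => by
  rw [← P.left_inv a ha, ← P.left_inv b hb, hab]

theorem mem_of_mem (P : IsPatch S D f h V O) {x : EuclideanSpace ℝ (Fin n)} (hxO : x ∈ O)
    (hxS : x ∈ S) : h x ∈ V ∩ D :=
  ⟨(P.right_inv x hxO hxS).1, (P.mem_iff _ (P.right_inv x hxO hxS).1).1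
    ((P.right_inv x hxO hxS).2.symm ▸ hxS)⟩

theorem image_eq (P : IsPatch S D f h V O) : f '' (V ∩ D) = O ∩ S := by
  ext x
  constructor
  · rintro ⟨y, ⟨hyV, hyD⟩, rfl⟩
    exact ⟨P.mapsTo y hyV, (P.mem_iff y hyV).2 hyD⟩
  · rintro ⟨hxO, hxS⟩
    exact ⟨h x, P.mem_of_mem hxO hxS, (P.right_inv x hxO hxS).2⟩

theorem fderiv_inv_fderiv (P : IsPatch S D f h V O) (hy : y ∈ V) (w : EuclideanSpace ℝ (Fin m)) :
    fderiv ℝ h (f y) (fderiv ℝ f y w) = w := by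
  have h1 := (P.hasFDerivAt_inv (P.mapsTo y hy)).comp y (P.hasFDerivAt hy)
  have h2 : HasFDerivAt (h ∘ f) (ContinuousLinearMap.id ℝ _) y := by
    refine (hasFDerivAt_id y).congr_of_eventuallyEq ?_
    filter_upwards [P.isOpen_dom.mem_nhds hy] with z hz using P.left_inv z hz
  exact DFunLike.congr_fun (h1.unique h2) w

theorem injective (P : IsPatch S D f h V O) (hy : y ∈ V) : Function.Injective (fderiv ℝ f y) :=
  Function.LeftInverse.injective (P.fderiv_inv_fderiv hy)

theorem continuousOn_pinv (P : IsPatch S D f h V O) :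
    ContDiffOn ℝ ∞ (fun y => pinv (fderiv ℝ f y)) V := fun y hy =>
  (contDiffAt_pinv (P.injective hy)).comp_contDiffWithinAt y (P.contDiffOn_fderiv y hy)

theorem contDiffOn_jac (P : IsPatch S D f h V O) :
    ContDiffOn ℝ ∞ (fun y => jac (fderiv ℝ f y)) V := fun y hy =>
  (contDiffAt_jac (P.injective hy)).comp_contDiffWithinAt y (P.contDiffOn_fderiv y hy)

/-- `f ∘ h` is the identity on `S` near `f y`, and any two derivatives within `S` agree on the
tangent cone. -/
theorem eq_of_mem_tangentConeAt (P : IsPatch S D f h V O) (hy : y ∈ V) (hyD : y ∈ D)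
    {v : EuclideanSpace ℝ (Fin n)} (hv : v ∈ tangentConeAt ℝ S (f y)) :
    fderiv ℝ f y (fderiv ℝ h (f y) v) = v := by
  have hO := P.mapsTo y hy
  have hS := (P.mem_iff y hy).2 hyD
  have h0 : HasFDerivAt f (fderiv ℝ f y) (h (f y)) := by
    rw [P.left_inv y hy]; exact P.hasFDerivAt hy
  have h1 : HasFDerivWithinAt (f ∘ h) (fderiv ℝ f y ∘L fderiv ℝ h (f y)) S (f y) :=
    (h0.comp (f y) (P.hasFDerivAt_inv hO)).hasFDerivWithinAt
  have h2 : HasFDerivWithinAt (f ∘ h) (ContinuousLinearMap.id ℝ _) S (f y) := by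
    refine (hasFDerivWithinAt_id (f y) S).congr_of_eventuallyEq ?_ (P.right_inv _ hO hS).2
    filter_upwards [self_mem_nhdsWithin, mem_nhdsWithin_of_mem_nhds (P.isOpen_cod.mem_nhds hO)]
      with x hx hx' using (P.right_inv x hx' hx).2
  have := HasFDerivWithinAt.unique_on h1 h2 hv
  simpa using this

theorem hasFDerivWithinAt (P : IsPatch S D f h V O) (hy : y ∈ V) :
    HasFDerivWithinAt f (fderiv ℝ f y) (V ∩ D) y := (P.hasFDerivAt hy).hasFDerivWithinAt

theorem uniqueDiffWithinAt (P : IsPatch S D f h V O) (hD : UniqueDiffOn ℝ D) (hy : y ∈ V)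
    (hyD : y ∈ D) : UniqueDiffWithinAt ℝ (V ∩ D) y := by
  rw [inter_comm]
  exact (hD y hyD).inter (P.isOpen_dom.mem_nhds hy)

/-- The tangent space in a parametrization. -/
theorem tan_eq (P : IsPatch S D f h V O) (hD : UniqueDiffOn ℝ D) (hy : y ∈ V) (hyD : y ∈ D) :
    Tan S (f y) = LinearMap.range
      (fderiv ℝ f y : EuclideanSpace ℝ (Fin m) →ₗ[ℝ] EuclideanSpace ℝ (Fin n)) := by
  apply le_antisymm
  · refine Submodule.span_le.2 fun v hv => ?_
    exact ⟨_, P.eq_of_mem_tangentConeAt hy hyD hv⟩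
  -- `f` maps the tangent cone of the parameter set into that of `S`. The former spans everything:
  -- its span is dense by unique differentiability and closed by finite dimension.
  · have h1 : (⊤ : Submodule ℝ (EuclideanSpace ℝ (Fin m))) ≤
        (Tan S (f y)).comap (fderiv ℝ f y).toLinearMap := by
      have h2 := (P.uniqueDiffWithinAt hD hy hyD).dense_tangentConeAt
      have h3 : Submodule.span ℝ (tangentConeAt ℝ (V ∩ D) y) = ⊤ := by
        have := Submodule.closed_of_finiteDimensional (Submodule.span ℝ (tangentConeAt ℝ (V ∩ D) y))
        rw [← SetLike.coe_set_eq, ← this.closure_eq, h2.closure_eq]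
        rfl
      rw [← h3, Submodule.span_le]
      intro w hw
      refine Submodule.subset_span ?_
      have := (P.hasFDerivWithinAt hy).mapsTo_tangent_cone hw
      rw [P.image_eq] at this
      exact tangentConeAt_mono inter_subset_right this
    rintro _ ⟨w, rfl⟩
    exact h1 (Submodule.mem_top (x := w))

theorem comp_hasFDerivWithinAt (P : IsPatch S D f h V O) (hy : y ∈ V)
    {F : Type*} [NormedAddCommGroup F] [NormedSpace ℝ F] {G : EuclideanSpace ℝ (Fin n) → F}
    {G' : EuclideanSpace ℝ (Fin n) →L[ℝ] F} (hG : HasFDerivWithinAt G G' S (f y)) :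
    HasFDerivWithinAt (G ∘ f) (G' ∘L fderiv ℝ f y) (V ∩ D) y :=
  hG.comp y (P.hasFDerivWithinAt hy) fun z hz => (P.mem_iff z hz.1).2 hz.2

theorem fderivWithin_comp (P : IsPatch S D f h V O) (hD : UniqueDiffOn ℝ D) (hy : y ∈ V)
    (hyD : y ∈ D) {F : Type*} [NormedAddCommGroup F] [NormedSpace ℝ F]
    {G : EuclideanSpace ℝ (Fin n) → F} (hG : DifferentiableWithinAt ℝ G S (f y)) :
    fderivWithin ℝ (G ∘ f) (V ∩ D) y = fderivWithin ℝ G S (f y) ∘L fderiv ℝ f y :=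
  (P.comp_hasFDerivWithinAt hy hG.hasFDerivWithinAt).fderivWithin (P.uniqueDiffWithinAt hD hy hyD)

/-- A function is smooth on `S` near a point if it is smooth in a parametrization. -/
theorem contDiffWithinAt_of_comp (P : IsPatch S D f h V O) {x : EuclideanSpace ℝ (Fin n)}
    (hx : x ∈ O) (hxS : x ∈ S) {F : Type*} [NormedAddCommGroup F] [NormedSpace ℝ F]
    {G : EuclideanSpace ℝ (Fin n) → F} {N : WithTop ℕ∞} (hN : N ≤ ∞)
    (hG : ContDiffWithinAt ℝ N (G ∘ f) (V ∩ D) (h x)) : ContDiffWithinAt ℝ N G S x := by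
  have h1 : ContDiffWithinAt ℝ N ((G ∘ f) ∘ h) (O ∩ S) x :=
    hG.comp x (((P.contDiffAt_inv hx).of_le hN).contDiffWithinAt)
      fun z hz => P.mem_of_mem hz.1 hz.2
  have h2 : ContDiffWithinAt ℝ N G (O ∩ S) x :=
    h1.congr (fun z hz => by simp [(P.right_inv z hz.1 hz.2).2])
      (by simp [(P.right_inv x hx hxS).2])
  exact h2.mono_of_mem_nhdsWithin (Filter.inter_mem
    (mem_nhdsWithin_of_mem_nhds (P.isOpen_cod.mem_nhds hx)) self_mem_nhdsWithin)

theorem contDiffOn_comp (P : IsPatch S D f h V O)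
    {F : Type*} [NormedAddCommGroup F] [NormedSpace ℝ F] {G : EuclideanSpace ℝ (Fin n) → F}
    {N : WithTop ℕ∞} (hN : N ≤ ∞) (hG : ContDiffOn ℝ N G S) : ContDiffOn ℝ N (G ∘ f) (V ∩ D) :=
  hG.comp ((P.smooth.of_le hN).mono inter_subset_left) fun z hz => (P.mem_iff z hz.1).2 hz.2

theorem continuousWithinAt_of_comp (P : IsPatch S D f h V O) {x : EuclideanSpace ℝ (Fin n)}
    (hx : x ∈ O) (hxS : x ∈ S) {F : Type*} [NormedAddCommGroup F] [NormedSpace ℝ F]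
    {G : EuclideanSpace ℝ (Fin n) → F}
    (hG : ContinuousOn (G ∘ f) (V ∩ D)) : ContinuousWithinAt G S x := by
  have h1 := P.contDiffWithinAt_of_comp hx hxS (N := 0) (by simp) (G := G)
    ((contDiffOn_zero.2 hG) _ (P.mem_of_mem hx hxS))
  exact h1.continuousWithinAt

/-- The divergence in a parametrization. -/
theorem divM_eq (P : IsPatch S D f h V O) (hD : UniqueDiffOn ℝ D) (hy : y ∈ V) (hyD : y ∈ D)
    {X : EuclideanSpace ℝ (Fin n) → EuclideanSpace ℝ (Fin n)}
    (hX : DifferentiableWithinAt ℝ X S (f y)) :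
    divM S X (f y) = tr _ (pinv (fderiv ℝ f y) ∘L fderivWithin ℝ (X ∘ f) (V ∩ D) y) := by
  rw [P.fderivWithin_comp hD hy hyD hX, ← sum_inner_eq_tr (P.injective hy) (P.tan_eq hD hy hyD)
    (stdOrthonormalBasis ℝ (Tan S (f y)))]
  rfl

/-- The orthogonal projection to the tangent space in a parametrization. -/
theorem starProjection_tan (P : IsPatch S D f h V O) (hD : UniqueDiffOn ℝ D) (hy : y ∈ V)
    (hyD : y ∈ D) :
    (Tan S (f y)).starProjection = fderiv ℝ f y ∘L pinv (fderiv ℝ f y) := by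
  ext1 v
  rw [ContinuousLinearMap.comp_apply, self_pinv_eq_starProjection (P.injective hy)]
  congr 2
  exact P.tan_eq hD hy hyD

theorem contDiffOn_proj (P : IsPatch S D f h V O) :
    ContDiffOn ℝ ∞ (fun y => fderiv ℝ f y ∘L pinv (fderiv ℝ f y)) V :=
  P.contDiffOn_fderiv.clm_comp P.continuousOn_pinv

theorem contDiffWithinAt_starProjection (P : IsPatch S D f h V O) (hD : UniqueDiffOn ℝ D)
    (hy : y ∈ V) (hyD : y ∈ D) :
    ContDiffWithinAt ℝ ∞ (fun x => (Tan S x).starProjection) S (f y) := by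
  refine P.contDiffWithinAt_of_comp (P.mapsTo y hy) ((P.mem_iff y hy).2 hyD) le_rfl ?_
  rw [P.left_inv y hy]
  refine ((P.contDiffOn_proj.mono inter_subset_left) y ⟨hy, hyD⟩).congr (fun z hz => ?_) ?_
  · exact P.starProjection_tan hD hz.1 hz.2
  · exact P.starProjection_tan hD hy hyD

/-- The mean curvature vector is the divergence of the tangential projection. -/
theorem inner_meanCurvature (P : IsPatch S D f h V O) (hD : UniqueDiffOn ℝ D)
    (hy : y ∈ V) (hyD : y ∈ D) (v : EuclideanSpace ℝ (Fin n)) :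
    inner ℝ (meanCurvature S (f y)) v =
      divM S (fun x => (Tan S x).starProjection v) (f y) := by
  set Q : EuclideanSpace ℝ (Fin n) → _ := fun x => (Tan S x).starProjection with hQ
  have hQd : HasFDerivWithinAt Q (fderivWithin ℝ Q S (f y)) S (f y) :=
    ((P.contDiffWithinAt_starProjection hD hy hyD).differentiableWithinAt
      (by simp)).hasFDerivWithinAt
  have hQf : HasFDerivWithinAt (Q ∘ f) (fderivWithin ℝ Q S (f y) ∘L fderiv ℝ f y) (V ∩ D) y :=
    P.comp_hasFDerivWithinAt hy hQd
  have hu := P.uniqueDiffWithinAt hD hy hyD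
  have hnab : ∀ (v : EuclideanSpace ℝ (Fin n)) (a : EuclideanSpace ℝ (Fin m)),
      nabla S (fun x => (Tan S x).starProjection v) (f y) (fderiv ℝ f y a) =
        fderivWithin ℝ Q S (f y) (fderiv ℝ f y a) v := by
    intro v a
    have h1 : HasFDerivWithinAt (fun x => Q x v)
        ((fderivWithin ℝ Q S (f y)).flip v) S (f y) := by
      simpa using! hQd.clm_apply (hasFDerivWithinAt_const v (f y) S)
    have h2 := P.fderivWithin_comp hD hy hyD h1.differentiableWithinAt
    have h3 := (P.comp_hasFDerivWithinAt hy h1).fderivWithin hu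
    exact DFunLike.congr_fun (h2.symm.trans h3) a
  -- The derivative of a family of self-adjoint operators is self-adjoint.
  have hsymm : ∀ (a : EuclideanSpace ℝ (Fin m)) (u v : EuclideanSpace ℝ (Fin n)),
      inner ℝ (fderivWithin ℝ Q S (f y) (fderiv ℝ f y a) u) v =
        inner ℝ u (fderivWithin ℝ Q S (f y) (fderiv ℝ f y a) v) := by
    intro a u v
    have e1 : HasFDerivWithinAt (fun z => inner ℝ (Q (f z) u) v) _ (V ∩ D) y :=
      (hQf.clm_apply (hasFDerivWithinAt_const u y _)).inner ℝ (hasFDerivWithinAt_const v y _)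
    have e2 : HasFDerivWithinAt (fun z => inner ℝ u (Q (f z) v)) _ (V ∩ D) y :=
      (hasFDerivWithinAt_const u y _).inner ℝ (hQf.clm_apply (hasFDerivWithinAt_const v y _))
    have : (fun z => inner ℝ (Q (f z) u) v) = fun z => inner ℝ u (Q (f z) v) := by
      ext z
      exact Submodule.inner_starProjection_left_eq_right _ _ _
    rw [this] at e1
    have := DFunLike.congr_fun (hu.eq e1 e2) a
    simpa using this
  -- Differentiating `Q² = Q` gives `Q'Q + QQ' = Q'`, hence `QQ'Q = 0`: the derivative of the
  -- projection sends tangent vectors to normal ones.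
  have hidem : ∀ (a : EuclideanSpace ℝ (Fin m)) (u : EuclideanSpace ℝ (Fin n)),
      Q (f y) (fderivWithin ℝ Q S (f y) (fderiv ℝ f y a) (Q (f y) u)) = 0 := by
    intro a u
    have e1 : HasFDerivWithinAt (fun z => Q (f z) ∘L Q (f z)) _ (V ∩ D) y := hQf.clm_comp hQf
    have : (fun z => Q (f z) ∘L Q (f z)) = Q ∘ f := by
      ext z u
      simp only [Q, Function.comp_apply, ContinuousLinearMap.comp_apply]
      rw [Submodule.starProjection_eq_self_iff.2 (Submodule.starProjection_apply_mem _ _)]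
    rw [this] at e1
    have h1 := DFunLike.congr_fun (DFunLike.congr_fun (hu.eq e1 hQf) a) (Q (f y) u)
    have hQQ : ∀ w, Q (f y) (Q (f y) w) = Q (f y) w := fun w =>
      Submodule.starProjection_eq_self_iff.2 (Submodule.starProjection_apply_mem _ _)
    simp [hQQ] at h1
    exact h1
  rw [meanCurvature, divM, sum_inner]
  refine Finset.sum_congr rfl fun i _ => ?_
  set e : EuclideanSpace ℝ (Fin n) :=
    ((stdOrthonormalBasis ℝ (Tan S (f y)) i : Tan S (f y)) : EuclideanSpace ℝ (Fin n)) with he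
  have hemem : e ∈ Tan S (f y) := (stdOrthonormalBasis ℝ (Tan S (f y)) i).2
  obtain ⟨a, ha⟩ : ∃ a, fderiv ℝ f y a = e := by
    have := hemem
    rw [P.tan_eq hD hy hyD] at this
    exact this
  -- By `hidem` the normal projection in `II(e, e)` changes nothing, and `hsymm` turns `Q'(e)e · v`
  -- into `e · Q'(e)v`, a summand of the divergence.
  rw [secondFundamentalForm, ← ha, hnab, hnab, ha, Submodule.starProjection_orthogonal_val]
  have h1 : Q (f y) e = e := Submodule.starProjection_eq_self_iff.2 hemem
  have h2 := hidem a e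
  rw [h1, ha] at h2
  rw [show (Tan S (f y)).starProjection ((fderivWithin ℝ Q S (f y)) e e) = 0 from h2, sub_zero,
    ← ha, hsymm]

/-- In coordinates the tangential projection is `A A⁺`, smooth on all of the open set `V`; the mean
curvature is thereby expressed through ordinary derivatives, as `tr_weight_flip` requires. -/
theorem inner_meanCurvature_eq (P : IsPatch S D f h V O) (hD : UniqueDiffOn ℝ D)
    (hy : y ∈ V) (hyD : y ∈ D) (v : EuclideanSpace ℝ (Fin n)) :
    inner ℝ (meanCurvature S (f y)) v =
      tr _ (pinv (fderiv ℝ f y) ∘L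
        fderiv ℝ (fun z => fderiv ℝ f z (pinv (fderiv ℝ f z) v)) y) := by
  have hd := (P.contDiffWithinAt_starProjection hD hy hyD).differentiableWithinAt (by simp)
  have hu := P.uniqueDiffWithinAt hD hy hyD
  rw [P.inner_meanCurvature hD hy hyD, P.divM_eq hD hy hyD]
  · congr 2
    have h1 : DifferentiableAt ℝ (fun z => fderiv ℝ f z (pinv (fderiv ℝ f z) v)) y := by
      have := ((P.contDiffOn_proj.contDiffAt (P.isOpen_dom.mem_nhds hy)).differentiableAt
        (by simp)).clm_apply (differentiableAt_const v)
      exact this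
    rw [← h1.fderivWithin hu]
    refine fderivWithin_congr (fun z hz => ?_) ?_
    · exact DFunLike.congr_fun (P.starProjection_tan hD hz.1 hz.2) v
    · exact DFunLike.congr_fun (P.starProjection_tan hD hy hyD) v
  · exact hd.clm_apply (differentiableWithinAt_const v)

end IsPatch

end

end FirstVariation

/-! ### The divergence theorem on a half-space. -/

namespace FirstVariation

noncomputable section

set_option linter.unusedSectionVars false

/-- The inclusion of `ℝᵏ` in `ℝᵏ⁺¹` as the edge of the half-space `half (k + 1)`. -/
def edgeL (k : ℕ) : EuclideanSpace ℝ (Fin k) →L[ℝ] EuclideanSpace ℝ (Fin (k + 1)) :=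
  LinearMap.toContinuousLinearMap
    { toFun := fun w => WithLp.toLp 2 (Fin.cons 0 w.ofLp)
      map_add' := fun x y => by ext i; refine Fin.cases ?_ (fun i => ?_) i <;> simp
      map_smul' := fun c y => by ext i; refine Fin.cases ?_ (fun i => ?_) i <;> simp }

theorem edgeL_apply {k : ℕ} (w : EuclideanSpace ℝ (Fin k)) :
    edgeL k w = WithLp.toLp 2 (Fin.cons 0 w.ofLp) := rfl

@[simp] theorem edgeL_zero {k : ℕ} (w : EuclideanSpace ℝ (Fin k)) : edgeL k w 0 = 0 := rfl

@[simp] theorem edgeL_succ {k : ℕ} (w : EuclideanSpace ℝ (Fin k)) (i : Fin k) :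
    edgeL k w i.succ = w i := rfl

theorem mem_half_succ {k : ℕ} {y : EuclideanSpace ℝ (Fin (k + 1))} :
    y ∈ half (k + 1) ↔ 0 ≤ y 0 := by
  refine ⟨fun h => h 0 rfl, fun h i hi => ?_⟩
  rwa [show i = 0 from Fin.ext hi]

theorem tr_eq_sum {m : ℕ} (A : EuclideanSpace ℝ (Fin m) →L[ℝ] EuclideanSpace ℝ (Fin m)) :
    tr _ A = ∑ i, A (EuclideanSpace.single i 1) i := by
  rw [tr_eq_sum_inner (EuclideanSpace.basisFun (Fin m) ℝ)]
  refine Finset.sum_congr rfl fun i _ => ?_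
  rw [EuclideanSpace.basisFun_apply, EuclideanSpace.inner_single_left]
  simp

/-- The divergence theorem on a half-space. -/
theorem integral_divergence_half {k : ℕ}
    {Z : EuclideanSpace ℝ (Fin (k + 1)) → EuclideanSpace ℝ (Fin (k + 1))}
    {K : Set (EuclideanSpace ℝ (Fin (k + 1)))} (hK : IsCompact K)
    (hZ : ContDiffOn ℝ 1 Z (half (k + 1))) (hZK : ∀ y ∈ half (k + 1), y ∉ K → Z y = 0) :
    ∫ y in half (k + 1), tr _ (fderivWithin ℝ Z (half (k + 1)) y) =
      - ∫ w : EuclideanSpace ℝ (Fin k), Z (edgeL k w) 0 := by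
  -- `K` lies strictly inside the cube of half-width `R`, so on the box `[0, R] × [-R, R]ᵏ` the
  -- field vanishes on every face except the one in `y_0 = 0`.
  obtain ⟨R, hR0, hR⟩ : ∃ R : ℝ, 0 < R ∧ ∀ y ∈ K, ∀ i, |y i| < R := by
    obtain ⟨R, hR⟩ := hK.isBounded.exists_norm_le
    refine ⟨max R 0 + 1, by positivity, fun y hy i => ?_⟩
    have h1 := hR y hy
    have h2 : ‖y i‖ ≤ ‖y‖ := PiLp.norm_apply_le y i
    rw [Real.norm_eq_abs] at h2
    linarith [le_max_left R 0]
  let a : Fin (k + 1) → ℝ := Fin.cons 0 fun _ => -R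
  let b : Fin (k + 1) → ℝ := fun _ => R
  have hab : a ≤ b := by
    intro i
    refine Fin.cases ?_ (fun i => ?_) i
    · exact hR0.le
    · simp only [a, b, Fin.cons_succ]; linarith
  let e := PiLp.continuousLinearEquiv 2 ℝ (fun _ : Fin (k + 1) => ℝ)
  have he : ∀ x i, e.symm x i = x i := fun x i => rfl
  let z : (Fin (k + 1) → ℝ) → (Fin (k + 1) → ℝ) := fun x => e (Z (e.symm x))
  let Z' := fderivWithin ℝ Z (half (k + 1))
  let z' : (Fin (k + 1) → ℝ) → ((Fin (k + 1) → ℝ) →L[ℝ] (Fin (k + 1) → ℝ)) := fun x =>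
    (e : _ →L[ℝ] _) ∘L (Z' (e.symm x)) ∘L (e.symm : _ →L[ℝ] _)
  have htr : ∀ x, ∑ i, z' x (Pi.single i 1) i = tr _ (Z' (e.symm x)) := by
    intro x
    rw [tr_eq_sum]
    rfl
  have hmem : ∀ x ∈ Icc a b, e.symm x ∈ half (k + 1) := fun x hx => mem_half_succ.2 (hx.1 0)
  have hZ'c : ContinuousOn Z' (half (k + 1)) :=
    hZ.continuousOn_fderivWithin uniqueDiffOn_half le_rfl
  have hZ'K : ∀ y ∈ half (k + 1), y ∉ K → Z' y = 0 := by
    intro y hy hyK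
    have : Z =ᶠ[𝓝[half (k + 1)] y] fun _ => 0 := by
      filter_upwards [self_mem_nhdsWithin,
        mem_nhdsWithin_of_mem_nhds (hK.isClosed.isOpen_compl.mem_nhds hyK)] with u hu hu'
        using hZK u hu hu'
    change fderivWithin ℝ Z _ y = 0
    rw [this.fderivWithin_eq (hZK y hy hyK)]
    simp
  have hKb : ∀ y ∈ half (k + 1), y ∈ K → e y ∈ Icc a b := by
    intro y hy hyK
    refine ⟨fun i => ?_, fun i => (abs_lt.1 (hR y hyK i)).2.le⟩
    have h1 := (abs_lt.1 (hR y hyK i)).1.le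
    revert h1
    refine Fin.cases (fun _ => ?_) (fun i h => ?_) i
    · exact mem_half_succ.1 hy
    · exact h
  have hvp := EuclideanSpace.volume_preserving_symm_measurableEquiv_toLp (Fin (k + 1))
  have main := integral_divergence_of_hasFDerivAt_off_countable a b hab z z' ∅ countable_empty
    ?_ ?_ ?_
  · have hl : ∫ x in Icc a b, ∑ i, z' x (Pi.single i 1) i =
        ∫ y in half (k + 1), tr _ (Z' y) := by
      simp_rw [htr]
      have h1 := (PiLp.volume_preserving_ofLp (Fin (k + 1))).setIntegral_preimage_emb
        (MeasurableEquiv.toLp 2 (Fin (k + 1) → ℝ)).symm.measurableEmbedding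
        (fun x => tr _ (Z' (e.symm x))) (Icc a b)
      rw [← h1]
      refine (setIntegral_eq_of_subset_of_forall_sdiff_eq_zero isClosed_half.measurableSet
        (fun y hy => hmem _ hy) (fun y hy => ?_)).symm
      change tr _ (Z' y) = 0
      rw [hZ'K y hy.1 fun hyK => hy.2 (hKb y hy.1 hyK), map_zero]
    rw [← hl, main, Fin.sum_univ_succ]
    have hz0 : ∀ x : Fin (k + 1) → ℝ, e.symm x ∈ half (k + 1) → (∃ i, |x i| = R) → z x = 0 := by
      rintro x hx ⟨i, hi⟩
      have : e.symm x ∉ K := fun h => (hR _ h i).ne hi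
      change e (Z (e.symm x)) = 0
      rw [hZK _ hx this, map_zero]
    have hrest : ∀ i : Fin k,
        ((∫ x in Icc (a ∘ i.succ.succAbove) (b ∘ i.succ.succAbove),
            z (i.succ.insertNth (b i.succ) x) i.succ) -
          ∫ x in Icc (a ∘ i.succ.succAbove) (b ∘ i.succ.succAbove),
            z (i.succ.insertNth (a i.succ) x) i.succ) = 0 := by
      intro i
      have hk : ∀ (c : ℝ), |c| = R →
          ∫ x in Icc (a ∘ i.succ.succAbove) (b ∘ i.succ.succAbove),
            z (i.succ.insertNth c x) i.succ = 0 := by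
        intro c hc
        refine setIntegral_eq_zero_of_forall_eq_zero fun x hx => ?_
        rw [hz0 _ (mem_half_succ.2 ?_) ⟨i.succ, by simpa using hc⟩]
        · rfl
        · obtain ⟨j, hj⟩ : ∃ j, i.succ.succAbove j = 0 :=
            Fin.exists_succAbove_eq (Fin.succ_ne_zero i).symm
          have := hx.1 j
          rw [he, ← hj, Fin.insertNth_apply_succAbove]
          simpa [a, hj] using this
      rw [hk _ (abs_of_pos hR0), hk _ (by simp [a, abs_of_pos hR0]), sub_zero]
    rw [Finset.sum_eq_zero fun i _ => hrest i, add_zero]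
    have hf0 : ∫ x in Icc (a ∘ (0 : Fin (k + 1)).succAbove) (b ∘ (0 : Fin (k + 1)).succAbove),
        z ((0 : Fin (k + 1)).insertNth (b 0) x) 0 = 0 := by
      refine setIntegral_eq_zero_of_forall_eq_zero fun x hx => ?_
      rw [hz0 _ (mem_half_succ.2 ?_) ⟨0, by simp [b, abs_of_pos hR0]⟩]
      · rfl
      · rw [he]; simpa [b] using hR0.le
    -- What survives is the lower face in direction `0`, counted negatively because its outward
    -- normal is `-e_0`.
    rw [hf0, zero_sub, neg_inj]
    have h2 := (PiLp.volume_preserving_ofLp (Fin k)).integral_comp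
      (MeasurableEquiv.toLp 2 (Fin k → ℝ)).symm.measurableEmbedding
      (fun x => z ((0 : Fin (k + 1)).insertNth (0 : ℝ) x) 0)
    have h3 : ∀ w : EuclideanSpace ℝ (Fin k), z ((0 : Fin (k + 1)).insertNth (0 : ℝ) w.ofLp) 0 =
        Z (edgeL k w) 0 := by
      intro w
      rw [edgeL_apply, Fin.insertNth_zero']
      rfl
    have h2' : ∫ w, Z (edgeL k w) 0 = ∫ x, z ((0 : Fin (k + 1)).insertNth (0 : ℝ) x) 0 := by
      rw [← h2]
      exact integral_congr_ae (Filter.Eventually.of_forall fun w => (h3 w).symm)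
    rw [h2']
    refine setIntegral_eq_integral_of_forall_compl_eq_zero fun x hx => ?_
    have h4 : edgeL k (WithLp.toLp 2 x) ∉ K := by
      intro hK
      apply hx
      have h5 := fun i : Fin k => abs_lt.1 (hR _ hK i.succ)
      exact ⟨fun i => by simpa [a] using (h5 i).1.le, fun i => by simpa [b] using (h5 i).2.le⟩
    have h5 := h3 (WithLp.toLp 2 x)
    change z ((0 : Fin (k + 1)).insertNth (0 : ℝ) x) 0 = _ at h5
    change z ((0 : Fin (k + 1)).insertNth (0 : ℝ) x) 0 = 0
    rw [h5, hZK _ (mem_half_succ.2 le_rfl) h4]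
    rfl
  · refine e.continuous.comp_continuousOn (hZ.continuousOn.comp e.symm.continuous.continuousOn ?_)
    exact fun x hx => hmem x hx
  · rintro x ⟨hx, -⟩
    have hx0 : e.symm x ∈ interior (half (k + 1)) := by
      refine mem_interior_half fun i hi => ?_
      rw [show i = 0 from Fin.ext hi]
      exact (hx 0 (mem_univ _)).1
    have h1 : HasFDerivAt Z (Z' (e.symm x)) (e.symm x) :=
      ((hZ.differentiableOn one_ne_zero _ (interior_subset hx0)).hasFDerivWithinAt).hasFDerivAt
        (mem_interior_iff_mem_nhds.1 hx0)
    exact e.hasFDerivAt.comp x (h1.comp x e.symm.hasFDerivAt)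
  · refine ContinuousOn.integrableOn_compact isCompact_Icc ?_
    simp_rw [htr]
    exact (tr _).continuous.comp_continuousOn
      (hZ'c.comp e.symm.continuous.continuousOn fun x hx => hmem x hx)

end

end FirstVariation

/-! ### The divergence theorem in one parametrization. -/

namespace FirstVariation

noncomputable section

set_option linter.unusedSectionVars false

theorem tr_smulRight {U : Type*} [NormedAddCommGroup U] [InnerProductSpace ℝ U]
    [FiniteDimensional ℝ U] (l : U →L[ℝ] ℝ) (w : U) : tr U (l.smulRight w) = l w := by
  rw [tr_apply]
  exact LinearMap.trace_smulRight _ _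

namespace IsPatch

section

variable {n m : ℕ} {S : Set (EuclideanSpace ℝ (Fin n))} {D : Set (EuclideanSpace ℝ (Fin m))}
    {f : EuclideanSpace ℝ (Fin m) → EuclideanSpace ℝ (Fin n)}
    {h : EuclideanSpace ℝ (Fin n) → EuclideanSpace ℝ (Fin m)}
    {V : Set (EuclideanSpace ℝ (Fin m))} {O : Set (EuclideanSpace ℝ (Fin n))}
    {y : EuclideanSpace ℝ (Fin m)}

/-- The weight `W = jac A • A⁺` pulls the tangential part of `X` back to the parameter domain as a
density. Its Euclidean divergence is `jac A * (div_M X + H · X)`, see `tr_weight_eq`; the curvature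
enters because `A⁺` discards the normal part. -/
theorem contDiffOn_weight (P : IsPatch S D f h V O) :
    ContDiffOn ℝ ∞ (fun z => jac (fderiv ℝ f z) • pinv (fderiv ℝ f z)) V :=
  P.contDiffOn_jac.smul P.continuousOn_pinv

theorem hasFDerivAt_weight (P : IsPatch S D f h V O) (hy : y ∈ V) :
    HasFDerivAt (fun z => jac (fderiv ℝ f z) • pinv (fderiv ℝ f z))
      (fderiv ℝ (fun z => jac (fderiv ℝ f z) • pinv (fderiv ℝ f z)) y) y :=
  ((P.contDiffOn_weight.contDiffAt (P.isOpen_dom.mem_nhds hy)).differentiableAt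
    (by simp)).hasFDerivAt

theorem hasFDerivAt_fderiv (P : IsPatch S D f h V O) (hy : y ∈ V) :
    HasFDerivAt (fderiv ℝ f) (fderiv ℝ (fderiv ℝ f) y) y :=
  ((P.contDiffOn_fderiv.contDiffAt (P.isOpen_dom.mem_nhds hy)).differentiableAt
    (by simp)).hasFDerivAt

/-- The product rule for the divergence of `W G`, where `W = jac (Df) (Df)⁺`. -/
theorem tr_weight_product (P : IsPatch S D f h V O) {s : Set (EuclideanSpace ℝ (Fin m))}
    (hs : UniqueDiffWithinAt ℝ s y) (hy : y ∈ V)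
    {G : EuclideanSpace ℝ (Fin m) → EuclideanSpace ℝ (Fin n)}
    {G' : EuclideanSpace ℝ (Fin m) →L[ℝ] EuclideanSpace ℝ (Fin n)}
    (hG : HasFDerivWithinAt G G' s y) :
    tr _ (fderivWithin ℝ (fun z => (jac (fderiv ℝ f z) • pinv (fderiv ℝ f z)) (G z)) s y) =
      tr _ ((fderiv ℝ (fun z => jac (fderiv ℝ f z) • pinv (fderiv ℝ f z)) y).flip (G y)) +
        jac (fderiv ℝ f y) * tr _ (pinv (fderiv ℝ f y) ∘L G') := by
  have h1 := ((P.hasFDerivAt_weight hy).hasFDerivWithinAt (s := s)).clm_apply hG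
  rw [h1.fderivWithin hs, map_add, ContinuousLinearMap.smul_comp, map_smul, smul_eq_mul, add_comm]

/-- For a tangent vector `A w` one has `W (A w) = jac A • w`; the product rule, Jacobi's formula and
the symmetry of `D²f` show that the derivative of `W` contributes nothing. For general `v`, `W v = W
(A A⁺ v)`, and since `A A⁺ v` is tangent only the term with its derivative remains, which is the
mean curvature. -/
theorem tr_weight_flip (P : IsPatch S D f h V O) (hD : UniqueDiffOn ℝ D) (hy : y ∈ V) (hyD : y ∈ D)
    (v : EuclideanSpace ℝ (Fin n)) :
    tr _ ((fderiv ℝ (fun z => jac (fderiv ℝ f z) • pinv (fderiv ℝ f z)) y).flip v) =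
      jac (fderiv ℝ f y) * inner ℝ (meanCurvature S (f y)) v := by
  have hV := P.isOpen_dom.mem_nhds hy
  have hu : UniqueDiffWithinAt ℝ univ y := uniqueDiffWithinAt_univ
  -- the tangential part vanishes
  have tang : ∀ w, tr _ ((fderiv ℝ (fun z => jac (fderiv ℝ f z) • pinv (fderiv ℝ f z)) y).flip
      (fderiv ℝ f y w)) = 0 := by
    intro w
    have hG : HasFDerivAt (fun z => fderiv ℝ f z w) ((fderiv ℝ (fderiv ℝ f) y).flip w) y := by
      simpa using! (P.hasFDerivAt_fderiv hy).clm_apply (hasFDerivAt_const w y)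
    have hsym : (fderiv ℝ (fderiv ℝ f) y).flip w = fderiv ℝ (fderiv ℝ f) y w := by
      ext1 u
      exact (P.contDiffAt hy).isSymmSndFDerivAt
        (by rw [minSmoothness_of_isRCLikeNormedField]; exact WithTop.coe_le_coe.2 le_top) u w
    have h1 := P.tr_weight_product hu hy hG.hasFDerivWithinAt
    have h2 : HasFDerivAt (fun z => (jac (fderiv ℝ f z) • pinv (fderiv ℝ f z)) (fderiv ℝ f z w))
        ((fderiv ℝ jac (fderiv ℝ f y) ∘L fderiv ℝ (fderiv ℝ f) y).smulRight w) y := by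
      have hj : HasFDerivAt jac (fderiv ℝ jac (fderiv ℝ f y)) (fderiv ℝ f y) :=
        ((contDiffAt_jac (N := 1) (P.injective hy)).differentiableAt one_ne_zero).hasFDerivAt
      have h3 := (hj.comp y (P.hasFDerivAt_fderiv hy)).smul_const w
      refine h3.congr_of_eventuallyEq ?_
      filter_upwards [hV] with z hz
      rw [smul_apply, pinv_apply_self (P.injective hz)]
      rfl
    rw [fderivWithin_univ, h2.fderiv, tr_smulRight, ContinuousLinearMap.comp_apply,
      fderiv_jac (P.injective hy), hsym] at h1
    linarith
  have hG : HasFDerivAt (fun z => fderiv ℝ f z (pinv (fderiv ℝ f z) v))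
      (fderiv ℝ (fun z => fderiv ℝ f z (pinv (fderiv ℝ f z) v)) y) y := by
    have := ((P.contDiffOn_proj.contDiffAt hV).differentiableAt
        (by simp)).clm_apply (differentiableAt_const v)
    exact this.hasFDerivAt
  have h1 := P.tr_weight_product hu hy hG.hasFDerivWithinAt
  rw [tang, zero_add, ← P.inner_meanCurvature_eq hD hy hyD] at h1
  rw [← h1, fderivWithin_univ]
  congr 1
  have h2 : HasFDerivAt (fun z => (jac (fderiv ℝ f z) • pinv (fderiv ℝ f z)) v)
      ((fderiv ℝ (fun z => jac (fderiv ℝ f z) • pinv (fderiv ℝ f z)) y).flip v) y := by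
    simpa using! (P.hasFDerivAt_weight hy).clm_apply (hasFDerivAt_const v y)
  rw [← h2.fderiv]
  refine Filter.EventuallyEq.fderiv_eq ?_
  filter_upwards [hV] with z hz
  rw [smul_apply, smul_apply, pinv_apply_self (P.injective hz)]

theorem tr_weight_eq (P : IsPatch S D f h V O) (hD : UniqueDiffOn ℝ D) (hy : y ∈ V) (hyD : y ∈ D)
    {X : EuclideanSpace ℝ (Fin n) → EuclideanSpace ℝ (Fin n)}
    (hX : DifferentiableWithinAt ℝ X S (f y)) :
    tr _ (fderivWithin ℝ
        (fun z => (jac (fderiv ℝ f z) • pinv (fderiv ℝ f z)) (X (f z))) (V ∩ D) y) =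
      jac (fderiv ℝ f y) * (divM S X (f y) + inner ℝ (meanCurvature S (f y)) (X (f y))) := by
  have h1 := P.comp_hasFDerivWithinAt hy hX.hasFDerivWithinAt
  have h2 := P.tr_weight_product (P.uniqueDiffWithinAt hD hy hyD) hy h1
  rw [show (fun z => (jac (fderiv ℝ f z) • pinv (fderiv ℝ f z)) (X (f z))) =
    fun z => (jac (fderiv ℝ f z) • pinv (fderiv ℝ f z)) ((X ∘ f) z) from rfl, h2,
    P.tr_weight_flip hD hy hyD, P.divM_eq hD hy hyD hX, P.fderivWithin_comp hD hy hyD hX]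
  simp only [Function.comp_apply]
  ring

theorem isCompact_coord (P : IsPatch S D f h V O) (hS : IsCompact S)
    {C : Set (EuclideanSpace ℝ (Fin n))} (hC : IsClosed C) (hCO : C ⊆ O) :
    IsCompact (h '' (C ∩ S)) := by
  refine (hS.inter_left hC).image_of_continuousOn ?_
  exact P.smooth_inv.continuousOn.mono fun x hx => hCO hx.1

theorem coord_subset (P : IsPatch S D f h V O)
    {C : Set (EuclideanSpace ℝ (Fin n))} (hCO : C ⊆ O) : h '' (C ∩ S) ⊆ V ∩ D := by
  rintro _ ⟨x, ⟨hxC, hxS⟩, rfl⟩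
  exact P.mem_of_mem (hCO hxC) hxS

theorem mem_coord_iff (P : IsPatch S D f h V O)
    {C : Set (EuclideanSpace ℝ (Fin n))} (hCO : C ⊆ O) (hy : y ∈ V) (hyD : y ∈ D) :
    y ∈ h '' (C ∩ S) ↔ f y ∈ C := by
  constructor
  · rintro ⟨x, ⟨hxC, hxS⟩, rfl⟩
    rwa [(P.right_inv x (hCO hxC) hxS).2]
  · intro hC
    exact ⟨f y, ⟨hC, (P.mem_iff y hy).2 hyD⟩, P.left_inv y hy⟩

theorem image_coord (P : IsPatch S D f h V O)
    {C : Set (EuclideanSpace ℝ (Fin n))} (hCO : C ⊆ O) : f '' (h '' (C ∩ S)) = C ∩ S := by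
  rw [image_image]
  refine (image_congr fun x hx => (P.right_inv x (hCO hx.1) hx.2).2).trans (image_id' _)

/-- The area formula in a parametrization. -/
theorem integral_eq (P : IsPatch S D f h V O) {K : Set (EuclideanSpace ℝ (Fin m))}
    (hK : MeasurableSet K) (hKV : K ⊆ V ∩ D) (g : EuclideanSpace ℝ (Fin n) → ℝ) :
    ∫ x in f '' K, g x ∂(Measure.euclideanHausdorffMeasure m) =
      ∫ y in K, jac (fderiv ℝ f y) * g (f y) := by
  have := integral_image_eq hK (fun y hy => ((P.hasFDerivAt (hKV hy).1).hasFDerivWithinAt))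
    (P.contDiffOn_fderiv.continuousOn.mono fun y hy => (hKV hy).1)
    (fun y hy => P.injective (hKV hy).1) (P.injOn.mono fun y hy => (hKV hy).1) g
  rwa [finrank_euclideanSpace_fin] at this

theorem measure_image_lt_top (P : IsPatch S D f h V O) {K : Set (EuclideanSpace ℝ (Fin m))}
    (hK : IsCompact K) (hKV : K ⊆ V) :
    Measure.euclideanHausdorffMeasure m (f '' K) < ⊤ := by
  have hc : ContinuousOn (fderiv ℝ f) K := P.contDiffOn_fderiv.continuousOn.mono hKV
  have := lintegral_jac_eq hK.measurableSet (fun y hy => ((P.hasFDerivAt (hKV hy)).hasFDerivWithinAt))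
    hc (fun y hy => P.injective (hKV hy)) (P.injOn.mono hKV)
  rw [finrank_euclideanSpace_fin] at this
  rw [← this]
  have h1 : IntegrableOn (fun y => jac (fderiv ℝ f y)) K volume :=
    (continuous_jac.comp_continuousOn hc).integrableOn_compact hK
  exact h1.lintegral_lt_top

end

/-- The divergence theorem for a vector field supported in a parametrized set, with the boundary
integral in coordinates. -/
theorem integral_divM_add {n k : ℕ} {S : Set (EuclideanSpace ℝ (Fin n))}
    {f : EuclideanSpace ℝ (Fin (k + 1)) → EuclideanSpace ℝ (Fin n)}
    {h : EuclideanSpace ℝ (Fin n) → EuclideanSpace ℝ (Fin (k + 1))}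
    {V : Set (EuclideanSpace ℝ (Fin (k + 1)))} {O : Set (EuclideanSpace ℝ (Fin n))}
    (P : IsPatch S (half (k + 1)) f h V O) (hS : IsCompact S)
    {C : Set (EuclideanSpace ℝ (Fin n))} (hC : IsClosed C) (hCO : C ⊆ O)
    {X : EuclideanSpace ℝ (Fin n) → EuclideanSpace ℝ (Fin n)} (hX : ContDiffOn ℝ 1 X S)
    (hXC : ∀ x ∈ S, x ∉ C → X x = 0) :
    ∫ x in C ∩ S, (divM S X x + inner ℝ (meanCurvature S x) (X x))
        ∂(Measure.euclideanHausdorffMeasure (k + 1)) =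
      - ∫ w in (edgeL k) ⁻¹' (h '' (C ∩ S)),
          jac (fderiv ℝ f (edgeL k w)) * pinv (fderiv ℝ f (edgeL k w)) (X (f (edgeL k w))) 0 := by
  set K := h '' (C ∩ S) with hK
  have hKc : IsCompact K := P.isCompact_coord hS hC hCO
  have hKV : K ⊆ V ∩ half (k + 1) := P.coord_subset hCO
  have hXK : ∀ y ∈ V, y ∈ half (k + 1) → y ∉ K → X (f y) = 0 := fun y hy hyD hyK =>
    hXC _ ((P.mem_iff y hy).2 hyD) fun h => hyK ((P.mem_coord_iff hCO hy hyD).2 h)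
  classical
  let Z₀ : EuclideanSpace ℝ (Fin (k + 1)) → EuclideanSpace ℝ (Fin (k + 1)) := fun z =>
    (jac (fderiv ℝ f z) • pinv (fderiv ℝ f z)) (X (f z))
  -- Extension by zero off `V` keeps the field `C¹` on the half-space, because `Z₀` already vanishes
  -- at the points of `V` in the half-space outside the compact set `K ⊆ V`.
  let Z := V.indicator Z₀
  have hZK : ∀ y ∈ half (k + 1), y ∉ K → Z y = 0 := by
    intro y hy hyK
    by_cases hyV : y ∈ V
    · simp only [Z, Z₀, indicator_of_mem hyV, hXK y hyV hy hyK, map_zero]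
    · exact indicator_of_notMem hyV _
  have hZ₀ : ContDiffOn ℝ 1 Z₀ (V ∩ half (k + 1)) :=
    ((P.contDiffOn_weight.of_le (by simp)).mono inter_subset_left).clm_apply
      (P.contDiffOn_comp (by simp) hX)
  have hZV : ∀ y ∈ V, Z =ᶠ[𝓝[half (k + 1)] y] Z₀ := fun y hy => by
    filter_upwards [mem_nhdsWithin_of_mem_nhds (P.isOpen_dom.mem_nhds hy)] with z hz
      using indicator_of_mem hz _
  have hnear : ∀ y ∈ half (k + 1), y ∉ K → Z =ᶠ[𝓝[half (k + 1)] y] fun _ => 0 := by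
    intro y hy hyK
    filter_upwards [self_mem_nhdsWithin,
      mem_nhdsWithin_of_mem_nhds (hKc.isClosed.isOpen_compl.mem_nhds hyK)] with u hu hu'
      using hZK u hu hu'
  have hZ : ContDiffOn ℝ 1 Z (half (k + 1)) := by
    intro y hy
    by_cases hyK : y ∈ K
    · have hyV := (hKV hyK).1
      have h1 : ContDiffWithinAt ℝ 1 Z₀ (half (k + 1)) y :=
        (hZ₀ y ⟨hyV, hy⟩).mono_of_mem_nhdsWithin (Filter.inter_mem
          (mem_nhdsWithin_of_mem_nhds (P.isOpen_dom.mem_nhds hyV)) self_mem_nhdsWithin)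
      exact h1.congr_of_eventuallyEq (hZV y hyV) (indicator_of_mem hyV _)
    · exact contDiffWithinAt_const.congr_of_eventuallyEq (hnear y hy hyK) (hZK y hy hyK)
  have hdiv := integral_divergence_half hKc hZ hZK
  have hL : ∫ y in half (k + 1), tr _ (fderivWithin ℝ Z (half (k + 1)) y) =
      ∫ x in C ∩ S, (divM S X x + inner ℝ (meanCurvature S x) (X x))
        ∂(Measure.euclideanHausdorffMeasure (k + 1)) := by
    rw [← P.image_coord hCO, P.integral_eq hKc.measurableSet hKV,
      setIntegral_eq_of_subset_of_forall_sdiff_eq_zero isClosed_half.measurableSet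
        (hKV.trans inter_subset_right)]
    · refine setIntegral_congr_fun hKc.measurableSet fun y hy => ?_
      obtain ⟨hyV, hyD⟩ := hKV hy
      have hXd := (hX.differentiableOn one_ne_zero) _ ((P.mem_iff y hyV).2 hyD)
      rw [← P.tr_weight_eq uniqueDiffOn_half hyV hyD hXd,
        (hZV y hyV).fderivWithin_eq (indicator_of_mem hyV _), inter_comm V,
        fderivWithin_inter (P.isOpen_dom.mem_nhds hyV)]
    · rintro y ⟨hy, hyK⟩
      rw [(hnear y hy hyK).fderivWithin_eq (hZK y hy hyK)]
      simp
  have hR : ∫ w, Z (edgeL k w) 0 = ∫ w in (edgeL k) ⁻¹' K,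
      jac (fderiv ℝ f (edgeL k w)) * pinv (fderiv ℝ f (edgeL k w)) (X (f (edgeL k w))) 0 := by
    rw [← setIntegral_eq_integral_of_forall_compl_eq_zero (s := (edgeL k) ⁻¹' K)]
    · refine setIntegral_congr_fun ((hKc.isClosed.preimage (edgeL k).continuous).measurableSet)
        fun w hw => ?_
      simp only [Z, Z₀, indicator_of_mem (hKV hw).1]
      simp
    · intro w hw
      rw [hZK _ (mem_half_succ.2 le_rfl) hw]
      rfl
  rw [← hL, hdiv, hR]

end IsPatch

end

end FirstVariation

/-! ### The boundary and its outward conormal. -/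

namespace FirstVariation

noncomputable section

set_option linter.unusedSectionVars false

section PosTangent

variable {n m : ℕ} {S : Set (EuclideanSpace ℝ (Fin n))}
    {f : EuclideanSpace ℝ (Fin m) → EuclideanSpace ℝ (Fin n)}
    {h : EuclideanSpace ℝ (Fin n) → EuclideanSpace ℝ (Fin m)}
    {V : Set (EuclideanSpace ℝ (Fin m))} {O : Set (EuclideanSpace ℝ (Fin n))}
    {y : EuclideanSpace ℝ (Fin m)}

/-- The first coordinate of `h` is nonnegative on `S` near `f y` and zero at `f y`, so it has a
local minimum there within `S`. -/
theorem IsPatch.nonneg_of_mem_posTangentConeAt (P : IsPatch S (half m) f h V O) (hy : y ∈ V)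
    {i : Fin m} (hi : (i : ℕ) = 0) (hyi : y i = 0)
    {v : EuclideanSpace ℝ (Fin n)} (hv : v ∈ posTangentConeAt S (f y)) :
    0 ≤ fderiv ℝ h (f y) v i := by
  have hO := P.mapsTo y hy
  have h1 : HasFDerivWithinAt (fun x => h x i)
      ((EuclideanSpace.proj i : EuclideanSpace ℝ (Fin m) →L[ℝ] ℝ) ∘L fderiv ℝ h (f y)) S (f y) :=
    ((EuclideanSpace.proj i : EuclideanSpace ℝ (Fin m) →L[ℝ] ℝ).hasFDerivAt.comp (f y)
      (P.hasFDerivAt_inv hO)).hasFDerivWithinAt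
  have h2 : IsLocalMinOn (fun x => h x i) S (f y) := by
    filter_upwards [self_mem_nhdsWithin, mem_nhdsWithin_of_mem_nhds (P.isOpen_cod.mem_nhds hO)]
      with x hx hx'
    rw [P.left_inv y hy, hyi]
    exact (P.mem_of_mem hx' hx).2 i hi
  exact h2.hasFDerivWithinAt_nonneg h1 hv

/-- The vector is the velocity of the curve `s ↦ f (y + s • w)`, which stays in `S` for small `s >
0`. -/
theorem IsPatch.mem_posTangentConeAt {D : Set (EuclideanSpace ℝ (Fin m))}
    (P : IsPatch S D f h V O) (hy : y ∈ V)
    {w : EuclideanSpace ℝ (Fin m)} (hw : ∀ᶠ s : ℝ in 𝓝[>] 0, y + s • w ∈ D) :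
    fderiv ℝ f y w ∈ posTangentConeAt S (f y) := by
  have hg : HasDerivAt (fun s : ℝ => f (y + s • w)) (fderiv ℝ f y w) 0 := by
    have h1 : HasDerivAt (fun s : ℝ => y + s • w) w 0 := by
      simpa using! ((hasDerivAt_id (0 : ℝ)).smul_const w).const_add y
    have h2 : HasFDerivAt f (fderiv ℝ f y) (y + (0 : ℝ) • w) := by simpa using P.hasFDerivAt hy
    exact h2.comp_hasDerivAt 0 h1
  have hcont : Filter.Tendsto (fun s : ℝ => f (y + s • w)) (𝓝[>] 0) (𝓝 (f y)) := by
    have := hg.continuousAt.tendsto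
    simp only [zero_smul, add_zero] at this
    exact this.mono_left nhdsWithin_le_nhds
  refine mem_tangentConeAt_of_seq (𝓝[>] (0 : ℝ)) (fun s => (s⁻¹).toNNReal)
    (fun s => f (y + s • w) - f y) ?_ ?_ ?_
  · simpa using hcont.sub_const (f y)
  · have hV : ∀ᶠ s : ℝ in 𝓝[>] 0, y + s • w ∈ V := by
      have : Filter.Tendsto (fun s : ℝ => y + s • w) (𝓝[>] 0) (𝓝 y) := by
        have h1 : Continuous fun s : ℝ => y + s • w := by fun_prop
        have := (h1.tendsto 0).mono_left (nhdsWithin_le_nhds (s := Ioi 0))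
        simpa using this
      exact this.eventually (P.isOpen_dom.mem_nhds hy)
    filter_upwards [hw, hV] with s hs hsV
    rw [add_sub_cancel]
    exact (P.mem_iff _ hsV).2 hs
  · have h1 := hg.tendsto_slope_zero_right
    refine h1.congr' ?_
    filter_upwards [self_mem_nhdsWithin] with s hs
    have : 0 ≤ s⁻¹ := inv_nonneg.2 (le_of_lt hs)
    rw [NNReal.smul_def, Real.coe_toNNReal _ this]
    simp

end PosTangent

/-- Half-plane parametrizations near each point, in which the edge is the manifold boundary. -/
theorem exists_patch {n m : ℕ} {M : Set (EuclideanSpace ℝ (Fin n))} (hM : IsSubmanifold m M)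
    {p : EuclideanSpace ℝ (Fin n)} (hp : p ∈ M) :
    ∃ f h V O, IsPatch M (half m) f h V O ∧ p ∈ O ∧ ∀ x ∈ O, x ∈ M →
      (x ∈ bdry m M ↔ 0 < m ∧ ∀ i : Fin m, (i : ℕ) = 0 → h x i = 0) := by
  obtain ⟨Ψ, hpΨ, hΨ, hΨM⟩ := exists_half_chart hM hp
  have P := isPatch_of_chart hM.1 hΨ hΨM
  refine ⟨_, _, _, _, P, hpΨ, fun x hx hxM => ⟨?_, ?_⟩⟩
  · rintro ⟨-, hm, Φ, hxΦ, hΦ, hΦM, hΦ0⟩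
    refine ⟨hm, fun i hi => ?_⟩
    have P' := isPatch_of_chart hM.1 hΦ hΦM
    have hy' := P'.mem_of_mem hxΦ hxM
    have hx' := (P'.right_inv x hxΦ hxM).2
    have hy := P.mem_of_mem hx hxM
    have hxy := (P.right_inv x hx hxM).2
    by_contra hne
    have hpos : 0 < truncL hM.1 (Ψ x) i := lt_of_le_of_ne (hy.2 i hi) (Ne.symm hne)
    set f := fun y => Ψ.symm (padL n m y)
    set f' := fun y => Φ.symm (padL n m y)
    set y := truncL hM.1 (Ψ x)
    set y' := truncL hM.1 (Φ x)
    replace hxy : f y = x := hxy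
    replace hx' : f' y' = x := hx'
    have hy0 : y' i = 0 := hΦ0 _ hi
    -- Invariance of the boundary: `v` points out of `M` in the chart `Φ`, whereas at a point
    -- interior for `Ψ` every tangent vector lies in the positive tangent cone. Read in `Φ`, this
    -- gives `0 ≤ -1`.
    let v := fderiv ℝ f' y' (-EuclideanSpace.single i 1)
    have hvT : v ∈ Tan M (f y) := by
      rw [hxy, ← hx', P'.tan_eq uniqueDiffOn_half hy'.1 hy'.2]
      exact ⟨_, rfl⟩
    rw [P.tan_eq uniqueDiffOn_half hy.1 hy.2] at hvT
    obtain ⟨w, hw⟩ := hvT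
    have hvP : v ∈ posTangentConeAt M (f y) := by
      rw [← hw]
      refine P.mem_posTangentConeAt hy.1 ?_
      have hint : y ∈ interior (half m) := mem_interior_half fun j hj => by
        rwa [show j = i from Fin.ext (hj.trans hi.symm)]
      have : Filter.Tendsto (fun s : ℝ => y + s • w) (𝓝[>] 0) (𝓝 y) := by
        have h1 : Continuous fun s : ℝ => y + s • w := by fun_prop
        have := (h1.tendsto 0).mono_left (nhdsWithin_le_nhds (s := Ioi 0))
        simpa using this
      exact (this.eventually (mem_interior_iff_mem_nhds.1 hint))
    rw [hxy, ← hx'] at hvP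
    have := P'.nonneg_of_mem_posTangentConeAt hy'.1 hi hy0 hvP
    rw [P'.fderiv_inv_fderiv hy'.1] at this
    simp at this
    linarith
  · rintro ⟨hm, h0⟩
    refine ⟨hxM, hm, Ψ, hx, hΨ, hΨM, fun i hi => ?_⟩
    have := h0 ⟨0, hm⟩ rfl
    rw [truncL_apply] at this
    rwa [show i = Fin.castLE hM.1 ⟨0, hm⟩ from Fin.ext hi]

/-- The projection of `ℝᵏ⁺¹` that forgets the first coordinate. -/
def tailL (k : ℕ) : EuclideanSpace ℝ (Fin (k + 1)) →L[ℝ] EuclideanSpace ℝ (Fin k) :=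
  LinearMap.toContinuousLinearMap
    { toFun := fun y => WithLp.toLp 2 fun i => y i.succ
      map_add' := fun x y => by ext i; simp
      map_smul' := fun c y => by ext i; simp }

theorem tailL_edgeL {k : ℕ} (w : EuclideanSpace ℝ (Fin k)) : tailL k (edgeL k w) = w := rfl

theorem edgeL_tailL {k : ℕ} {y : EuclideanSpace ℝ (Fin (k + 1))} (hy : y 0 = 0) :
    edgeL k (tailL k y) = y := by
  ext i
  refine Fin.cases ?_ (fun i => ?_) i
  · exact hy.symm
  · rfl

section Edge

variable {n k : ℕ} {M : Set (EuclideanSpace ℝ (Fin n))}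
    {f : EuclideanSpace ℝ (Fin (k + 1)) → EuclideanSpace ℝ (Fin n)}
    {h : EuclideanSpace ℝ (Fin n) → EuclideanSpace ℝ (Fin (k + 1))}
    {V : Set (EuclideanSpace ℝ (Fin (k + 1)))} {O : Set (EuclideanSpace ℝ (Fin n))}

/-- A parametrization of the boundary. -/
theorem IsPatch.edge (P : IsPatch M (half (k + 1)) f h V O)
    (hb : ∀ x ∈ O, x ∈ M → (x ∈ bdry (k + 1) M ↔ h x 0 = 0)) :
    IsPatch (bdry (k + 1) M) univ (f ∘ edgeL k) (tailL k ∘ h) ((edgeL k) ⁻¹' V) O where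
  isOpen_dom := P.isOpen_dom.preimage (edgeL k).continuous
  isOpen_cod := P.isOpen_cod
  smooth := P.smooth.comp (edgeL k).contDiff.contDiffOn fun y hy => hy
  smooth_inv := (tailL k).contDiff.comp_contDiffOn P.smooth_inv
  mapsTo y hy := P.mapsTo _ hy
  left_inv y hy := by
    simp only [Function.comp_apply]
    rw [P.left_inv _ hy, tailL_edgeL]
  mem_iff y hy := by
    refine iff_of_true ?_ (mem_univ _)
    have hM : f (edgeL k y) ∈ M := (P.mem_iff _ hy).2 (mem_half_succ.2 le_rfl)
    refine (hb _ (P.mapsTo _ hy) hM).2 ?_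
    rw [P.left_inv _ hy, edgeL_zero]
  right_inv x hx hxS := by
    have h1 : edgeL k (tailL k (h x)) = h x := edgeL_tailL ((hb x hx hxS.1).1 hxS)
    simp only [Function.comp_apply, mem_preimage, h1]
    exact P.right_inv x hx hxS.1

theorem IsPatch.fderiv_edge (P : IsPatch M (half (k + 1)) f h V O)
    {w : EuclideanSpace ℝ (Fin k)} (hw : edgeL k w ∈ V) :
    fderiv ℝ (f ∘ edgeL k) w = fderiv ℝ f (edgeL k w) ∘L edgeL k :=
  ((P.hasFDerivAt hw).comp w (edgeL k).hasFDerivAt).fderiv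

theorem jac_sq_eq_det_gram {U V : Type*} [NormedAddCommGroup U] [InnerProductSpace ℝ U]
    [FiniteDimensional ℝ U] [NormedAddCommGroup V] [InnerProductSpace ℝ V] {ι : Type*} [Fintype ι]
    [DecidableEq ι] (A : U →L[ℝ] V) (b : OrthonormalBasis ι ℝ U) :
    jac A ^ 2 = (Matrix.gram ℝ fun i => A (b i)).det := by
  simpa using! LinearMap.normDet_sq_eq_det_gram (A : U →ₗ[ℝ] V) b

/-- `A⁺` annihilates the orthogonal complement of the range of `A`, so its adjoint takes values in
that range. This makes the conormal below tangent to `M`. -/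
theorem self_pinv_adjoint_pinv {U V : Type*} [NormedAddCommGroup U] [InnerProductSpace ℝ U]
    [FiniteDimensional ℝ U] [NormedAddCommGroup V] [InnerProductSpace ℝ V] [FiniteDimensional ℝ V]
    {A : U →L[ℝ] V} (hA : Function.Injective A) (u : U) :
    A (pinv A (ContinuousLinearMap.adjoint (pinv A) u)) =
      ContinuousLinearMap.adjoint (pinv A) u := by
  rw [self_pinv_eq_starProjection hA]
  refine ext_inner_right ℝ fun v => ?_
  rw [Submodule.inner_starProjection_left_eq_right, ContinuousLinearMap.adjoint_inner_left,
    ContinuousLinearMap.adjoint_inner_left, pinv_starProjection hA]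

/-- Base times height. -/
theorem jac_mul_norm {V : Type*} [NormedAddCommGroup V] [InnerProductSpace ℝ V]
    [FiniteDimensional ℝ V] {A : EuclideanSpace ℝ (Fin (k + 1)) →L[ℝ] V}
    (hA : Function.Injective A) :
    jac A * ‖ContinuousLinearMap.adjoint (pinv A) (EuclideanSpace.single 0 1)‖ =
      jac (A ∘L edgeL k) := by
  set N := ContinuousLinearMap.adjoint (pinv A) (EuclideanSpace.single 0 1)
  rw [← sq_eq_sq₀ (mul_nonneg (jac_nonneg _) (norm_nonneg _)) (jac_nonneg _), mul_pow]
  let e := EuclideanSpace.basisFun (Fin (k + 1)) ℝ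
  let e' := EuclideanSpace.basisFun (Fin k) ℝ
  let G : Matrix (Fin (k + 1)) (Fin (k + 1)) ℝ := Matrix.gram ℝ fun i => A (e i)
  have h1 : jac A ^ 2 = G.det := jac_sq_eq_det_gram A e
  have h2 : jac (A ∘L edgeL k) ^ 2 = (G.submatrix Fin.succ Fin.succ).det := by
    have h3 : jac (A ∘L edgeL k) ^ 2 = (Matrix.gram ℝ fun i => A (edgeL k (e' i))).det :=
      jac_sq_eq_det_gram (A ∘L edgeL k) e'
    rw [h3]
    congr 1
    have : ∀ i, edgeL k (e' i) = e i.succ := by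
      intro i
      ext j
      refine Fin.cases ?_ (fun j => ?_) j
      · simp [e, (Fin.succ_ne_zero i).symm]
      · simp [e, e']
    ext i j
    simp [G, Matrix.gram, this]
  have h4 : ∀ v, inner ℝ N v = pinv A v 0 := by
    intro v
    rw [ContinuousLinearMap.adjoint_inner_left, EuclideanSpace.inner_single_left]
    simp
  -- `N` is dual to the first coordinate: `N · A z = z_0`. Hence `u` solves `G u = e_0` and has
  -- first coordinate `‖N‖²`, which Cramer's rule expresses as a minor over `det G`.
  let u := pinv A N
  have hNu : A u = N := self_pinv_adjoint_pinv hA _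
  have h5 : G.mulVec u.ofLp = Pi.single 0 1 := by
    ext i
    have h6 : inner ℝ (A (e i)) (A u) = (G.mulVec u.ofLp) i := by
      have : u = ∑ j, u j • e j := by
        conv_lhs => rw [← e.sum_repr u]
        rfl
      conv_lhs => rw [this]
      rw [map_sum, inner_sum, Matrix.mulVec, dotProduct]
      refine Finset.sum_congr rfl fun j _ => ?_
      rw [map_smul, inner_smul_right, mul_comm]
      rfl
    rw [← h6, hNu, real_inner_comm, h4, pinv_apply_self hA]
    simp [e, Pi.single_apply, eq_comm]
  have h7 : G.det * u 0 = (G.submatrix Fin.succ Fin.succ).det := by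
    have h8 : G.adjugate.mulVec (G.mulVec u.ofLp) = G.det • u.ofLp := by
      rw [Matrix.mulVec_mulVec, Matrix.adjugate_mul, Matrix.smul_mulVec, Matrix.one_mulVec]
    have h9 := congrFun h8 0
    rw [h5, Matrix.mulVec_single_one] at h9
    rw [← smul_eq_mul, ← Pi.smul_apply, ← h9, Matrix.col_apply,
      Matrix.adjugate_fin_succ_eq_det_submatrix]
    simp
  rw [h1, h2, ← real_inner_self_eq_norm_sq, h4]
  exact h7

variable {w : EuclideanSpace ℝ (Fin k)}

/-- The outward conormal in a parametrization. -/
theorem IsPatch.isOutwardConormal_iff (P : IsPatch M (half (k + 1)) f h V O)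
    (hb : ∀ x ∈ O, x ∈ M → (x ∈ bdry (k + 1) M ↔ h x 0 = 0)) (hw : edgeL k w ∈ V)
    (ν : EuclideanSpace ℝ (Fin n)) :
    IsOutwardConormal (k + 1) M (f (edgeL k w)) ν ↔
      ν = -(‖ContinuousLinearMap.adjoint (pinv (fderiv ℝ f (edgeL k w)))
        (EuclideanSpace.single 0 1)‖⁻¹ • ContinuousLinearMap.adjoint
          (pinv (fderiv ℝ f (edgeL k w))) (EuclideanSpace.single 0 1)) := by
  set y := edgeL k w with hy
  set A := fderiv ℝ f y with hAdef
  have hA : Function.Injective A := P.injective hw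
  -- `N` is the gradient along `M` of the first coordinate, so it is normal to the boundary and
  -- points into `M`.
  set N := ContinuousLinearMap.adjoint (pinv A) (EuclideanSpace.single 0 1) with hN
  have hyD : y ∈ half (k + 1) := mem_half_succ.2 le_rfl
  have h4 : ∀ v, inner ℝ N v = pinv A v 0 := by
    intro v
    rw [ContinuousLinearMap.adjoint_inner_left, EuclideanSpace.inner_single_left]
    simp
  have hNA : ∀ u, inner ℝ N (A u) = u 0 := fun u => by rw [h4, pinv_apply_self hA]
  have hTan : Tan M (f y) = LinearMap.range (A : EuclideanSpace ℝ (Fin (k + 1)) →ₗ[ℝ] _) :=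
    P.tan_eq uniqueDiffOn_half hw hyD
  have hNT : A (pinv A N) = N := self_pinv_adjoint_pinv hA _
  have hN0 : N ≠ 0 := by
    intro h0
    have := hNA (EuclideanSpace.single 0 1)
    rw [h0, inner_zero_left] at this
    simp at this
  have hNpos : 0 < ‖N‖ := norm_pos_iff.2 hN0
  have hTb : Tan (bdry (k + 1) M) (f y) =
      LinearMap.range ((A ∘L edgeL k : _ →L[ℝ] _) : EuclideanSpace ℝ (Fin k) →ₗ[ℝ] _) := by
    have := (P.edge hb).tan_eq uniqueDiffOn_univ (y := w) hw (mem_univ _)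
    rwa [P.fderiv_edge hw] at this
  have hpos : ∀ u, A u ∈ posTangentConeAt M (f y) ↔ 0 ≤ u 0 := by
    intro u
    constructor
    · intro hu
      have := P.nonneg_of_mem_posTangentConeAt hw (i := 0) rfl rfl hu
      rwa [P.fderiv_inv_fderiv hw] at this
    · intro hu
      refine P.mem_posTangentConeAt hw ?_
      filter_upwards [self_mem_nhdsWithin] with s hs
      rw [mem_half_succ]
      have : (y + s • u) 0 = s * u 0 := by simp [y]
      rw [this]
      exact mul_nonneg (le_of_lt hs) hu
  constructor
  · rintro ⟨hν1, hνT, hνb, hνp⟩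
    rw [hTan] at hνT
    obtain ⟨u, rfl⟩ := hνT
    change ‖A u‖ = 1 at hν1
    change A u ∉ _ at hνp
    rw [hpos, not_le] at hνp
    -- Orthogonality to the boundary leaves a dependence on the first coordinate only, so `A u` is a
    -- multiple of `N`. The outward condition then fixes the sign and the norm fixes the size.
    have hperp : ∀ z, inner ℝ (A u) (A z) = inner ℝ (A u) (A (EuclideanSpace.single 0 1)) * z 0 := by
      intro z
      have hz : z = z 0 • EuclideanSpace.single 0 1 + edgeL k (tailL k z) := by
        ext i
        refine Fin.cases ?_ (fun i => ?_) i
        · simp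
        · simp [tailL]
      have h0 : inner ℝ (A u) (A (edgeL k (tailL k z))) = 0 := hνb _ (by
        rw [hTb]
        exact ⟨_, rfl⟩)
      conv_lhs => rw [hz]
      rw [map_add, inner_add_right, h0, map_smul, inner_smul_right, add_zero, mul_comm]
    set c := inner ℝ (A u) (A (EuclideanSpace.single 0 1)) with hc
    have hAu : A u = c • N := by
      have h5 : ∀ z, inner ℝ (A u - c • N) (A z) = 0 := by
        intro z
        rw [inner_sub_left, hperp, inner_smul_left, hNA]
        simp
      have h6 := h5 (u - c • pinv A N)
      rw [map_sub, map_smul, hNT] at h6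
      exact sub_eq_zero.1 (inner_self_eq_zero.1 h6)
    have hu0 : u 0 = c * ‖N‖ ^ 2 := by
      rw [← hNA u, hAu, inner_smul_right, real_inner_self_eq_norm_sq]
    have hc0 : c < 0 := by
      by_contra hcc
      rw [hu0] at hνp
      have : 0 ≤ c * ‖N‖ ^ 2 := mul_nonneg (not_lt.1 hcc) (by positivity)
      linarith
    rw [hAu, norm_smul, Real.norm_eq_abs, abs_of_neg hc0] at hν1
    have hc1 : c = -‖N‖⁻¹ := by
      field_simp
      linarith
    change A u = _
    rw [hAu, hc1, neg_smul]
  · rintro rfl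
    refine ⟨?_, ?_, ?_, ?_⟩
    · rw [norm_neg, norm_smul, norm_inv, norm_norm, inv_mul_cancel₀ hNpos.ne']
    · rw [hTan]
      exact Submodule.neg_mem _ (Submodule.smul_mem _ _ ⟨_, hNT⟩)
    · rw [hTb]
      rintro _ ⟨z, rfl⟩
      change inner ℝ _ (A (edgeL k z)) = 0
      rw [inner_neg_left, inner_smul_left, hNA, edgeL_zero, mul_zero, neg_zero]
    · have : -(‖N‖⁻¹ • N) = A (-(‖N‖⁻¹ • pinv A N)) := by
        rw [map_neg, map_smul, hNT]
      rw [this, hpos, not_le]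
      have h5 : pinv A N 0 = ‖N‖ ^ 2 := by rw [← h4, real_inner_self_eq_norm_sq]
      simp only [PiLp.neg_apply, PiLp.smul_apply, smul_eq_mul, h5]
      have : 0 < ‖N‖⁻¹ * ‖N‖ ^ 2 := by positivity
      linarith

/-- The conormal is the normalized `-N`, and the factor `‖N‖` lost in normalizing is the ratio of
the volume factors of the edge and of the patch, by `jac_mul_norm`. -/
theorem IsPatch.flux_eq (P : IsPatch M (half (k + 1)) f h V O)
    (hb : ∀ x ∈ O, x ∈ M → (x ∈ bdry (k + 1) M ↔ h x 0 = 0)) (hw : edgeL k w ∈ V)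
    {ν : EuclideanSpace ℝ (Fin n)} (hν : IsOutwardConormal (k + 1) M (f (edgeL k w)) ν)
    (v : EuclideanSpace ℝ (Fin n)) :
    jac (fderiv ℝ (f ∘ edgeL k) w) * inner ℝ v ν =
      -(jac (fderiv ℝ f (edgeL k w)) * pinv (fderiv ℝ f (edgeL k w)) v 0) := by
  have hA : Function.Injective (fderiv ℝ f (edgeL k w)) := P.injective hw
  rw [(P.isOutwardConormal_iff hb hw ν).1 hν, P.fderiv_edge hw, ← jac_mul_norm hA]
  set A := fderiv ℝ f (edgeL k w)
  set N := ContinuousLinearMap.adjoint (pinv A) (EuclideanSpace.single 0 1)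
  have h4 : inner ℝ N v = pinv A v 0 := by
    rw [ContinuousLinearMap.adjoint_inner_left, EuclideanSpace.inner_single_left]
    simp
  have hN0 : ‖N‖ ≠ 0 := by
    rw [norm_ne_zero_iff]
    intro h0
    have : inner ℝ N (A (EuclideanSpace.single 0 1)) = (1 : ℝ) := by
      rw [ContinuousLinearMap.adjoint_inner_left, EuclideanSpace.inner_single_left,
        pinv_apply_self hA]
      simp
    rw [h0, inner_zero_left] at this
    exact zero_ne_one this
  rw [inner_neg_right, inner_smul_right, real_inner_comm, h4]
  field_simp

end Edge

end

end FirstVariation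

/-! ### Integrability, and the divergence theorem on all of `M`. -/

namespace FirstVariation

noncomputable section

set_option linter.unusedSectionVars false

variable {n m : ℕ}

/-- Every point of `S` has a neighbourhood in `S` parametrized by a smooth embedding of a set with
unique derivatives. -/
def HasPatches (m : ℕ) (S : Set (EuclideanSpace ℝ (Fin n))) : Prop :=
  ∀ p ∈ S, ∃ (D : Set (EuclideanSpace ℝ (Fin m)))
    (f : EuclideanSpace ℝ (Fin m) → EuclideanSpace ℝ (Fin n))
    (h : EuclideanSpace ℝ (Fin n) → EuclideanSpace ℝ (Fin m))
    (V : Set (EuclideanSpace ℝ (Fin m))) (O : Set (EuclideanSpace ℝ (Fin n))),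
    UniqueDiffOn ℝ D ∧ IsPatch S D f h V O ∧ p ∈ O

theorem IsSubmanifold.hasPatches {M : Set (EuclideanSpace ℝ (Fin n))} (hM : IsSubmanifold m M) :
    HasPatches m M := by
  intro p hp
  obtain ⟨f, h, V, O, P, hpO, -⟩ := exists_patch hM hp
  exact ⟨_, f, h, V, O, uniqueDiffOn_half, P, hpO⟩

theorem exists_patch_succ {k : ℕ} {M : Set (EuclideanSpace ℝ (Fin n))}
    (hM : IsSubmanifold (k + 1) M) {p : EuclideanSpace ℝ (Fin n)} (hp : p ∈ M) :
    ∃ f h V O, IsPatch M (half (k + 1)) f h V O ∧ p ∈ O ∧ ∀ x ∈ O, x ∈ M →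
      (x ∈ bdry (k + 1) M ↔ h x 0 = 0) := by
  obtain ⟨f, h, V, O, P, hpO, hb⟩ := exists_patch hM hp
  refine ⟨f, h, V, O, P, hpO, fun x hx hxM => (hb x hx hxM).trans ⟨fun H => H.2 0 rfl, ?_⟩⟩
  intro H
  refine ⟨k.succ_pos, fun i hi => ?_⟩
  rwa [show i = 0 from Fin.ext hi]

theorem IsSubmanifold.hasPatches_bdry {k : ℕ} {M : Set (EuclideanSpace ℝ (Fin n))}
    (hM : IsSubmanifold (k + 1) M) : HasPatches k (bdry (k + 1) M) := by
  intro p hp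
  obtain ⟨f, h, V, O, P, hpO, hb⟩ := exists_patch_succ hM hp.1
  exact ⟨_, _, _, _, O, uniqueDiffOn_univ, P.edge hb, hpO⟩

/-- Inside a patch the boundary is the zero set in `M` of a continuous coordinate, hence it is
closed in `M`. -/
theorem isCompact_bdry {k : ℕ} {M : Set (EuclideanSpace ℝ (Fin n))}
    (hM : IsSubmanifold (k + 1) M) (hMc : IsCompact M) : IsCompact (bdry (k + 1) M) := by
  refine hMc.of_isClosed_subset (isClosed_of_closure_subset fun x hx => ?_) fun x hx => hx.1
  have hxM : x ∈ M := hMc.isClosed.closure_subset_iff.2 (fun z hz => hz.1) hx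
  obtain ⟨f, h, V, O, P, hxO, hb⟩ := exists_patch_succ hM hxM
  rw [hb x hxO hxM]
  have hc : ContinuousAt (fun z => h z 0) x :=
    (EuclideanSpace.proj (0 : Fin (k + 1)) : _ →L[ℝ] ℝ).continuous.continuousAt.comp
      (P.contDiffAt_inv hxO).continuousAt
  have hf : ∃ᶠ z in 𝓝 x, h z 0 ∈ ({0} : Set ℝ) := by
    refine ((mem_closure_iff_frequently.1 hx).and_eventually
      (P.isOpen_cod.mem_nhds hxO)).mono ?_
    rintro z ⟨hz, hzO⟩
    exact (hb z hzO hz.1).1 hz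
  exact isClosed_singleton.mem_of_frequently_of_tendsto hf hc

theorem HasPatches.measure_lt_top {S : Set (EuclideanSpace ℝ (Fin n))} (hS : HasPatches m S)
    (hSc : IsCompact S) : Measure.euclideanHausdorffMeasure m S < ⊤ := by
  have := hSc.induction_on (p := fun t => Measure.euclideanHausdorffMeasure m (t ∩ S) < ⊤)
    (by simp) (fun s t hst ht => (measure_mono (inter_subset_inter_left S hst)).trans_lt ht)
    (fun s t hs ht => by
      rw [union_inter_distrib_right]
      exact measure_union_lt_top hs ht) ?_
  · rwa [inter_self] at this
  intro x hx
  obtain ⟨D, f, h, V, O, hD, P, hxO⟩ := hS x hx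
  obtain ⟨r, hr, hrO⟩ := Metric.nhds_basis_closedBall.mem_iff.1 (P.isOpen_cod.mem_nhds hxO)
  refine ⟨Metric.closedBall x r, mem_nhdsWithin_of_mem_nhds (Metric.closedBall_mem_nhds x hr), ?_⟩
  rw [← P.image_coord hrO]
  exact P.measure_image_lt_top (P.isCompact_coord hSc Metric.isClosed_closedBall hrO)
    ((P.coord_subset hrO).trans inter_subset_left)

theorem HasPatches.integrableOn {S : Set (EuclideanSpace ℝ (Fin n))} (hS : HasPatches m S)
    (hSc : IsCompact S) {g : EuclideanSpace ℝ (Fin n) → ℝ} (hg : ContinuousOn g S) :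
    IntegrableOn g S (Measure.euclideanHausdorffMeasure m) := by
  obtain ⟨C, hC⟩ := hSc.exists_bound_of_continuousOn hg
  have : IsFiniteMeasure ((Measure.euclideanHausdorffMeasure m).restrict S) :=
    ⟨by simpa using hS.measure_lt_top hSc⟩
  refine Integrable.of_bound (hg.aestronglyMeasurable hSc.measurableSet) C ?_
  filter_upwards [ae_restrict_mem hSc.measurableSet] with x hx using hC x hx

theorem HasPatches.continuousOn_divM {S : Set (EuclideanSpace ℝ (Fin n))} (hS : HasPatches m S)
    {X : EuclideanSpace ℝ (Fin n) → EuclideanSpace ℝ (Fin n)} (hX : ContDiffOn ℝ 1 X S) :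
    ContinuousOn (divM S X) S := by
  intro x hx
  obtain ⟨D, f, h, V, O, hD, P, hxO⟩ := hS x hx
  refine P.continuousWithinAt_of_comp hxO hx ?_
  have h1 : ContinuousOn (fun y => tr _ (pinv (fderiv ℝ f y) ∘L
      fderivWithin ℝ (X ∘ f) (V ∩ D) y)) (V ∩ D) := by
    refine (tr _).continuous.comp_continuousOn ?_
    refine (P.continuousOn_pinv.continuousOn.mono inter_subset_left).clm_comp ?_
    have hu : UniqueDiffOn ℝ (V ∩ D) := fun y hy => P.uniqueDiffWithinAt hD hy.1 hy.2
    exact (P.contDiffOn_comp (by simp) hX).continuousOn_fderivWithin hu le_rfl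
  refine h1.congr fun y hy => ?_
  exact P.divM_eq hD hy.1 hy.2 (hX.differentiableOn one_ne_zero _ ((P.mem_iff y hy.1).2 hy.2))

/-- `tr_weight_flip`, divided by the positive volume factor, gives a formula that is visibly
continuous in coordinates. -/
theorem HasPatches.continuousOn_inner_meanCurvature {S : Set (EuclideanSpace ℝ (Fin n))}
    (hS : HasPatches m S) {X : EuclideanSpace ℝ (Fin n) → EuclideanSpace ℝ (Fin n)}
    (hX : ContinuousOn X S) :
    ContinuousOn (fun x => inner ℝ (meanCurvature S x) (X x)) S := by
  intro x hx
  obtain ⟨D, f, h, V, O, hD, P, hxO⟩ := hS x hx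
  refine P.continuousWithinAt_of_comp hxO hx ?_
  have h1 : ContinuousOn (fun y => (jac (fderiv ℝ f y))⁻¹ *
      tr _ ((fderiv ℝ (fun z => jac (fderiv ℝ f z) • pinv (fderiv ℝ f z)) y).flip (X (f y))))
      (V ∩ D) := by
    refine ContinuousOn.mul (ContinuousOn.inv₀
      (P.contDiffOn_jac.continuousOn.mono inter_subset_left)
      fun y hy => (jac_pos (P.injective hy.1)).ne') ?_
    refine (tr _).continuous.comp_continuousOn (ContinuousOn.clm_apply ?_ ?_)
    · have h2 : ContinuousOn
          (fderiv ℝ (fun z => jac (fderiv ℝ f z) • pinv (fderiv ℝ f z))) V :=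
        P.contDiffOn_weight.continuousOn_fderiv_of_isOpen P.isOpen_dom (by simp)
      exact (ContinuousLinearMap.flipₗᵢ ℝ (EuclideanSpace ℝ (Fin m)) (EuclideanSpace ℝ (Fin n))
        (EuclideanSpace ℝ (Fin m))).continuous.comp_continuousOn (h2.mono inter_subset_left)
    · exact hX.comp (P.smooth.continuousOn.mono inter_subset_left)
        fun z hz => (P.mem_iff z hz.1).2 hz.2
  refine h1.congr fun y hy => ?_
  simp only [Function.comp_apply]
  rw [P.tr_weight_flip hD hy.1 hy.2, inv_mul_cancel_left₀ (jac_pos (P.injective hy.1)).ne']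

/-- `ν` is only a pointwise choice; continuity of the flux density comes from `IsPatch.flux_eq`,
which computes it in coordinates. -/
theorem continuousOn_inner_conormal {k : ℕ} {M : Set (EuclideanSpace ℝ (Fin n))}
    (hM : IsSubmanifold (k + 1) M) {X ν : EuclideanSpace ℝ (Fin n) → EuclideanSpace ℝ (Fin n)}
    (hX : ContinuousOn X M) (hν : ∀ x ∈ bdry (k + 1) M, IsOutwardConormal (k + 1) M x (ν x)) :
    ContinuousOn (fun x => inner ℝ (X x) (ν x)) (bdry (k + 1) M) := by
  intro x hx
  obtain ⟨f, h, V, O, P, hxO, hb⟩ := exists_patch_succ hM hx.1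
  refine (P.edge hb).continuousWithinAt_of_comp hxO hx ?_
  have h0 : ContinuousOn (fderiv ℝ f ∘ edgeL k) (edgeL k ⁻¹' V) :=
    P.contDiffOn_fderiv.continuousOn.comp (edgeL k).continuous.continuousOn fun w hw => hw
  have hXc : ContinuousOn (fun w => X (f (edgeL k w))) (edgeL k ⁻¹' V) := by
    refine hX.comp (P.smooth.continuousOn.comp (edgeL k).continuous.continuousOn fun w hw => hw) ?_
    exact fun w hw => (P.mem_iff _ hw).2 (mem_half_succ.2 le_rfl)
  have hp : ContinuousOn (fun w => pinv (fderiv ℝ f (edgeL k w))) (edgeL k ⁻¹' V) :=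
    P.continuousOn_pinv.continuousOn.comp (edgeL k).continuous.continuousOn fun w hw => hw
  have h1 : ContinuousOn (fun w => (jac (fderiv ℝ (f ∘ edgeL k) w))⁻¹ *
      -(jac (fderiv ℝ f (edgeL k w)) * pinv (fderiv ℝ f (edgeL k w)) (X (f (edgeL k w))) 0))
      (edgeL k ⁻¹' V) := by
    refine ContinuousOn.mul (ContinuousOn.inv₀ (P.edge hb).contDiffOn_jac.continuousOn
      fun y hy => (jac_pos ((P.edge hb).injective hy)).ne') ?_
    refine ((continuous_jac.comp_continuousOn h0).mul ?_).neg
    exact (EuclideanSpace.proj (0 : Fin (k + 1)) : _ →L[ℝ] ℝ).continuous.comp_continuousOn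
      (hp.clm_apply hXc)
  refine (h1.mono inter_subset_left).congr fun w hw => ?_
  have hwb := ((P.edge hb).mem_iff w hw.1).2 hw.2
  change inner ℝ (X (f (edgeL k w))) (ν (f (edgeL k w))) = (jac (fderiv ℝ (f ∘ edgeL k) w))⁻¹ *
    -(jac (fderiv ℝ f (edgeL k w)) * pinv (fderiv ℝ f (edgeL k w)) (X (f (edgeL k w))) 0)
  have h2 := P.flux_eq hb hw.1 (hν _ hwb) (X (f (edgeL k w)))
  rw [← h2, inv_mul_cancel_left₀ (jac_pos ((P.edge hb).injective hw.1)).ne']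

/-- Derivatives within `S` are determined only along tangent directions, so additivity is checked
after composition with `f`, on a set with unique derivatives. -/
theorem HasPatches.divM_sum {S : Set (EuclideanSpace ℝ (Fin n))} (hS : HasPatches m S)
    {ι : Type*} {t : Finset ι} {X : ι → EuclideanSpace ℝ (Fin n) → EuclideanSpace ℝ (Fin n)}
    (hX : ∀ i, ContDiffOn ℝ 1 (X i) S)
    {Y : EuclideanSpace ℝ (Fin n) → EuclideanSpace ℝ (Fin n)}
    (hY : ∀ x ∈ S, Y x = ∑ i ∈ t, X i x) {x : EuclideanSpace ℝ (Fin n)} (hx : x ∈ S) :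
    divM S Y x = ∑ i ∈ t, divM S (X i) x := by
  obtain ⟨D, f, h, V, O, hD, P, hxO⟩ := hS x hx
  have hy := P.mem_of_mem hxO hx
  have hxy := (P.right_inv x hxO hx).2
  have hYd : ContDiffOn ℝ 1 Y S := (ContDiffOn.sum fun i _ => hX i).congr hY
  have hd : ∀ i, DifferentiableWithinAt ℝ (X i) S (f (h x)) := fun i =>
    (hX i).differentiableOn one_ne_zero _ (hxy.symm ▸ hx)
  have hu := P.uniqueDiffWithinAt hD hy.1 hy.2
  rw [← hxy, P.divM_eq hD hy.1 hy.2 (hYd.differentiableOn one_ne_zero _ (hxy.symm ▸ hx))]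
  have h1 : fderivWithin ℝ (Y ∘ f) (V ∩ D) (h x) =
      ∑ i ∈ t, fderivWithin ℝ (X i ∘ f) (V ∩ D) (h x) := by
    have h2 : ∀ z ∈ V ∩ D, (Y ∘ f) z = ∑ i ∈ t, (X i ∘ f) z := fun z hz =>
      hY _ ((P.mem_iff z hz.1).2 hz.2)
    rw [fderivWithin_congr h2 (h2 _ hy), fderivWithin_fun_sum hu]
    intro i _
    exact (P.comp_hasFDerivWithinAt hy.1 (hd i).hasFDerivWithinAt).differentiableWithinAt
  rw [h1, ContinuousLinearMap.comp_finsetSum, map_sum]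
  exact Finset.sum_congr rfl fun i _ => (P.divM_eq hD hy.1 hy.2 (hd i)).symm

theorem divM_eq_zero_of_eventuallyEq {S : Set (EuclideanSpace ℝ (Fin n))}
    {X : EuclideanSpace ℝ (Fin n) → EuclideanSpace ℝ (Fin n)} {x : EuclideanSpace ℝ (Fin n)}
    (hx : x ∈ S) (hX : X =ᶠ[𝓝[S] x] fun _ => 0) : divM S X x = 0 := by
  simp [divM, nabla, hX.fderivWithin_eq (hX.self_of_nhdsWithin hx)]

/-- The divergence theorem for a vector field supported in a parametrized part. -/
theorem divergence_theorem_local {k : ℕ} {M : Set (EuclideanSpace ℝ (Fin n))}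
    (hMc : IsCompact M) {f : EuclideanSpace ℝ (Fin (k + 1)) → EuclideanSpace ℝ (Fin n)}
    {h : EuclideanSpace ℝ (Fin n) → EuclideanSpace ℝ (Fin (k + 1))}
    {V : Set (EuclideanSpace ℝ (Fin (k + 1)))} {O : Set (EuclideanSpace ℝ (Fin n))}
    (P : IsPatch M (half (k + 1)) f h V O)
    (hb : ∀ x ∈ O, x ∈ M → (x ∈ bdry (k + 1) M ↔ h x 0 = 0))
    (hbc : IsCompact (bdry (k + 1) M))
    {C : Set (EuclideanSpace ℝ (Fin n))} (hC : IsClosed C) (hCO : C ⊆ O)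
    {X ν : EuclideanSpace ℝ (Fin n) → EuclideanSpace ℝ (Fin n)} (hX : ContDiffOn ℝ 1 X M)
    (hXC : ∀ x ∈ M, x ∉ C → X x = 0)
    (hν : ∀ x ∈ bdry (k + 1) M, IsOutwardConormal (k + 1) M x (ν x)) :
    ∫ x in M, (divM M X x + inner ℝ (meanCurvature M x) (X x))
        ∂(Measure.euclideanHausdorffMeasure (k + 1)) =
      ∫ x in bdry (k + 1) M, inner ℝ (X x) (ν x) ∂(Measure.euclideanHausdorffMeasure k) := by
  have P' := P.edge hb
  -- This makes the edge integral left by the half-space and the integral over the boundary patch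
  -- run over the same subset of `ℝᵏ`.
  have hK' : (edgeL k) ⁻¹' (h '' (C ∩ M)) = (tailL k ∘ h) '' (C ∩ bdry (k + 1) M) := by
    ext w
    by_cases hw : edgeL k w ∈ V
    · rw [mem_preimage, P.mem_coord_iff hCO hw (mem_half_succ.2 le_rfl),
        P'.mem_coord_iff hCO hw (mem_univ _)]
      rfl
    · refine iff_of_false (fun h => hw (P.coord_subset hCO h).1)
        fun h => hw (P'.coord_subset hCO h).1
  have hKc := P'.isCompact_coord hbc hC hCO
  have hKV := P'.coord_subset hCO
  have h1 := P.integral_divM_add hMc hC hCO hX hXC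
  have h2 : ∫ x in C ∩ bdry (k + 1) M, inner ℝ (X x) (ν x)
        ∂(Measure.euclideanHausdorffMeasure k) =
      - ∫ w in (edgeL k) ⁻¹' (h '' (C ∩ M)),
          jac (fderiv ℝ f (edgeL k w)) * pinv (fderiv ℝ f (edgeL k w)) (X (f (edgeL k w))) 0 := by
    rw [← P'.image_coord hCO, P'.integral_eq hKc.measurableSet hKV, hK']
    refine Eq.trans ?_ (integral_neg _)
    refine setIntegral_congr_fun hKc.measurableSet fun w hw => ?_
    have hwV := (hKV hw).1
    have h3 := P.flux_eq hb hwV (hν _ ((P'.mem_iff w hwV).2 (mem_univ w)))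
      (X (f (edgeL k w)))
    simpa using h3
  rw [setIntegral_eq_of_subset_of_forall_sdiff_eq_zero hMc.measurableSet
    (inter_subset_right (s := C)), h1, ← h2,
    setIntegral_eq_of_subset_of_forall_sdiff_eq_zero hbc.measurableSet
    (inter_subset_right (s := C))]
  · rintro x ⟨hx, hxC⟩
    rw [hXC x hx.1 fun h => hxC ⟨h, hx⟩, inner_zero_left]
  · rintro x ⟨hx, hxC⟩
    have hxC' : x ∉ C := fun h => hxC ⟨h, hx⟩
    rw [hXC x hx hxC', inner_zero_right, add_zero]
    refine divM_eq_zero_of_eventuallyEq hx ?_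
    filter_upwards [self_mem_nhdsWithin, mem_nhdsWithin_of_mem_nhds
      (hC.isOpen_compl.mem_nhds hxC')] with z hz hz' using hXC z hz hz'

/-- The generalized divergence theorem on a compact submanifold with boundary. -/
theorem divergence_theorem_succ {k : ℕ} {M : Set (EuclideanSpace ℝ (Fin n))}
    (hM : IsSubmanifold (k + 1) M) (hMc : IsCompact M)
    {X ν : EuclideanSpace ℝ (Fin n) → EuclideanSpace ℝ (Fin n)} (hX : ContDiffOn ℝ 1 X M)
    (hν : ∀ x ∈ bdry (k + 1) M, IsOutwardConormal (k + 1) M x (ν x)) :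
    ∫ x in M, (divM M X x + inner ℝ (meanCurvature M x) (X x))
        ∂(Measure.euclideanHausdorffMeasure (k + 1)) =
      ∫ x in bdry (k + 1) M, inner ℝ (X x) (ν x) ∂(Measure.euclideanHausdorffMeasure k) := by
  choose! f h V O P hpO hb using fun p (hp : p ∈ M) => exists_patch_succ hM hp
  obtain ⟨t, ht⟩ := hMc.elim_finite_subcover_image (b := M) (c := O)
    (fun p hp => (P p hp).isOpen_cod) (fun p hp => mem_biUnion hp (hpO p hp))
  obtain ⟨htM, htf, htO⟩ := ht
  have : Fintype t := htf.fintype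
  -- Finitely many patches suffice, so the partition of unity is a finite sum that commutes with the
  -- divergence and with the integrals.
  obtain ⟨ρ, hρ⟩ := SmoothPartitionOfUnity.exists_isSubordinate
    (modelWithCornersSelf ℝ (EuclideanSpace ℝ (Fin n))) hMc.isClosed (fun i : t => O i)
    (fun i => (P i (htM i.2)).isOpen_cod) (by rwa [iUnion_coe_set])
  have hbc := isCompact_bdry hM hMc
  have hpat := hM.hasPatches
  have hpatb := hM.hasPatches_bdry
  let Xi : t → EuclideanSpace ℝ (Fin n) → EuclideanSpace ℝ (Fin n) := fun i x => ρ i x • X x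
  have hXi : ∀ i, ContDiffOn ℝ 1 (Xi i) M := fun i =>
    (((ρ i).contMDiff.contDiff).of_le (by simp)).contDiffOn.smul hX
  have hsum : ∀ x ∈ M, X x = ∑ i, Xi i x := by
    intro x hx
    have := ρ.sum_eq_one hx
    rw [finsum_eq_sum_of_fintype] at this
    rw [← Finset.sum_smul, this, one_smul]
  have hloc : ∀ i : t, ∫ x in M, (divM M (Xi i) x + inner ℝ (meanCurvature M x) (Xi i x))
        ∂(Measure.euclideanHausdorffMeasure (k + 1)) =
      ∫ x in bdry (k + 1) M, inner ℝ (Xi i x) (ν x)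
        ∂(Measure.euclideanHausdorffMeasure k) := by
    intro i
    refine divergence_theorem_local hMc (P i (htM i.2)) (hb i (htM i.2)) hbc
      (isClosed_tsupport (ρ i)) (hρ i) (hXi i) (fun x _ hx => ?_) hν
    simp only [Xi, image_eq_zero_of_notMem_tsupport hx, zero_smul]
  have h1 : ∫ x in M, (divM M X x + inner ℝ (meanCurvature M x) (X x))
        ∂(Measure.euclideanHausdorffMeasure (k + 1)) =
      ∑ i, ∫ x in M, (divM M (Xi i) x + inner ℝ (meanCurvature M x) (Xi i x))
        ∂(Measure.euclideanHausdorffMeasure (k + 1)) := by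
    rw [← integral_finsetSum]
    · refine setIntegral_congr_fun hMc.measurableSet fun x hx => ?_
      rw [hpat.divM_sum hXi hsum hx, Finset.sum_add_distrib, ← inner_sum, ← hsum x hx]
    · intro i _
      exact hpat.integrableOn hMc ((hpat.continuousOn_divM (hXi i)).add
        (hpat.continuousOn_inner_meanCurvature (hXi i).continuousOn))
  have h2 : ∫ x in bdry (k + 1) M, inner ℝ (X x) (ν x)
        ∂(Measure.euclideanHausdorffMeasure k) =
      ∑ i, ∫ x in bdry (k + 1) M, inner ℝ (Xi i x) (ν x)
        ∂(Measure.euclideanHausdorffMeasure k) := by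
    rw [← integral_finsetSum]
    · refine setIntegral_congr_fun hbc.measurableSet fun x hx => ?_
      rw [← sum_inner, ← hsum x hx.1]
    · intro i _
      exact hpatb.integrableOn hbc (continuousOn_inner_conormal hM (hXi i).continuousOn hν)
  rw [h1, h2]
  exact Finset.sum_congr rfl fun i _ => hloc i

theorem divM_eq_zero_of_dim_zero {M : Set (EuclideanSpace ℝ (Fin n))} (hM : HasPatches 0 M)
    {X : EuclideanSpace ℝ (Fin n) → EuclideanSpace ℝ (Fin n)} (hX : ContDiffOn ℝ 1 X M)
    {x : EuclideanSpace ℝ (Fin n)} (hx : x ∈ M) : divM M X x = 0 := by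
  obtain ⟨D, f, h, V, O, hD, P, hxO⟩ := hM x hx
  have hy := P.mem_of_mem hxO hx
  have hxy := (P.right_inv x hxO hx).2
  rw [← hxy, P.divM_eq hD hy.1 hy.2 (hX.differentiableOn one_ne_zero _ (hxy.symm ▸ hx)),
    tr_eq_sum]
  simp

theorem inner_meanCurvature_eq_zero_of_dim_zero {M : Set (EuclideanSpace ℝ (Fin n))}
    (hM : HasPatches 0 M) (v : EuclideanSpace ℝ (Fin n))
    {x : EuclideanSpace ℝ (Fin n)} (hx : x ∈ M) : inner ℝ (meanCurvature M x) v = 0 := by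
  obtain ⟨D, f, h, V, O, hD, P, hxO⟩ := hM x hx
  have hy := P.mem_of_mem hxO hx
  have hxy := (P.right_inv x hxO hx).2
  rw [← hxy, P.inner_meanCurvature_eq hD hy.1 hy.2, tr_eq_sum]
  simp

end

end FirstVariation

/-! ### Smooth families of maps: mixed derivatives, injectivity, derivative of the area integral. -/

namespace FirstVariation

noncomputable section

set_option linter.unusedSectionVars false

section Family

variable {U E : Type*} [NormedAddCommGroup U] [InnerProductSpace ℝ U] [FiniteDimensional ℝ U]
  [NormedAddCommGroup E] [InnerProductSpace ℝ E] [FiniteDimensional ℝ E]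
  {I : Set ℝ} {D : Set U} {F : ℝ × U → E}

/-- The derivative of `F (t, y)` in `y`, for `F` defined on `I × D`. -/
def spaceDeriv (I : Set ℝ) (D : Set U) (F : ℝ × U → E) (q : ℝ × U) : U →L[ℝ] E :=
  fderivWithin ℝ F (I ×ˢ D) q ∘L ContinuousLinearMap.inr ℝ ℝ U

theorem contDiffOn_spaceDeriv (hI : IsOpen I) (hD : UniqueDiffOn ℝ D)
    (hF : ContDiffOn ℝ ∞ F (I ×ˢ D)) : ContDiffOn ℝ ∞ (spaceDeriv I D F) (I ×ˢ D) :=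
  (hF.fderivWithin (hI.uniqueDiffOn.prod hD) (by simp)).clm_comp contDiffOn_const

theorem hasFDerivWithinAt_spaceDeriv (hF : ContDiffOn ℝ ∞ F (I ×ˢ D)) {t : ℝ} (ht : t ∈ I) {y : U}
    (hy : y ∈ D) : HasFDerivWithinAt (fun z => F (t, z)) (spaceDeriv I D F (t, y)) D y := by
  have h1 := (hF.differentiableOn (by simp) (t, y) ⟨ht, hy⟩).hasFDerivWithinAt
  have h2 : HasFDerivWithinAt (fun z : U => (t, z)) (ContinuousLinearMap.inr ℝ ℝ U) D y :=
    (hasFDerivAt_prodMk_right t y).hasFDerivWithinAt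
  exact h1.comp y h2 fun z hz => ⟨ht, hz⟩

/-- As `I` is open, the time derivative is two-sided even where `y` lies on the edge of `D`. -/
theorem hasDerivAt_slice {W : Type*} [NormedAddCommGroup W] [NormedSpace ℝ W] {G : ℝ × U → W}
    {G' : ℝ × U →L[ℝ] W} (hI : IsOpen I) {t : ℝ} (ht : t ∈ I) {y : U} (hy : y ∈ D)
    (hG : HasFDerivWithinAt G G' (I ×ˢ D) (t, y)) :
    HasDerivAt (fun s => G (s, y)) (G' (1, 0)) t := by
  have h2 : HasDerivWithinAt (fun s : ℝ => (s, y)) (1, 0) I t :=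
    ((hasDerivAt_id t).prodMk (hasDerivAt_const t y)).hasDerivWithinAt
  have h3 : MapsTo (fun s : ℝ => (s, y)) I (I ×ˢ D) := fun z hz => ⟨hz, hy⟩
  exact (hG.comp_hasDerivWithinAt t h2 h3).hasDerivAt (hI.mem_nhds ht)

/-- The time derivative of the space derivative is the space derivative of the time derivative. -/
theorem fderivWithin_spaceDeriv (hI : IsOpen I) (hD : UniqueDiffOn ℝ D)
    (hDc : D ⊆ closure (interior D)) (hF : ContDiffOn ℝ ∞ F (I ×ˢ D)) {t : ℝ} (ht : t ∈ I) {y : U}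
    (hy : y ∈ D) :
    fderivWithin ℝ (spaceDeriv I D F) (I ×ˢ D) (t, y) (1, 0) =
      fderivWithin ℝ (fun z => fderivWithin ℝ F (I ×ˢ D) (t, z) (1, 0)) D y := by
  have hu : UniqueDiffOn ℝ (I ×ˢ D) := hI.uniqueDiffOn.prod hD
  have hm : (t, y) ∈ I ×ˢ D := ⟨ht, hy⟩
  have hF' : ContDiffOn ℝ ∞ (fderivWithin ℝ F (I ×ˢ D)) (I ×ˢ D) := hF.fderivWithin hu (by simp)
  have hd := (hF'.differentiableOn (by simp) _ hm).hasFDerivWithinAt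
  -- On the edge of `D`, symmetry of the second derivative is inherited from nearby interior points;
  -- this is the role of `hDc`.
  have hsymm : IsSymmSndFDerivWithinAt ℝ F (I ×ˢ D) (t, y) := by
    refine (hF _ hm).isSymmSndFDerivWithinAt ?_ hu ?_ hm
    · rw [minSmoothness_of_isRCLikeNormedField]
      exact WithTop.coe_le_coe.2 le_top
    · rw [interior_prod_eq, closure_prod_eq, hI.interior_eq]
      exact ⟨subset_closure ht, hDc hy⟩
  ext w
  have h1 : HasFDerivWithinAt (spaceDeriv I D F)
      (((ContinuousLinearMap.compL ℝ U (ℝ × U) E).flip (ContinuousLinearMap.inr ℝ ℝ U)) ∘L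
        fderivWithin ℝ (fderivWithin ℝ F (I ×ˢ D)) (I ×ˢ D) (t, y)) (I ×ˢ D) (t, y) :=
    ((ContinuousLinearMap.compL ℝ U (ℝ × U) E).flip
      (ContinuousLinearMap.inr ℝ ℝ U)).hasFDerivAt.comp_hasFDerivWithinAt _ hd
  have h2 : HasFDerivWithinAt (fun z : U => (t, z)) (ContinuousLinearMap.inr ℝ ℝ U) D y :=
    (hasFDerivAt_prodMk_right t y).hasFDerivWithinAt
  have h3 : HasFDerivWithinAt (fun z => fderivWithin ℝ F (I ×ˢ D) (t, z) (1, 0))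
      ((ContinuousLinearMap.apply ℝ E ((1, 0) : ℝ × U)) ∘L
        (fderivWithin ℝ (fderivWithin ℝ F (I ×ˢ D)) (I ×ˢ D) (t, y) ∘L
          ContinuousLinearMap.inr ℝ ℝ U)) D y :=
    (ContinuousLinearMap.apply ℝ E ((1, 0) : ℝ × U)).hasFDerivAt.comp_hasFDerivWithinAt _
      (hd.comp y h2 fun z hz => ⟨ht, hz⟩)
  rw [h1.fderivWithin (hu _ hm), h3.fderivWithin (hD _ hy)]
  exact hsymm (1, 0) (0, w)

/-- Injective linear maps form an open set, and compactness of `K` makes the range of times uniform.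
-/
theorem eventually_injective_spaceDeriv (hI : IsOpen I) (h0 : (0 : ℝ) ∈ I) (hD : UniqueDiffOn ℝ D)
    (hF : ContDiffOn ℝ ∞ F (I ×ˢ D))
    (hinj : ∀ y ∈ D, Function.Injective (spaceDeriv I D F (0, y)))
    {K : Set U} (hK : IsCompact K) (hKD : K ⊆ D) :
    ∀ᶠ t in 𝓝 (0 : ℝ), ∀ y ∈ K, Function.Injective (spaceDeriv I D F (t, y)) := by
  have : ∀ᶠ t in 𝓝 (0 : ℝ), ∀ y ∈ K, y ∈ D → Function.Injective (spaceDeriv I D F (t, y)) := by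
    refine hK.eventually_forall_of_forall_eventually fun y hy => ?_
    have hc := (contDiffOn_spaceDeriv hI hD hF).continuousOn (0, y) ⟨h0, hKD hy⟩
    have h1 := hc.eventually (ContinuousLinearMap.isOpen_injective.mem_nhds (hinj y (hKD hy)))
    rw [eventually_nhdsWithin_iff] at h1
    filter_upwards [h1, (hI.preimage continuous_fst).mem_nhds (show (0, y) ∈ Prod.fst ⁻¹' I from h0)]
      with z hz hzI hzD using hz ⟨hzI, hzD⟩
  filter_upwards [this] with t ht y hy using ht y hy (hKD hy)

/-- A smooth family of maps starting with an immersion is injective near each point, uniformly for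
small times. -/
theorem eventually_eq_of_eq (hI : IsOpen I) (h0 : (0 : ℝ) ∈ I) (hD : UniqueDiffOn ℝ D)
    (hF : ContDiffOn ℝ ∞ F (I ×ˢ D)) {y₀ : U} (hy₀ : y₀ ∈ D)
    (hconv : ∀ᶠ r in 𝓝[>] (0 : ℝ), Convex ℝ (Metric.ball y₀ r ∩ D))
    (hinj : Function.Injective (spaceDeriv I D F (0, y₀))) :
    ∀ᶠ z : ℝ × U × U in 𝓝 (0, y₀, y₀), z.2.1 ∈ D → z.2.2 ∈ D →
      F (z.1, z.2.1) = F (z.1, z.2.2) → z.2.1 = z.2.2 := by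
  set A := spaceDeriv I D F (0, y₀) with hA
  obtain ⟨c, hc, hAc⟩ := A.toLinearMap.exists_antilipschitzWith (LinearMap.ker_eq_bot.2 hinj)
  have hc' : (0 : ℝ) < c := hc
  have hcont := (contDiffOn_spaceDeriv hI hD hF).continuousOn (0, y₀) ⟨h0, hy₀⟩
  -- If the space derivative stays within `(2 * c)⁻¹` of `A`, the linear approximation errs by at
  -- most half of the lower bound `c⁻¹‖z - y‖` for `‖A (z - y)‖`, so equal values force `z = y`.
  have h1 := hcont.eventually (Metric.ball_mem_nhds A (ε := (2 * c)⁻¹) (by positivity))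
  rw [eventually_nhdsWithin_iff, Metric.eventually_nhds_iff_ball] at h1
  obtain ⟨δ, hδ, h1⟩ := h1
  obtain ⟨δ', hδ', h2⟩ := Metric.isOpen_iff.1 hI 0 h0
  obtain ⟨r, hrconv, hr0, hrδ⟩ := (hconv.and (Ioo_mem_nhdsGT (lt_min hδ hδ'))).exists
  filter_upwards [Metric.ball_mem_nhds _ hr0] with ⟨t, y, z⟩ h hyD hzD heq
  simp only [Metric.mem_ball, Prod.dist_eq, max_lt_iff] at h
  have htI : t ∈ I := h2 (h.1.trans (hrδ.trans_le (min_le_right _ _)))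
  have hb : ∀ x ∈ Metric.ball y₀ r ∩ D, ‖spaceDeriv I D F (t, x) - A‖ ≤ (2 * (c : ℝ))⁻¹ := by
    intro x hx
    have := h1 (t, x) (by
      simp only [Metric.mem_ball, Prod.dist_eq, max_lt_iff]
      exact ⟨h.1.trans (hrδ.trans_le (min_le_left _ _)),
        (Metric.mem_ball.1 hx.1).trans (hrδ.trans_le (min_le_left _ _))⟩) ⟨htI, hx.2⟩
    rw [dist_eq_norm] at this
    exact this.le
  have h3 := hrconv.norm_image_sub_le_of_norm_hasFDerivWithin_le' (𝕜 := ℝ)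
    (f := fun x => F (t, x)) (φ := A)
    (fun x hx => (hasFDerivWithinAt_spaceDeriv hF htI hx.2).mono inter_subset_right) hb
    ⟨h.2.1, hyD⟩ ⟨h.2.2, hzD⟩
  simp only at heq h3
  rw [heq, sub_self, zero_sub, norm_neg] at h3
  have h4 := hAc.le_mul_dist z y
  rw [dist_eq_norm, dist_eq_norm, ← map_sub] at h4
  have h5 : (c : ℝ) * ‖A (z - y)‖ ≤ c * ((2 * (c : ℝ))⁻¹ * ‖z - y‖) := by gcongr
  have h6 : (c : ℝ) * ((2 * (c : ℝ))⁻¹ * ‖z - y‖) = ‖z - y‖ / 2 := by field_simp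
  have h7 : ‖z - y‖ ≤ ‖z - y‖ / 2 := by
    rw [← h6]; exact h4.trans h5
  have h8 : ‖z - y‖ = 0 := le_antisymm (by linarith) (norm_nonneg _)
  exact (sub_eq_zero.1 (norm_eq_zero.1 h8)).symm

variable [MeasurableSpace U] [BorelSpace U]

/-- The derivative of the area in a parametrization. -/
theorem hasDerivAt_integral_jac {μ : Measure U} [IsFiniteMeasureOnCompacts μ]
    (hI : IsOpen I) (h0 : (0 : ℝ) ∈ I) (hD : UniqueDiffOn ℝ D) (hF : ContDiffOn ℝ ∞ F (I ×ˢ D))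
    (hinj : ∀ y ∈ D, Function.Injective (spaceDeriv I D F (0, y)))
    {K K' : Set U} (hK : IsCompact K) (hKD : K ⊆ D) (hK' : MeasurableSet K') (hKK : K' ⊆ K) :
    HasDerivAt (fun t => ∫ y in K', jac (spaceDeriv I D F (t, y)) ∂μ)
      (∫ y in K', jac (spaceDeriv I D F (0, y)) * tr U (pinv (spaceDeriv I D F (0, y)) ∘L
        fderivWithin ℝ (spaceDeriv I D F) (I ×ˢ D) (0, y) (1, 0)) ∂μ) 0 := by
  set A := spaceDeriv I D F with hA
  have hu : UniqueDiffOn ℝ (I ×ˢ D) := hI.uniqueDiffOn.prod hD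
  have hAs : ContDiffOn ℝ ∞ A (I ×ˢ D) := contDiffOn_spaceDeriv hI hD hF
  obtain ⟨δ, hδ, hsub⟩ := Metric.nhds_basis_closedBall.mem_iff.1
    (Filter.inter_mem (eventually_injective_spaceDeriv hI h0 hD hF hinj hK hKD) (hI.mem_nhds h0))
  have hmem : ∀ q ∈ Metric.closedBall (0 : ℝ) δ ×ˢ K, q ∈ I ×ˢ D := fun q hq =>
    ⟨(hsub hq.1).2, hKD hq.2⟩
  have hAi : ∀ q ∈ Metric.closedBall (0 : ℝ) δ ×ˢ K, Function.Injective (A q) := fun q hq =>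
    (hsub hq.1).1 q.2 hq.2
  let B : ℝ × U → ℝ := fun q => fderiv ℝ jac (A q) (fderivWithin ℝ A (I ×ˢ D) q (1, 0))
  have hBc : ContinuousOn B (Metric.closedBall (0 : ℝ) δ ×ˢ K) := by
    refine ContinuousOn.clm_apply (fun q hq => ?_) (ContinuousOn.clm_apply ?_ continuousOn_const)
    · have h1 : ContinuousAt (fderiv ℝ (jac : (U →L[ℝ] E) → ℝ)) (A q) :=
        ((contDiffAt_jac (N := 1) (hAi q hq)).fderiv_right (m := 0) (by simp)).continuousAt
      exact h1.comp_continuousWithinAt ((hAs.continuousOn.mono hmem) q hq)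
    · exact (hAs.continuousOn_fderivWithin hu (by simp)).mono hmem
  have hjc : ∀ t ∈ Metric.closedBall (0 : ℝ) δ, ContinuousOn (fun y => jac (A (t, y))) K :=
    fun t ht => continuous_jac.comp_continuousOn (hAs.continuousOn.comp
      (Continuous.prodMk_right t).continuousOn fun y hy => hmem (t, y) ⟨ht, hy⟩)
  -- A compact time interval times `K` gives a constant dominating the time derivative. The domain
  -- of integration `K'` need only be measurable, which later allows cutting `M` into pieces.
  obtain ⟨C, hC⟩ := ((isCompact_closedBall (0 : ℝ) δ).prod hK).exists_bound_of_continuousOn hBc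
  have h0m : (0 : ℝ) ∈ Metric.closedBall (0 : ℝ) δ := Metric.mem_closedBall_self hδ.le
  have hfin : IsFiniteMeasure (μ.restrict K') :=
    ⟨by simpa using (measure_mono hKK).trans_lt hK.measure_lt_top⟩
  have key := hasDerivAt_integral_of_dominated_loc_of_deriv_le (μ := μ.restrict K')
    (F := fun t y => jac (A (t, y))) (F' := fun t y => B (t, y)) (x₀ := (0 : ℝ))
    (s := Metric.closedBall 0 δ) (bound := fun _ => C) (Metric.closedBall_mem_nhds 0 hδ)
    (by
      filter_upwards [Metric.closedBall_mem_nhds (0 : ℝ) hδ] with t ht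
      exact ((hjc t ht).mono hKK).aestronglyMeasurable hK')
    (((hjc 0 h0m).integrableOn_compact hK).mono_set hKK)
    ((hBc.comp (Continuous.prodMk_right (0 : ℝ)).continuousOn
      fun y hy => ⟨h0m, hKK hy⟩).aestronglyMeasurable hK')
    (by
      filter_upwards [ae_restrict_mem hK'] with y hy t ht using hC (t, y) ⟨ht, hKK hy⟩)
    (integrable_const C)
    (by
      filter_upwards [ae_restrict_mem hK'] with y hy t ht
      have hq : (t, y) ∈ Metric.closedBall (0 : ℝ) δ ×ˢ K := ⟨ht, hKK hy⟩
      have h1 := hasDerivAt_slice hI (hmem _ hq).1 (hmem _ hq).2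
        (hAs.differentiableOn (by simp) _ (hmem _ hq)).hasFDerivWithinAt
      have h2 : HasFDerivAt jac (fderiv ℝ jac (A (t, y))) (A (t, y)) :=
        ((contDiffAt_jac (N := 1) (hAi _ hq)).differentiableAt one_ne_zero).hasFDerivAt
      exact h2.comp_hasDerivAt t h1)
  refine key.2.congr_deriv (setIntegral_congr_fun hK' fun y hy => ?_)
  exact fderiv_jac (hinj y (hKD (hKK hy))) _

end Family

end

end FirstVariation

/-! ### The first variation of area. -/

namespace FirstVariation

noncomputable section

set_option linter.unusedSectionVars false

variable {n m : ℕ} {M : Set (EuclideanSpace ℝ (Fin n))} {I : Set ℝ}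
  {φ : ℝ → EuclideanSpace ℝ (Fin n) → EuclideanSpace ℝ (Fin n)}
  {X : EuclideanSpace ℝ (Fin n) → EuclideanSpace ℝ (Fin n)}
  {f : EuclideanSpace ℝ (Fin m) → EuclideanSpace ℝ (Fin n)}
  {h : EuclideanSpace ℝ (Fin n) → EuclideanSpace ℝ (Fin m)}
  {V : Set (EuclideanSpace ℝ (Fin m))} {O : Set (EuclideanSpace ℝ (Fin n))}

/-- This is what the equality of mixed derivatives up to the edge requires; it holds because the
half-space is convex with interior points. -/
theorem subset_closure_interior_half {V : Set (EuclideanSpace ℝ (Fin m))} (hV : IsOpen V) :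
    V ∩ half m ⊆ closure (interior (V ∩ half m)) := by
  have h1 : (interior (half m)).Nonempty :=
    ⟨WithLp.toLp 2 fun _ => 1, mem_interior_half fun i _ => one_pos⟩
  rw [interior_inter, hV.interior_eq]
  rintro y ⟨hyV, hy⟩
  refine hV.inter_closure ⟨hyV, ?_⟩
  rw [convex_half.closure_interior_eq_closure_of_nonempty_interior h1]
  exact subset_closure hy

namespace IsPatch

theorem contDiffOn_family (P : IsPatch M (half m) f h V O)
    (hφ : ContDiffOn ℝ ∞ (fun q : ℝ × EuclideanSpace ℝ (Fin n) => φ q.1 q.2) (I ×ˢ M)) :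
    ContDiffOn ℝ ∞ (fun q : ℝ × EuclideanSpace ℝ (Fin m) => φ q.1 (f q.2))
      (I ×ˢ (V ∩ half m)) := by
  have h1 : ContDiffOn ℝ ∞ (fun q : ℝ × EuclideanSpace ℝ (Fin m) => (q.1, f q.2))
      (I ×ˢ (V ∩ half m)) :=
    contDiff_fst.contDiffOn.prodMk (P.smooth.comp contDiff_snd.contDiffOn fun q hq => hq.2.1)
  exact hφ.comp h1 fun q hq => ⟨hq.1, (P.mem_iff _ hq.2.1).2 hq.2.2⟩

theorem uniqueDiffOn_dom (P : IsPatch M (half m) f h V O) : UniqueDiffOn ℝ (V ∩ half m) :=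
  fun _ hy => P.uniqueDiffWithinAt uniqueDiffOn_half hy.1 hy.2

theorem spaceDeriv_zero (P : IsPatch M (half m) f h V O) (h0 : (0 : ℝ) ∈ I)
    (hφ : ContDiffOn ℝ ∞ (fun q : ℝ × EuclideanSpace ℝ (Fin n) => φ q.1 q.2) (I ×ˢ M))
    (hφ0 : ∀ p ∈ M, φ 0 p = p) {y : EuclideanSpace ℝ (Fin m)} (hy : y ∈ V ∩ half m) :
    spaceDeriv I (V ∩ half m) (fun q => φ q.1 (f q.2)) (0, y) = fderiv ℝ f y := by
  have h1 := hasFDerivWithinAt_spaceDeriv (P.contDiffOn_family hφ) h0 hy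
  refine (P.uniqueDiffOn_dom y hy).eq h1 ?_
  exact (P.hasFDerivWithinAt hy.1).congr
    (fun z hz => hφ0 _ ((P.mem_iff z hz.1).2 hz.2)) (hφ0 _ ((P.mem_iff y hy.1).2 hy.2))

/-- The velocity is given only pointwise on `M`; as a partial derivative of the family in
coordinates it turns out to be smooth up to the edge. -/
theorem velocity_eq (P : IsPatch M (half m) f h V O) (hI : IsOpen I) (h0 : (0 : ℝ) ∈ I)
    (hφ : ContDiffOn ℝ ∞ (fun q : ℝ × EuclideanSpace ℝ (Fin n) => φ q.1 q.2) (I ×ˢ M))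
    (hX : ∀ p ∈ M, HasDerivAt (fun t => φ t p) (X p) 0) {y : EuclideanSpace ℝ (Fin m)}
    (hy : y ∈ V ∩ half m) :
    (X ∘ f) y = fderivWithin ℝ (fun q : ℝ × EuclideanSpace ℝ (Fin m) => φ q.1 (f q.2))
      (I ×ˢ (V ∩ half m)) (0, y) (1, 0) :=
  (hX _ ((P.mem_iff y hy.1).2 hy.2)).unique (hasDerivAt_slice hI h0 hy
    ((P.contDiffOn_family hφ).differentiableOn (by simp) (0, y) ⟨h0, hy⟩).hasFDerivWithinAt)

/-- The derivative of the area of a piece of the submanifold contained in one parametrized part. -/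
theorem hasDerivAt_area (P : IsPatch M (half m) f h V O) (hMc : IsCompact M)
    (hI : IsOpen I) (h0 : (0 : ℝ) ∈ I)
    (hφ : ContDiffOn ℝ ∞ (fun q : ℝ × EuclideanSpace ℝ (Fin n) => φ q.1 q.2) (I ×ˢ M))
    (hφ0 : ∀ p ∈ M, φ 0 p = p) (hX : ∀ p ∈ M, HasDerivAt (fun t => φ t p) (X p) 0)
    (hXs : ContDiffOn ℝ 1 X M) (hinj : ∀ᶠ t in 𝓝 (0 : ℝ), InjOn (φ t) M)
    {C B : Set (EuclideanSpace ℝ (Fin n))} (hC : IsClosed C) (hCO : C ⊆ O)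
    (hB : MeasurableSet B) (hBC : B ⊆ C ∩ M) :
    (∀ᶠ t in 𝓝 (0 : ℝ), Measure.euclideanHausdorffMeasure m (φ t '' B) < ⊤) ∧
      HasDerivAt (fun t => area m (φ t '' B))
        (∫ x in B, divM M X x ∂(Measure.euclideanHausdorffMeasure m)) 0 := by
  set D := V ∩ half m with hDdef
  set F : ℝ × EuclideanSpace ℝ (Fin m) → EuclideanSpace ℝ (Fin n) := fun q => φ q.1 (f q.2)
    with hFdef
  have hF : ContDiffOn ℝ ∞ F (I ×ˢ D) := P.contDiffOn_family hφ
  have hD : UniqueDiffOn ℝ D := P.uniqueDiffOn_dom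
  have hA0 : ∀ y ∈ D, spaceDeriv I D F (0, y) = fderiv ℝ f y := fun y hy =>
    P.spaceDeriv_zero h0 hφ hφ0 hy
  have hAi : ∀ y ∈ D, Function.Injective (spaceDeriv I D F (0, y)) := fun y hy => by
    rw [hA0 y hy]; exact P.injective hy.1
  set K := h '' (C ∩ M) with hKdef
  have hK : IsCompact K := P.isCompact_coord hMc hC hCO
  have hKD : K ⊆ D := P.coord_subset hCO
  set K' := h '' B with hKdef'
  have hKK : K' ⊆ K := image_mono hBC
  have hfB : f '' K' = B := by
    rw [hKdef', image_image]
    exact (image_congr fun x hx => (P.right_inv x (hCO (hBC hx).1) (hBC hx).2).2).trans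
      (image_id' _)
  have hK' : MeasurableSet K' := by
    refine hB.image_of_continuousOn_injOn
      (P.smooth_inv.continuousOn.mono fun x hx => hCO (hBC hx).1) fun a ha b hb hab => ?_
    rw [← (P.right_inv a (hCO (hBC ha).1) (hBC ha).2).2,
      ← (P.right_inv b (hCO (hBC hb).1) (hBC hb).2).2, hab]
  have himg : ∀ t, φ t '' B = (fun y => F (t, y)) '' K' := fun t => by
    rw [← hfB, image_image]
  have hAs := contDiffOn_spaceDeriv hI hD hF
  have hslice : ∀ t ∈ I, ContinuousOn (fun y => spaceDeriv I D F (t, y)) K := fun t ht =>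
    hAs.continuousOn.comp (Continuous.prodMk_right t).continuousOn fun y hy => ⟨ht, hKD hy⟩
  -- For small `t` the map `φ t ∘ f` is an injective immersion on `K'`: injective by `hinj`, an
  -- immersion by compactness of `K`. So the area formula applies.
  have hev : ∀ᶠ t in 𝓝 (0 : ℝ), Measure.euclideanHausdorffMeasure m (φ t '' B) < ⊤ ∧
      area m (φ t '' B) = ∫ y in K', jac (spaceDeriv I D F (t, y)) := by
    filter_upwards [hI.mem_nhds h0, eventually_injective_spaceDeriv hI h0 hD hF hAi hK hKD, hinj]
      with t ht hti htM
    have h1 := lintegral_jac_eq hK' (f := fun y => F (t, y))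
      (fun y hy => (hasFDerivWithinAt_spaceDeriv hF ht (hKD (hKK hy))).mono (hKK.trans hKD))
      ((hslice t ht).mono hKK) (fun y hy => hti y (hKK hy)) (fun a ha b hb hab => by
        have ha' := hKD (hKK ha)
        have hb' := hKD (hKK hb)
        exact P.injOn ha'.1 hb'.1 (htM ((P.mem_iff a ha'.1).2 ha'.2)
          ((P.mem_iff b hb'.1).2 hb'.2) hab))
    rw [finrank_euclideanSpace_fin, ← himg] at h1
    have h2 : IntegrableOn (fun y => jac (spaceDeriv I D F (t, y))) K' :=
      ((continuous_jac.comp_continuousOn (hslice t ht)).integrableOn_compact hK).mono_set hKK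
    refine ⟨h1 ▸ h2.lintegral_lt_top, ?_⟩
    rw [area, ← h1, integral_eq_lintegral_of_nonneg_ae (.of_forall fun y => jac_nonneg _)
      h2.aestronglyMeasurable]
  refine ⟨hev.mono fun t ht => ht.1, ?_⟩
  have key := hasDerivAt_integral_jac (μ := volume) hI h0 hD hF hAi hK hKD hK' hKK
  refine (key.congr_of_eventuallyEq (hev.mono fun t ht => ht.2)).congr_deriv ?_
  rw [← hfB, P.integral_eq hK' (hKK.trans hKD)]
  refine setIntegral_congr_fun hK' fun y hy => ?_
  have hyD := hKD (hKK hy)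
  have hXd := hXs.differentiableOn one_ne_zero _ ((P.mem_iff y hyD.1).2 hyD.2)
  rw [hA0 y hyD, P.divM_eq uniqueDiffOn_half hyD.1 hyD.2 hXd,
    fderivWithin_spaceDeriv hI hD (subset_closure_interior_half P.isOpen_dom) hF h0 hyD,
    fderivWithin_congr (fun z hz => P.velocity_eq hI h0 hφ hX hz) (P.velocity_eq hI h0 hφ hX hyD)]

end IsPatch

theorem contDiffOn_velocity (hM : IsSubmanifold m M) (hI : IsOpen I) (h0 : (0 : ℝ) ∈ I)
    (hφ : ContDiffOn ℝ ∞ (fun q : ℝ × EuclideanSpace ℝ (Fin n) => φ q.1 q.2) (I ×ˢ M))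
    (hX : ∀ p ∈ M, HasDerivAt (fun t => φ t p) (X p) 0) : ContDiffOn ℝ ∞ X M := by
  intro x hx
  obtain ⟨f, h, V, O, P, hxO, -⟩ := exists_patch hM hx
  refine P.contDiffWithinAt_of_comp hxO hx le_rfl ?_
  have h1 : ContDiffOn ℝ ∞ (fun y => fderivWithin ℝ
      (fun q : ℝ × EuclideanSpace ℝ (Fin m) => φ q.1 (f q.2))
      (I ×ˢ (V ∩ half m)) (0, y) (1, 0)) (V ∩ half m) := by
    refine ContDiffOn.clm_apply ?_ contDiffOn_const
    exact ((P.contDiffOn_family hφ).fderivWithin (hI.uniqueDiffOn.prod P.uniqueDiffOn_dom)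
      (by simp)).comp (contDiff_prodMk_right (0 : ℝ)).contDiffOn fun y hy => ⟨h0, hy⟩
  exact (h1.congr fun y hy => P.velocity_eq hI h0 hφ hX hy) _ (P.mem_of_mem hxO hx)

/-- The maps of a smooth family starting with the identity are injective for small times. -/
theorem eventually_injOn (hM : IsSubmanifold m M) (hMc : IsCompact M) (hI : IsOpen I)
    (h0 : (0 : ℝ) ∈ I)
    (hφ : ContDiffOn ℝ ∞ (fun q : ℝ × EuclideanSpace ℝ (Fin n) => φ q.1 q.2) (I ×ˢ M))
    (hφ0 : ∀ p ∈ M, φ 0 p = p) : ∀ᶠ t in 𝓝 (0 : ℝ), InjOn (φ t) M := by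
  have key : ∀ᶠ t in 𝓝 (0 : ℝ), ∀ z ∈ M ×ˢ M, z.1 ∈ M → z.2 ∈ M → φ t z.1 = φ t z.2 →
      z.1 = z.2 := by
    refine (hMc.prod hMc).eventually_forall_of_forall_eventually ?_
    rintro ⟨p, q⟩ ⟨hp, hq⟩
    simp only at hp hq
    -- Compactness of `M × M` reduces the claim to neighbourhoods of single pairs. On the diagonal,
    -- local injectivity follows from starting at an immersion; off it, the two values differ at
    -- time `0` and continuity keeps them apart.
    by_cases hpq : p = q
    · subst hpq
      obtain ⟨f, h, V, O, P, hpO, -⟩ := exists_patch hM hp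
      have hy := P.mem_of_mem hpO hp
      have hconv : ∀ᶠ r in 𝓝[>] (0 : ℝ), Convex ℝ (Metric.ball (h p) r ∩ (V ∩ half m)) := by
        obtain ⟨δ, hδ, hV⟩ := Metric.isOpen_iff.1 P.isOpen_dom _ hy.1
        filter_upwards [Ioo_mem_nhdsGT hδ] with r hr
        rw [← inter_assoc, inter_eq_left.2 ((Metric.ball_subset_ball hr.2.le).trans hV)]
        exact (convex_ball _ _).inter convex_half
      have h1 := eventually_eq_of_eq hI h0 P.uniqueDiffOn_dom (P.contDiffOn_family hφ) hy hconv
        (by rw [P.spaceDeriv_zero h0 hφ hφ0 hy]; exact P.injective hy.1)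
      have hc := (P.contDiffAt_inv hpO).continuousAt
      have h2 : ContinuousAt (fun z : ℝ × EuclideanSpace ℝ (Fin n) × EuclideanSpace ℝ (Fin n) =>
          (z.1, h z.2.1, h z.2.2)) (0, p, p) :=
        continuousAt_fst.prodMk ((hc.comp_of_eq (by fun_prop) rfl).prodMk
          (hc.comp_of_eq (by fun_prop) rfl))
      have hO : IsOpen {z : ℝ × EuclideanSpace ℝ (Fin n) × EuclideanSpace ℝ (Fin n) |
          z.2.1 ∈ O ∧ z.2.2 ∈ O} :=
        (P.isOpen_cod.preimage (continuous_fst.comp continuous_snd)).inter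
          (P.isOpen_cod.preimage (continuous_snd.comp continuous_snd))
      filter_upwards [h2.eventually h1, hO.mem_nhds ⟨hpO, hpO⟩] with ⟨t, a, b⟩ hz hzO ha hb hab
      have hra := (P.right_inv a hzO.1 ha).2
      have hrb := (P.right_inv b hzO.2 hb).2
      simp only at hz ha hb hab ⊢
      rw [hra, hrb] at hz
      rw [← hra, ← hrb, hz (P.mem_of_mem hzO.1 ha) (P.mem_of_mem hzO.2 hb) hab]
    · have h1 : ContinuousOn (fun z : ℝ × EuclideanSpace ℝ (Fin n) × EuclideanSpace ℝ (Fin n) =>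
          (φ z.1 z.2.1, φ z.1 z.2.2)) (I ×ˢ (M ×ˢ M)) := by
        refine ContinuousOn.prodMk ?_ ?_
        · exact hφ.continuousOn.comp (f := fun z : ℝ × EuclideanSpace ℝ (Fin n) ×
            EuclideanSpace ℝ (Fin n) => (z.1, z.2.1)) (by fun_prop) fun z hz => ⟨hz.1, hz.2.1⟩
        · exact hφ.continuousOn.comp (f := fun z : ℝ × EuclideanSpace ℝ (Fin n) ×
            EuclideanSpace ℝ (Fin n) => (z.1, z.2.2)) (by fun_prop) fun z hz => ⟨hz.1, hz.2.2⟩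
      have h2 := (h1 (0, p, q) ⟨h0, hp, hq⟩).eventually
        (isClosed_diagonal.isOpen_compl.mem_nhds
          (by simpa [hφ0 p hp, hφ0 q hq] using hpq))
      rw [eventually_nhdsWithin_iff] at h2
      filter_upwards [h2, (hI.preimage continuous_fst).mem_nhds
        (show (0, p, q) ∈ Prod.fst ⁻¹' I from h0)] with z hz hzI hz1 hz2 hab
      exact absurd hab (hz ⟨hzI, hz1, hz2⟩)
  filter_upwards [key] with t ht a ha b hb hab using ht (a, b) ⟨ha, hb⟩ ha hb hab

/-- The first variation formula. -/
theorem hasDerivAt_area (hM : IsSubmanifold m M) (hMc : IsCompact M) (hI : IsOpen I)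
    (h0 : (0 : ℝ) ∈ I)
    (hφ : ContDiffOn ℝ ∞ (fun q : ℝ × EuclideanSpace ℝ (Fin n) => φ q.1 q.2) (I ×ˢ M))
    (hφ0 : ∀ p ∈ M, φ 0 p = p) (hX : ∀ p ∈ M, HasDerivAt (fun t => φ t p) (X p) 0) :
    (∀ᶠ t in 𝓝 (0 : ℝ), Measure.euclideanHausdorffMeasure m (φ t '' M) < ⊤) ∧
      HasDerivAt (fun t => area m (φ t '' M))
        (∫ x in M, divM M X x ∂(Measure.euclideanHausdorffMeasure m)) 0 := by
  have hXs : ContDiffOn ℝ 1 X M := (contDiffOn_velocity hM hI h0 hφ hX).of_le (by simp)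
  have hinj := eventually_injOn hM hMc hI h0 hφ hφ0
  have hint : IntegrableOn (divM M X) M (Measure.euclideanHausdorffMeasure m) :=
    hM.hasPatches.integrableOn hMc (hM.hasPatches.continuousOn_divM hXs)
  have hcont : ∀ t ∈ I, ContinuousOn (φ t) M := fun t ht =>
    hφ.continuousOn.comp (Continuous.prodMk_right t).continuousOn fun y hy => ⟨ht, hy⟩
  -- The claim is made for all measurable subsets `B` of a piece, so that for a union of pieces `B`
  -- can be cut into the disjoint parts `B ∩ C` and `B \ C`.
  have key := hMc.induction_on (p := fun s => ∃ C : Set (EuclideanSpace ℝ (Fin n)),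
    MeasurableSet C ∧ s ⊆ C ∧ ∀ B, MeasurableSet B → B ⊆ C ∩ M →
      (∀ᶠ t in 𝓝 (0 : ℝ), Measure.euclideanHausdorffMeasure m (φ t '' B) < ⊤) ∧
      HasDerivAt (fun t => area m (φ t '' B))
        (∫ x in B, divM M X x ∂(Measure.euclideanHausdorffMeasure m)) 0) ?_ ?_ ?_ ?_
  · obtain ⟨C, -, hMC, hC⟩ := key
    exact hC M hMc.measurableSet (subset_inter hMC subset_rfl)
  · refine ⟨∅, MeasurableSet.empty, subset_rfl, fun B _ hB => ?_⟩
    obtain rfl : B = ∅ := subset_empty_iff.1 (hB.trans inter_subset_left)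
    simpa [area] using hasDerivAt_const (0 : ℝ) (0 : ℝ)
  · rintro s t hst ⟨C, hC, hs, H⟩
    exact ⟨C, hC, hst.trans hs, H⟩
  · rintro s t ⟨C, hC, hs, H⟩ ⟨C', hC', hs', H'⟩
    refine ⟨C ∪ C', hC.union hC', union_subset_union hs hs', fun B hB hBC => ?_⟩
    have hB1 : MeasurableSet (B ∩ C) := hB.inter hC
    have hB2 : MeasurableSet (B \ C) := hB.diff hC
    have hBM : B ⊆ M := hBC.trans inter_subset_right
    obtain ⟨a1, a2⟩ := H _ hB1 fun x hx => ⟨hx.2, hBM hx.1⟩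
    obtain ⟨b1, b2⟩ := H' _ hB2 fun x hx => ⟨(hBC hx.1).1.resolve_left hx.2, hBM hx.1⟩
    have hu : ∀ t, φ t '' B = φ t '' (B ∩ C) ∪ φ t '' (B \ C) := fun t => by
      rw [← image_union, inter_union_sdiff]
    refine ⟨?_, ?_⟩
    · filter_upwards [a1, b1] with t ha hb
      rw [hu]
      exact measure_union_lt_top ha hb
    · have hi : ∫ x in B, divM M X x ∂(Measure.euclideanHausdorffMeasure m) =
          (∫ x in B ∩ C, divM M X x ∂(Measure.euclideanHausdorffMeasure m)) +
          ∫ x in B \ C, divM M X x ∂(Measure.euclideanHausdorffMeasure m) :=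
        (integral_inter_add_sdiff hC (hint.mono_set hBM)).symm
      rw [hi]
      refine (a2.add b2).congr_of_eventuallyEq ?_
      filter_upwards [a1, b1, hinj, hI.mem_nhds h0] with t ha hb ht htI
      -- Injectivity of `φ t` on `M` keeps the two images disjoint, so their areas add.
      have hdisj : Disjoint (φ t '' (B ∩ C)) (φ t '' (B \ C)) :=
        disjoint_sdiff_inter.symm.image ht (inter_subset_left.trans hBM) (sdiff_subset.trans hBM)
      have hmeas : MeasurableSet (φ t '' (B \ C)) :=
        hB2.image_of_continuousOn_injOn ((hcont t htI).mono (sdiff_subset.trans hBM))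
          (ht.mono (sdiff_subset.trans hBM))
      simp only [area, Pi.add_apply]
      rw [hu, measure_union hdisj hmeas, ENNReal.toReal_add ha.ne hb.ne]
  · intro x hx
    obtain ⟨f, h, V, O, P, hxO, -⟩ := exists_patch hM hx
    obtain ⟨r, hr, hrO⟩ := Metric.nhds_basis_closedBall.mem_iff.1 (P.isOpen_cod.mem_nhds hxO)
    exact ⟨Metric.closedBall x r, mem_nhdsWithin_of_mem_nhds (Metric.closedBall_mem_nhds x hr),
      Metric.closedBall x r, Metric.isClosed_closedBall.measurableSet, subset_rfl, fun B hB hBC =>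
      P.hasDerivAt_area hMc hI h0 hφ hφ0 hX hXs hinj Metric.isClosed_closedBall hrO hB hBC⟩

/-- The outward conormal exists and is unique at each boundary point. -/
theorem existsUnique_outwardConormal (hM : IsSubmanifold m M) {x : EuclideanSpace ℝ (Fin n)}
    (hx : x ∈ bdry m M) : ∃! v, IsOutwardConormal m M x v := by
  obtain ⟨k, rfl⟩ := Nat.exists_eq_succ_of_ne_zero hx.2.1.ne'
  obtain ⟨f, h, V, O, P, hxO, hb⟩ := exists_patch_succ hM hx.1
  have hy := (P.edge hb).mem_of_mem hxO hx
  have hxy := ((P.edge hb).right_inv x hxO hx).2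
  simp only [Function.comp_apply] at hxy
  have key := P.isOutwardConormal_iff hb hy.1
  simp only [Function.comp_apply, hxy] at key
  exact ⟨_, (key _).2 rfl, fun v hv => (key v).1 hv⟩

end

end FirstVariation

/-! ### The first variation formula and the generalized divergence theorem. -/

theorem mainTheorem7 (n m : ℕ) (M : Set (EuclideanSpace ℝ (Fin n)))
    (hM : FirstVariation.IsSubmanifold m M) (hMc : IsCompact M)
    (ε : ℝ) (hε : 0 < ε)
    (φ : ℝ → EuclideanSpace ℝ (Fin n) → EuclideanSpace ℝ (Fin n))
    (hφ : ContDiffOn ℝ ∞ (fun q : ℝ × EuclideanSpace ℝ (Fin n) => φ q.1 q.2)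
      (Ioo (-ε) ε ×ˢ M))
    (hφ0 : ∀ p ∈ M, φ 0 p = p)
    (X : EuclideanSpace ℝ (Fin n) → EuclideanSpace ℝ (Fin n))
    (hX : ∀ p ∈ M, HasDerivAt (fun t => φ t p) (X p) 0) :
    (∀ᶠ t in 𝓝 (0 : ℝ), Measure.euclideanHausdorffMeasure m (φ t '' M) < ⊤) ∧
    (∀ x ∈ FirstVariation.bdry m M, ∃! v, FirstVariation.IsOutwardConormal m M x v) ∧
    IntegrableOn (FirstVariation.divM M X) M (Measure.euclideanHausdorffMeasure m) ∧
    IntegrableOn (fun x => inner ℝ (FirstVariation.meanCurvature M x) (X x)) M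
      (Measure.euclideanHausdorffMeasure m) ∧
    HasDerivAt (fun t => FirstVariation.area m (φ t '' M))
      (∫ x in M, FirstVariation.divM M X x ∂(Measure.euclideanHausdorffMeasure m)) 0 ∧
    ∀ ν : EuclideanSpace ℝ (Fin n) → EuclideanSpace ℝ (Fin n),
      (∀ x ∈ FirstVariation.bdry m M, FirstVariation.IsOutwardConormal m M x (ν x)) →
      IntegrableOn (fun x => inner ℝ (X x) (ν x)) (FirstVariation.bdry m M)
        (Measure.euclideanHausdorffMeasure (m - 1)) ∧
      ∫ x in M, FirstVariation.divM M X x ∂(Measure.euclideanHausdorffMeasure m) =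
        (∫ x in FirstVariation.bdry m M, inner ℝ (X x) (ν x)
          ∂(Measure.euclideanHausdorffMeasure (m - 1))) -
        ∫ x in M, inner ℝ (FirstVariation.meanCurvature M x) (X x)
          ∂(Measure.euclideanHausdorffMeasure m) := by
  have hI : IsOpen (Ioo (-ε) ε) := isOpen_Ioo
  have h0 : (0 : ℝ) ∈ Ioo (-ε) ε := ⟨neg_lt_zero.2 hε, hε⟩
  have hXs : ContDiffOn ℝ 1 X M :=
    (FirstVariation.contDiffOn_velocity hM hI h0 hφ hX).of_le (by simp)
  have hp := hM.hasPatches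
  have hdiv := hp.integrableOn hMc (hp.continuousOn_divM hXs)
  have hcurv := hp.integrableOn hMc (hp.continuousOn_inner_meanCurvature hXs.continuousOn)
  obtain ⟨hfin, hder⟩ := FirstVariation.hasDerivAt_area hM hMc hI h0 hφ hφ0 hX
  refine ⟨hfin, fun x hx => FirstVariation.existsUnique_outwardConormal hM hx, hdiv, hcurv, hder,
    fun ν hν => ?_⟩
  cases m with
  -- In dimension zero there is no boundary, `m - 1` is truncated to `0`, and both integrands over
  -- `M` vanish.
  | zero =>
    have hb : FirstVariation.bdry 0 M = ∅ :=
      eq_empty_of_forall_notMem fun x hx => lt_irrefl _ hx.2.1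
    rw [hb, setIntegral_empty, zero_sub,
      setIntegral_congr_fun hMc.measurableSet fun x hx =>
        FirstVariation.divM_eq_zero_of_dim_zero hp hXs hx,
      setIntegral_congr_fun hMc.measurableSet fun x hx =>
        FirstVariation.inner_meanCurvature_eq_zero_of_dim_zero hp (X x) hx]
    simp
  | succ k =>
    refine ⟨hM.hasPatches_bdry.integrableOn (FirstVariation.isCompact_bdry hM hMc)
      (FirstVariation.continuousOn_inner_conormal hM hXs.continuousOn hν), ?_⟩
    have h1 := FirstVariation.divergence_theorem_succ hM hMc hXs hν
    rw [integral_add hdiv hcurv] at h1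
    exact eq_sub_of_add_eq h1
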